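/- Spaces are pointed and compactly generated, and $\wedge$ is the smash product. Let $P=\{P(k)\}_{k\ge 1}$ be a (unital, symmetric) operad of pointed spaces with respect to $\wedge$, and let $W$ be a tower of pointed spaces $\cdots\to W_{m+1}\xrightarrow{q}W_m\to\cdots\to W_0$. Let $s\ge 0$ be an integer. Suppose that $P$ acts on $W$: for all $k\ge 1$ and $m_1,\dots,m_k\ge s$ there are pointed maps $$P(k)\wedge W_{m_1}\wedge\cdots\wedge W_{m_k}\to W_{m_1+\cdots+m_k}$$ which strictly commute with the maps $q$ in each variable, are $\Sigma_k$-equivariant, and are associative with respect to the composition of $P$. ($s=1$ means: for all decompositions into positive parts; $s=0$ includes $W_0$.) No unit condition is required. For $t\ge 1$, $m\ge0$ and $n\ge1$ let $\pi_n(W_m,W_{m+t})$ be the set of homotopy classes of commutative squares of pointed maps with top $\alpha_0:S^{n-1}\to W_{m+t}$, bottom $\alpha_1:D^n\to W_m$, left side the inclusion $S^{n-1}\subset D^n$ and right side $q^t:W_{m+t}\to W_m$. Then: 1. $\pi_n(P(k))$ is a group for $n\ge1$ (abelian for $n\ge 2$) and $\pi_n(W_m,W_{m+t})$ is a group for $n\ge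 2$ (abelian for $n\ge 3$). 2. $\pi_*(P)$ is an operad of graded groups (with pointed sets in degree $0$). The symmetric group actions and the unit are induced by those of $P$, and the composition sends classes $[\rho],[\eta_1],\dots,[\eta_k]$ to the class of $D^{a_0}\wedge D^{a_1}\wedge\cdots\wedge D^{a_k}\to P(k)\wedge P(j_1)\wedge\cdots\wedge P(j_k)\to P(j_1+\cdots+j_k)$. 3. $\pi_*(W,W_{+t})=\{\pi_n(W_m,W_{m+t})\}_{m\ge s,\,n\ge1}$ is an algebra over $\pi_*(P)$: there are well-defined operations $$\pi_{n_0}(P(k))\times\prod_{i=1}^k\pi_{n_i}(W_{m_i},W_{m_i+t})\to\pi_n(W_m,W_{m+t}),\qquad n=\sum_{i=0}^k n_i,\quad m=\sum_{i=1}^k m_i,$$ for $n_0\ge0$ and $n_i\ge1$, which vanish if one of the arguments is trivial, are additive in each argument whose degree carries a group structure, and are associative and equivariant, with the Koszul signs. The class of $\rho:(D^{n_0},S^{n_0-1})\to(P(k),\ast)$ and the classes of squares $(\alpha_{i,0},\alpha_{i,1})$ are sent to the class of the following square $(\beta_0,\beta_1)$. Write $D^n\cong D^{n_0}\wedge D^{n_1}\wedge\cdots\wedge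 D^{n_k}$, so that $S^{n-1}$ is the union of the faces $D^{n_0}\wedge\cdots\wedge S^{n_i-1}\wedge\cdots\wedge D^{n_k}$, $0\le i\le k$ (the colimit of the punctured cube of their intersections). Then $\beta_1$ is $\rho\wedge\alpha_{1,1}\wedge\cdots\wedge\alpha_{k,1}$ followed by the action; $\beta_0$ is trivial on the face $i=0$, and on the face $i\ge1$ it is $\rho\wedge\alpha_{1,1}\wedge\cdots\wedge\alpha_{i,0}\wedge\cdots\wedge\alpha_{k,1}$ followed by the action $P(k)\wedge W_{m_1}\wedge\cdots\wedge W_{m_i+t}\wedge\cdots\wedge W_{m_k}\to W_{m+t}$. If, moreover, the unit of $P$ acts on $W$ as the identity, then the unit of $\pi_*(P)$ acts as the identity on $\pi_*(W,W_{+t})$. -/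

import Mathlib

open scoped unitInterval Topology Topology.Homotopy

universe u

noncomputable section

namespace OperadTower

/-! ### Pointed maps out of smash products -/

/-- A pointed map `X ∧ Y 0 ∧ ⋯ ∧ Y (k-1) ⟶ Z`.  The smash product is the quotient of the compactly
generated product by the subspace of all tuples with an entry at the base point; by the universal
property of this quotient, a pointed map out of it is a map on tuples that is continuous for the
compactly generated topology of the product and sends that subspace to the base point. -/
structure SmashMap (X : Type u) [TopologicalSpace X] (x₀ : X) {k : ℕ} (Y : Fin k → Type u)
    [∀ j, TopologicalSpace (Y j)] (y₀ : ∀ j, Y j) (Z : Type u) [tZ : TopologicalSpace Z]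
    (z₀ : Z) where
  /-- The value at `x ∧ y 0 ∧ ⋯ ∧ y (k-1)`. -/
  toFun : X → (∀ j, Y j) → Z
  continuous_toFun :
    Continuous[TopologicalSpace.compactlyGenerated.{u} (X × (∀ j, Y j)), tZ]
      (fun z : X × (∀ j, Y j) => toFun z.1 z.2)
  base_left : ∀ y, toFun x₀ y = z₀
  base_right : ∀ x y, (∃ j, y j = y₀ j) → toFun x y = z₀

instance {X : Type u} [TopologicalSpace X] {x₀ : X} {k : ℕ} {Y : Fin k → Type u}
    [∀ j, TopologicalSpace (Y j)] {y₀ : ∀ j, Y j} {Z : Type u} [TopologicalSpace Z] {z₀ : Z} :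
    CoeFun (SmashMap X x₀ Y y₀ Z z₀) (fun _ => X → (∀ j, Y j) → Z) :=
  ⟨SmashMap.toFun⟩

/-! ### Block decompositions of `{0, …, N-1}` -/

/-- Consecutive blocks of sizes `n 0, n 1, …` fill `{0, …, N-1}`, in lexicographic order. -/
def lexEquiv {k : ℕ} (n : Fin k → ℕ) (N : ℕ) (h : ∑ i, n i = N) : (Σ i, Fin (n i)) ≃ Fin N :=
  finSigmaFinEquiv.trans (finCongr h)

/-- The block permutation sending the `a`-th entry of the `i`-th block (of size `n (θ i)`)
to the `a`-th entry of the `θ i`-th block. -/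
def blockPerm {k : ℕ} (θ : Equiv.Perm (Fin k)) (n : Fin k → ℕ) (N : ℕ) (h : ∑ i, n i = N)
    (h' : ∑ i, n (θ i) = N) : Equiv.Perm (Fin N) :=
  (lexEquiv (fun i => n (θ i)) N h').symm.trans
    ((Equiv.sigmaCongrLeft (β := fun i => Fin (n i)) θ).trans (lexEquiv n N h))

/-- The block sum of permutations. -/
def sumPerm {k : ℕ} (n : Fin k → ℕ) (N : ℕ) (h : ∑ i, n i = N)
    (τ : ∀ i, Equiv.Perm (Fin (n i))) : Equiv.Perm (Fin N) :=
  (lexEquiv n N h).symm.trans ((Equiv.sigmaCongrRight τ).trans (lexEquiv n N h))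

/-- A first block of size `n₀` followed by consecutive blocks of sizes `n 0, n 1, …`. -/
def cubeEquiv {k : ℕ} (n₀ : ℕ) (n : Fin k → ℕ) (N : ℕ) (h : n₀ + ∑ i, n i = N) :
    Fin n₀ ⊕ (Σ i, Fin (n i)) ≃ Fin N :=
  ((Equiv.refl _).sumCongr finSigmaFinEquiv).trans (finSumFinEquiv.trans (finCongr h))

/-- The component in `I^n₀` of a point of `I^N = I^n₀ × I^(n 0) × I^(n 1) × ⋯`. -/
def headBlock {k : ℕ} {n₀ : ℕ} {n : Fin k → ℕ} {N : ℕ} (h : n₀ + ∑ i, n i = N)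
    (x : Fin N → I) : Fin n₀ → I :=
  fun a => x (cubeEquiv n₀ n N h (Sum.inl a))

/-- The component in `I^(n i)` of a point of `I^N = I^n₀ × I^(n 0) × I^(n 1) × ⋯`. -/
def block {k : ℕ} {n₀ : ℕ} {n : Fin k → ℕ} {N : ℕ} (h : n₀ + ∑ i, n i = N) (i : Fin k)
    (x : Fin N → I) : Fin (n i) → I :=
  fun a => x (cubeEquiv n₀ n N h (Sum.inr ⟨i, a⟩))

/-! ### Koszul signs -/

/-- The Koszul sign of reordering elements of degrees `n 0, n 1, …` as
`n (θ 0), n (θ 1), …`. -/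
def koszulSign {k : ℕ} (θ : Equiv.Perm (Fin k)) (n : Fin k → ℕ) : ℤˣ :=
  ∏ p : Fin k × Fin k,
    if p.1 < p.2 ∧ θ p.2 < θ p.1 then (-1) ^ (n (θ p.1) * n (θ p.2)) else 1

/-- The Koszul sign of reordering `x 0, x 1, …, y 0, y 1, …` as `x 0, y 0, x 1, y 1, …`, where
`x i` has degree `a i` and `y i` has degree `c i`. -/
def shuffleSign {k : ℕ} (a c : Fin k → ℕ) : ℤˣ :=
  ∏ p : Fin k × Fin k, if p.1 < p.2 then (-1) ^ (c p.1 * a p.2) else 1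

/-! ### Operads of pointed spaces -/

/-- A (unital, symmetric) operad `P = {P(k)}`, `k ≥ 1`, of pointed spaces with respect to the
smash product.  The symmetric groups act from the left; a right action is a left action through
inverses.  In these terms `θ • p` is the operation
`(x 0, …, x (k-1)) ↦ p (x (θ 0), …, x (θ (k-1)))`. -/
structure PointedOperad where
  /-- The space `P(k)`. -/
  space : ℕ+ → Type u
  [top : ∀ k, TopologicalSpace (space k)]
  /-- The base point of `P(k)`. -/
  base : ∀ k, space k
  /-- The action of the symmetric group. -/
  perm : ∀ k : ℕ+, Equiv.Perm (Fin k) → C(space k, space k)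
  perm_base : ∀ k θ, perm k θ (base k) = base k
  perm_one : ∀ k p, perm k 1 p = p
  perm_mul : ∀ k θ τ p, perm k (θ * τ) p = perm k θ (perm k τ p)
  /-- The unit `S⁰ ⟶ P(1)`, given by its value at the point other than the base point. -/
  one : space 1
  /-- The composition `P(k) ∧ P(j 0) ∧ ⋯ ∧ P(j (k-1)) ⟶ P(l)` for `l = j 0 + ⋯ + j (k-1)`. -/
  comp : ∀ {k : ℕ+} (j : Fin k → ℕ+) (l : ℕ+), ∑ i, (j i : ℕ) = l →
    SmashMap (space k) (base k) (fun i => space (j i)) (fun i => base (j i)) (space l) (base l)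
  one_comp : ∀ (l : ℕ+) (h : ∑ _i : Fin (1 : ℕ+), (l : ℕ) = l) (p : space l),
    comp (fun _ => l) l h one (fun _ => p) = p
  comp_one : ∀ (k : ℕ+) (h : ∑ _i : Fin k, ((1 : ℕ+) : ℕ) = k) (p : space k),
    comp (fun _ => 1) k h p (fun _ => one) = p
  assoc : ∀ {k : ℕ+} (j : Fin k → ℕ+) (l : ℕ+) (hl : ∑ i, (j i : ℕ) = l)
    (r : ∀ i, Fin (j i) → ℕ+) (R : Fin k → ℕ+) (hR : ∀ i, ∑ b, (r i b : ℕ) = R i)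
    (L : ℕ+) (hL : ∑ i, (R i : ℕ) = L)
    (hL' : ∑ c : Fin l, (r ((lexEquiv (fun i => (j i : ℕ)) l hl).symm c).1
      ((lexEquiv (fun i => (j i : ℕ)) l hl).symm c).2 : ℕ) = L)
    (p : space k) (q : ∀ i, space (j i)) (s : ∀ i b, space (r i b)),
    comp (fun c => r ((lexEquiv (fun i => (j i : ℕ)) l hl).symm c).1
        ((lexEquiv (fun i => (j i : ℕ)) l hl).symm c).2) L hL' (comp j l hl p q)
      (fun c => s ((lexEquiv (fun i => (j i : ℕ)) l hl).symm c).1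
        ((lexEquiv (fun i => (j i : ℕ)) l hl).symm c).2) =
    comp R L hL p (fun i => comp (r i) (R i) (hR i) (q i) (s i))
  perm_comp : ∀ {k : ℕ+} (j : Fin k → ℕ+) (l : ℕ+) (hl : ∑ i, (j i : ℕ) = l)
    (θ : Equiv.Perm (Fin k)) (hl' : ∑ i, (j (θ i) : ℕ) = l)
    (p : space k) (q : ∀ i, space (j i)),
    comp j l hl (perm k θ p) q =
      perm l (blockPerm θ (fun i => (j i : ℕ)) l hl hl')
        (comp (fun i => j (θ i)) l hl' p (fun i => q (θ i)))
  comp_perm : ∀ {k : ℕ+} (j : Fin k → ℕ+) (l : ℕ+) (hl : ∑ i, (j i : ℕ) = l)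
    (τ : ∀ i, Equiv.Perm (Fin (j i))) (p : space k) (q : ∀ i, space (j i)),
    comp j l hl p (fun i => perm (j i) (τ i) (q i)) =
      perm l (sumPerm (fun i => (j i : ℕ)) l hl τ) (comp j l hl p q)

attribute [instance] PointedOperad.top

/-! ### Towers of pointed spaces and operad actions on them -/

/-- A tower `⋯ ⟶ W (m+1) ⟶ W m ⟶ ⋯ ⟶ W 0` of pointed spaces. -/
structure Tower where
  /-- The space `W m`. -/
  space : ℕ → Type u
  [top : ∀ m, TopologicalSpace (space m)]
  /-- The base point of `W m`. -/
  base : ∀ m, space m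
  /-- The structure map. -/
  q : ∀ m, C(space (m + 1), space m)
  q_base : ∀ m, q m (base (m + 1)) = base m

attribute [instance] Tower.top

/-- The composite `q^t : W (m+t) ⟶ W m` of structure maps. -/
def Tower.qpow (W : Tower.{u}) (m : ℕ) : ∀ t : ℕ, C(W.space (m + t), W.space m)
  | 0 => ContinuousMap.id _
  | t + 1 => (W.qpow m t).comp (W.q (m + t))

/-- An action of `P` on the tower `W`.  The structure map
`P(k) ∧ W (m 0) ∧ ⋯ ∧ W (m (k-1)) ⟶ W M` is given for every decomposition
`M = m 0 + ⋯ + m (k-1)` into parts that are at least `s` (thus `s = 1` asks for an action for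
all decompositions into positive parts, and `s = 0` for one that involves `W 0` as well). -/
structure TowerAction (P : PointedOperad.{u}) (W : Tower.{u}) (s : ℕ) where
  /-- The structure maps. -/
  act : ∀ {k : ℕ+} (m : Fin k → ℕ) (M : ℕ), ∑ i, m i = M → (∀ i, s ≤ m i) →
    SmashMap (P.space k) (P.base k) (fun i => W.space (m i)) (fun i => W.base (m i))
      (W.space M) (W.base M)
  /-- Strict compatibility with the structure maps of the tower, in all variables. -/
  act_q : ∀ {k : ℕ+} (m d : Fin k → ℕ) (M D : ℕ) (h : ∑ i, m i = M) (hm : ∀ i, s ≤ m i)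
    (h' : ∑ i, (m i + d i) = M + D) (hm' : ∀ i, s ≤ m i + d i)
    (p : P.space k) (w : ∀ i, W.space (m i + d i)),
    W.qpow M D (act (fun i => m i + d i) (M + D) h' hm' p w) =
      act m M h hm p (fun i => W.qpow (m i) (d i) (w i))
  equivariance : ∀ {k : ℕ+} (m : Fin k → ℕ) (M : ℕ) (h : ∑ i, m i = M) (hm : ∀ i, s ≤ m i)
    (θ : Equiv.Perm (Fin k)) (h' : ∑ i, m (θ i) = M) (hm' : ∀ i, s ≤ m (θ i))
    (p : P.space k) (w : ∀ i, W.space (m i)),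
    act m M h hm (P.perm k θ p) w = act (fun i => m (θ i)) M h' hm' p (fun i => w (θ i))
  assoc : ∀ {k : ℕ+} (j : Fin k → ℕ+) (l : ℕ+) (hl : ∑ i, (j i : ℕ) = l)
    (m : ∀ i, Fin (j i) → ℕ) (hm : ∀ i b, s ≤ m i b)
    (M : Fin k → ℕ) (hM : ∀ i, ∑ b, m i b = M i) (hM' : ∀ i, s ≤ M i)
    (T : ℕ) (hT : ∑ i, M i = T)
    (hT' : ∑ c : Fin l, m ((lexEquiv (fun i => (j i : ℕ)) l hl).symm c).1
      ((lexEquiv (fun i => (j i : ℕ)) l hl).symm c).2 = T)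
    (p : P.space k) (q : ∀ i, P.space (j i)) (w : ∀ i b, W.space (m i b)),
    act (fun c => m ((lexEquiv (fun i => (j i : ℕ)) l hl).symm c).1
        ((lexEquiv (fun i => (j i : ℕ)) l hl).symm c).2) T hT' (fun _ => hm _ _)
      (P.comp j l hl p q)
      (fun c => w ((lexEquiv (fun i => (j i : ℕ)) l hl).symm c).1
        ((lexEquiv (fun i => (j i : ℕ)) l hl).symm c).2) =
    act M T hT hM' p (fun i => act (m i) (M i) (hM i) (hm i) (q i) (w i))

/-- The unit of the operad acts as the identity (not part of the definition of an action). -/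
def TowerAction.Unital {P : PointedOperad.{u}} {W : Tower.{u}} {s : ℕ}
    (Φ : TowerAction P W s) : Prop :=
  ∀ (m : ℕ) (hm : s ≤ m) (h : ∑ _i : Fin (1 : ℕ+), m = m) (w : W.space m),
    Φ.act (fun _ => m) m h (fun _ => hm) P.one (fun _ => w) = w

/-! ### Relative homotopy groups of a map -/

section Relative

variable {A B : Type u} [TopologicalSpace A] [TopologicalSpace B]

/-- A commutative square with top `S^(n-1) ⟶ A`, bottom `D^n ⟶ B` and right side `f : A ⟶ B`, all
maps pointed.  The disk `D^n` is the `n`-fold smash power of the interval `(I, 0)`, that is the cube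
`I^n` with the contractible set of points having some coordinate `0` collapsed to the base point,
and `S^(n-1)` is its boundary. -/
@[ext]
structure RelSphere (n : ℕ) (f : C(A, B)) (a₀ : A) where
  /-- The map `D^n ⟶ B`. -/
  disk : C(Fin n → I, B)
  /-- The map `S^(n-1) ⟶ A`. -/
  bdry : C(Cube.boundary (Fin n), A)
  comm : ∀ x, f (bdry x) = disk x
  base : ∀ x : Cube.boundary (Fin n), (∃ i, x.1 i = 0) → bdry x = a₀

namespace RelSphere

variable {n : ℕ} {f : C(A, B)} {a₀ : A}

theorem disk_base (α : RelSphere n f a₀) (x : Fin n → I) (h : ∃ i, x i = 0) :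
    α.disk x = f a₀ := by
  have hx : x ∈ Cube.boundary (Fin n) := by
    obtain ⟨i, hi⟩ := h
    exact ⟨i, Or.inl hi⟩
  exact (α.comm ⟨x, hx⟩).symm.trans (congrArg f (α.base ⟨x, hx⟩ h))

/-- A homotopy through commutative squares of pointed maps. -/
structure IsHomotopy (H : I → RelSphere n f a₀) : Prop where
  disk : Continuous fun z : I × (Fin n → I) => (H z.1).disk z.2
  bdry : Continuous fun z : I × Cube.boundary (Fin n) => (H z.1).bdry z.2

/-- Two squares are homotopic. -/
def Homotopic (α β : RelSphere n f a₀) : Prop :=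
  ∃ H : I → RelSphere n f a₀, IsHomotopy H ∧ H 0 = α ∧ H 1 = β

theorem Homotopic.refl (α : RelSphere n f a₀) : Homotopic α α :=
  ⟨fun _ => α, ⟨α.disk.continuous.comp continuous_snd, α.bdry.continuous.comp continuous_snd⟩,
    rfl, rfl⟩

theorem Homotopic.symm {α β : RelSphere n f a₀} (h : Homotopic α β) : Homotopic β α := by
  obtain ⟨H, hH, h0, h1⟩ := h
  refine ⟨fun t => H (unitInterval.symm t), ⟨?_, ?_⟩, by simpa using h1, by simpa using h0⟩
  · exact hH.disk.comp (((unitInterval.continuous_symm).comp continuous_fst).prodMk continuous_snd)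
  · exact hH.bdry.comp (((unitInterval.continuous_symm).comp continuous_fst).prodMk continuous_snd)

theorem Homotopic.trans {α β γ : RelSphere n f a₀} (h : Homotopic α β) (h' : Homotopic β γ) :
    Homotopic α γ := by
  obtain ⟨H, hH, h0, h1⟩ := h
  obtain ⟨K, hK, k0, k1⟩ := h'
  have e1 : Set.projIcc (0 : ℝ) 1 zero_le_one (2 * (1 / 2)) = 1 := by
    apply Set.projIcc_of_right_le; norm_num
  have e2 : Set.projIcc (0 : ℝ) 1 zero_le_one (2 * (1 / 2) - 1) = 0 := by
    apply Set.projIcc_of_le_left; norm_num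
  have c : Continuous (Set.projIcc (0 : ℝ) 1 zero_le_one) := continuous_projIcc
  refine ⟨fun t => if (t : ℝ) ≤ 1 / 2 then H (Set.projIcc 0 1 zero_le_one (2 * t))
    else K (Set.projIcc 0 1 zero_le_one (2 * t - 1)), ⟨?_, ?_⟩, ?_, ?_⟩
  · have : Continuous fun z : I × (Fin n → I) => if (z.1 : ℝ) ≤ 1 / 2 then
        (H (Set.projIcc 0 1 zero_le_one (2 * z.1))).disk z.2 else
        (K (Set.projIcc 0 1 zero_le_one (2 * z.1 - 1))).disk z.2 := by
      refine Continuous.if_le (hH.disk.comp (((c.comp (f := fun t : I => 2 * (t : ℝ))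
        (by fun_prop)).comp continuous_fst).prodMk continuous_snd))
        (hK.disk.comp (((c.comp (f := fun t : I => 2 * (t : ℝ) - 1)
        (by fun_prop)).comp continuous_fst).prodMk continuous_snd))
        (by fun_prop) (by fun_prop) ?_
      rintro z hz
      simp only [hz, e1, e2, h1, k0]
    refine this.congr fun z => ?_
    split_ifs <;> rfl
  · have : Continuous fun z : I × Cube.boundary (Fin n) => if (z.1 : ℝ) ≤ 1 / 2 then
        (H (Set.projIcc 0 1 zero_le_one (2 * z.1))).bdry z.2 else
        (K (Set.projIcc 0 1 zero_le_one (2 * z.1 - 1))).bdry z.2 := by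
      refine Continuous.if_le (hH.bdry.comp (((c.comp (f := fun t : I => 2 * (t : ℝ))
        (by fun_prop)).comp continuous_fst).prodMk continuous_snd))
        (hK.bdry.comp (((c.comp (f := fun t : I => 2 * (t : ℝ) - 1)
        (by fun_prop)).comp continuous_fst).prodMk continuous_snd))
        (by fun_prop) (by fun_prop) ?_
      rintro z hz
      simp only [hz, e1, e2, h1, k0]
    refine this.congr fun z => ?_
    split_ifs <;> rfl
  · simp [h0]
  · have e : Set.projIcc (0 : ℝ) 1 zero_le_one (2 - 1) = 1 := by
      apply Set.projIcc_of_right_le; norm_num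
    have : ¬ ((1 : ℝ) ≤ 2⁻¹) := by norm_num
    simp [e, k1, this]

instance setoid (n : ℕ) (f : C(A, B)) (a₀ : A) : Setoid (RelSphere n f a₀) :=
  ⟨Homotopic, Homotopic.refl, Homotopic.symm, Homotopic.trans⟩

/-- The constant square. -/
def const (n : ℕ) (f : C(A, B)) (a₀ : A) : RelSphere n f a₀ where
  disk := ContinuousMap.const _ (f a₀)
  bdry := ContinuousMap.const _ a₀
  comm _ := rfl
  base _ _ := rfl

theorem comp_perm_mem (θ : Equiv.Perm (Fin n)) {x : Fin n → I}
    (hx : x ∈ Cube.boundary (Fin n)) : (fun i => x (θ i)) ∈ Cube.boundary (Fin n) := by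
  obtain ⟨i, hi⟩ := hx
  exact ⟨θ.symm i, by simpa using hi⟩

/-- Precomposition with a permutation of the coordinates of the disk. -/
def permute (θ : Equiv.Perm (Fin n)) (α : RelSphere n f a₀) : RelSphere n f a₀ where
  disk := ⟨fun x => α.disk (fun i => x (θ i)), by fun_prop⟩
  bdry := ⟨fun x => α.bdry ⟨fun i => x.1 (θ i), comp_perm_mem θ x.2⟩,
    α.bdry.continuous.comp (Continuous.subtype_mk
      (f := fun x : Cube.boundary (Fin n) => fun i => x.1 (θ i))
      (continuous_pi fun i => (continuous_apply (θ i)).comp continuous_subtype_val) _)⟩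
  comm x := α.comm _
  base x hx := α.base _ (by
    obtain ⟨i, hi⟩ := hx
    exact ⟨θ.symm i, by simpa using hi⟩)

theorem permute_homotopic (θ : Equiv.Perm (Fin n)) {α β : RelSphere n f a₀}
    (h : Homotopic α β) : Homotopic (permute θ α) (permute θ β) := by
  obtain ⟨H, hH, rfl, rfl⟩ := h
  refine ⟨fun t => permute θ (H t), ⟨?_, ?_⟩, rfl, rfl⟩
  · exact hH.disk.comp (g := fun z : I × (Fin n → I) => (H z.1).disk z.2)
      (f := fun z : I × (Fin n → I) => (z.1, fun i => z.2 (θ i))) (by fun_prop)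
  · exact hH.bdry.comp (continuous_fst.prodMk (Continuous.subtype_mk
      (f := fun z : I × Cube.boundary (Fin n) => fun i => z.2.1 (θ i))
      (continuous_pi fun i =>
        (continuous_apply (θ i)).comp (continuous_subtype_val.comp continuous_snd))
      fun z => comp_perm_mem θ z.2.2))

/-- The map `(s, t, …) ↦ (min (2s) t, min (2(t-s)) t, …)` (negative values being replaced by `0`)
of the cube to itself; it sends the half `s ≤ t` onto the cube, and the diagonal `s = t` as well as
the other half to points with second coordinate `0`. -/
def lowerPinch (h : 2 ≤ n) (x : Fin n → I) : Fin n → I :=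
  Function.update (Function.update x ⟨0, by omega⟩
    (Set.projIcc 0 1 zero_le_one (min (2 * (x ⟨0, by omega⟩ : ℝ)) (x ⟨1, by omega⟩))))
    ⟨1, by omega⟩
    (Set.projIcc 0 1 zero_le_one
      (min (2 * ((x ⟨1, by omega⟩ : ℝ) - x ⟨0, by omega⟩)) (x ⟨1, by omega⟩)))

/-- The mirror image `(s, t, …) ↦ (min (2(s-t)) s, min (2t) s, …)` of `lowerPinch`. -/
def upperPinch (h : 2 ≤ n) (x : Fin n → I) : Fin n → I :=
  Function.update (Function.update x ⟨0, by omega⟩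
    (Set.projIcc 0 1 zero_le_one
      (min (2 * ((x ⟨0, by omega⟩ : ℝ) - x ⟨1, by omega⟩)) (x ⟨0, by omega⟩))))
    ⟨1, by omega⟩
    (Set.projIcc 0 1 zero_le_one (min (2 * (x ⟨1, by omega⟩ : ℝ)) (x ⟨0, by omega⟩)))

theorem continuous_lowerPinch (h : 2 ≤ n) : Continuous (lowerPinch h) := by
  unfold lowerPinch
  refine (continuous_id.update _ ?_).update _ ?_ <;>
    exact continuous_projIcc.comp (by fun_prop)

theorem continuous_upperPinch (h : 2 ≤ n) : Continuous (upperPinch h) := by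
  unfold upperPinch
  refine (continuous_id.update _ ?_).update _ ?_ <;>
    exact continuous_projIcc.comp (by fun_prop)

theorem lowerPinch_zero (h : 2 ≤ n) (x : Fin n → I) :
    lowerPinch h x ⟨0, by omega⟩ =
      Set.projIcc 0 1 zero_le_one (min (2 * (x ⟨0, by omega⟩ : ℝ)) (x ⟨1, by omega⟩)) := by
  simp [lowerPinch]

theorem lowerPinch_one (h : 2 ≤ n) (x : Fin n → I) :
    lowerPinch h x ⟨1, by omega⟩ = Set.projIcc 0 1 zero_le_one
      (min (2 * ((x ⟨1, by omega⟩ : ℝ) - x ⟨0, by omega⟩)) (x ⟨1, by omega⟩)) := by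
  simp [lowerPinch]

theorem upperPinch_zero (h : 2 ≤ n) (x : Fin n → I) :
    upperPinch h x ⟨0, by omega⟩ = Set.projIcc 0 1 zero_le_one
      (min (2 * ((x ⟨0, by omega⟩ : ℝ) - x ⟨1, by omega⟩)) (x ⟨0, by omega⟩)) := by
  simp [upperPinch]

theorem upperPinch_one (h : 2 ≤ n) (x : Fin n → I) :
    upperPinch h x ⟨1, by omega⟩ =
      Set.projIcc 0 1 zero_le_one (min (2 * (x ⟨1, by omega⟩ : ℝ)) (x ⟨0, by omega⟩)) := by
  simp [upperPinch]

theorem lowerPinch_of_ne (h : 2 ≤ n) (x : Fin n → I) (i : Fin n) (h0 : i ≠ ⟨0, by omega⟩)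
    (h1 : i ≠ ⟨1, by omega⟩) : lowerPinch h x i = x i := by
  simp [lowerPinch, h0, h1]

theorem upperPinch_of_ne (h : 2 ≤ n) (x : Fin n → I) (i : Fin n) (h0 : i ≠ ⟨0, by omega⟩)
    (h1 : i ≠ ⟨1, by omega⟩) : upperPinch h x i = x i := by
  simp [upperPinch, h0, h1]

theorem projIcc_eq_zero {r : ℝ} (h : r ≤ 0) : Set.projIcc (0 : ℝ) 1 zero_le_one r = 0 :=
  Set.projIcc_of_le_left _ h

theorem projIcc_eq_one {r : ℝ} (h : 1 ≤ r) : Set.projIcc (0 : ℝ) 1 zero_le_one r = 1 :=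
  Set.projIcc_of_right_le _ h

theorem lowerPinch_base (h : 2 ≤ n) (x : Fin n → I)
    (hx : (∃ i, x i = 0) ∨ (x ⟨1, by omega⟩ : ℝ) ≤ x ⟨0, by omega⟩) :
    ∃ i, lowerPinch h x i = 0 := by
  rcases hx with ⟨i, hi⟩ | hx
  · by_cases h0 : i = ⟨0, by omega⟩
    · subst h0
      refine ⟨_, (lowerPinch_zero h x).trans (projIcc_eq_zero ?_)⟩
      simp [hi]
    by_cases h1 : i = ⟨1, by omega⟩
    · subst h1
      refine ⟨_, (lowerPinch_zero h x).trans (projIcc_eq_zero ?_)⟩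
      simp [hi]
    · exact ⟨i, (lowerPinch_of_ne h x i h0 h1).trans hi⟩
  · refine ⟨_, (lowerPinch_one h x).trans (projIcc_eq_zero ((min_le_left _ _).trans ?_))⟩
    linarith

theorem upperPinch_base (h : 2 ≤ n) (x : Fin n → I)
    (hx : (∃ i, x i = 0) ∨ (x ⟨0, by omega⟩ : ℝ) ≤ x ⟨1, by omega⟩) :
    ∃ i, upperPinch h x i = 0 := by
  rcases hx with ⟨i, hi⟩ | hx
  · by_cases h0 : i = ⟨0, by omega⟩
    · subst h0
      refine ⟨_, (upperPinch_one h x).trans (projIcc_eq_zero ?_)⟩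
      simp [hi]
    by_cases h1 : i = ⟨1, by omega⟩
    · subst h1
      refine ⟨_, (upperPinch_one h x).trans (projIcc_eq_zero ?_)⟩
      simp [hi]
    · exact ⟨i, (upperPinch_of_ne h x i h0 h1).trans hi⟩
  · refine ⟨_, (upperPinch_zero h x).trans (projIcc_eq_zero ((min_le_left _ _).trans ?_))⟩
    linarith

theorem lowerPinch_mem (h : 2 ≤ n) (x : Fin n → I) (hx : x ∈ Cube.boundary (Fin n)) :
    lowerPinch h x ∈ Cube.boundary (Fin n) := by
  obtain ⟨i, hi | hi⟩ := hx
  · obtain ⟨j, hj⟩ := lowerPinch_base h x (Or.inl ⟨i, hi⟩)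
    exact ⟨j, Or.inl hj⟩
  by_cases hle : (x ⟨1, by omega⟩ : ℝ) ≤ x ⟨0, by omega⟩
  · obtain ⟨j, hj⟩ := lowerPinch_base h x (Or.inr hle)
    exact ⟨j, Or.inl hj⟩
  push Not at hle
  by_cases h0 : i = ⟨0, by omega⟩
  · subst h0
    have := (x ⟨1, by omega⟩).2.2
    rw [hi] at hle
    simp at hle
    linarith
  by_cases h1 : i = ⟨1, by omega⟩
  · subst h1
    by_cases hs : (1 : ℝ) ≤ 2 * x ⟨0, by omega⟩
    · exact ⟨_, Or.inr ((lowerPinch_zero h x).trans (projIcc_eq_one (by simp [hi, hs])))⟩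
    · refine ⟨_, Or.inr ((lowerPinch_one h x).trans (projIcc_eq_one ?_))⟩
      simp [hi]
      linarith
  · exact ⟨i, Or.inr ((lowerPinch_of_ne h x i h0 h1).trans hi)⟩

theorem upperPinch_mem (h : 2 ≤ n) (x : Fin n → I) (hx : x ∈ Cube.boundary (Fin n)) :
    upperPinch h x ∈ Cube.boundary (Fin n) := by
  obtain ⟨i, hi | hi⟩ := hx
  · obtain ⟨j, hj⟩ := upperPinch_base h x (Or.inl ⟨i, hi⟩)
    exact ⟨j, Or.inl hj⟩
  by_cases hle : (x ⟨0, by omega⟩ : ℝ) ≤ x ⟨1, by omega⟩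
  · obtain ⟨j, hj⟩ := upperPinch_base h x (Or.inr hle)
    exact ⟨j, Or.inl hj⟩
  push Not at hle
  by_cases h0 : i = ⟨0, by omega⟩
  · subst h0
    by_cases hs : (1 : ℝ) ≤ 2 * x ⟨1, by omega⟩
    · exact ⟨_, Or.inr ((upperPinch_one h x).trans (projIcc_eq_one (by simp [hi, hs])))⟩
    · refine ⟨_, Or.inr ((upperPinch_zero h x).trans (projIcc_eq_one ?_))⟩
      simp [hi]
      linarith
  by_cases h1 : i = ⟨1, by omega⟩
  · subst h1
    have := (x ⟨0, by omega⟩).2.2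
    rw [hi] at hle
    simp at hle
    linarith
  · exact ⟨i, Or.inr ((upperPinch_of_ne h x i h0 h1).trans hi)⟩

theorem continuous_pinch_disk {Z : Type*} [TopologicalSpace Z] (h : 2 ≤ n)
    (H K : Z → RelSphere n f a₀)
    (hH : Continuous fun z : Z × (Fin n → I) => (H z.1).disk z.2)
    (hK : Continuous fun z : Z × (Fin n → I) => (K z.1).disk z.2) :
    Continuous fun z : Z × (Fin n → I) =>
      if (z.2 ⟨0, by omega⟩ : ℝ) ≤ z.2 ⟨1, by omega⟩ then (K z.1).disk (lowerPinch h z.2)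
      else (H z.1).disk (upperPinch h z.2) := by
  refine Continuous.if_le
    (hK.comp (continuous_fst.prodMk ((continuous_lowerPinch h).comp continuous_snd)))
    (hH.comp (continuous_fst.prodMk ((continuous_upperPinch h).comp continuous_snd)))
    (by fun_prop) (by fun_prop) fun z hz => ?_
  rw [disk_base _ _ (lowerPinch_base h _ (Or.inr hz.ge)),
    disk_base _ _ (upperPinch_base h _ (Or.inr hz.le))]

theorem continuous_pinch_bdry {Z : Type*} [TopologicalSpace Z] (h : 2 ≤ n)
    (H K : Z → RelSphere n f a₀)
    (hH : Continuous fun z : Z × Cube.boundary (Fin n) => (H z.1).bdry z.2)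
    (hK : Continuous fun z : Z × Cube.boundary (Fin n) => (K z.1).bdry z.2) :
    Continuous fun z : Z × Cube.boundary (Fin n) =>
      if (z.2.1 ⟨0, by omega⟩ : ℝ) ≤ z.2.1 ⟨1, by omega⟩ then
        (K z.1).bdry ⟨lowerPinch h z.2.1, lowerPinch_mem h _ z.2.2⟩
      else (H z.1).bdry ⟨upperPinch h z.2.1, upperPinch_mem h _ z.2.2⟩ := by
  refine Continuous.if_le
    (hK.comp (continuous_fst.prodMk (((continuous_lowerPinch h).comp
      (continuous_subtype_val.comp continuous_snd)).subtype_mk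
        fun z => lowerPinch_mem h _ z.2.2)))
    (hH.comp (continuous_fst.prodMk (((continuous_upperPinch h).comp
      (continuous_subtype_val.comp continuous_snd)).subtype_mk
        fun z => upperPinch_mem h _ z.2.2)))
    (continuous_subtype_val.comp ((continuous_apply _).comp
      (continuous_subtype_val.comp continuous_snd)))
    (continuous_subtype_val.comp ((continuous_apply _).comp
      (continuous_subtype_val.comp continuous_snd))) fun z hz => ?_
  rw [base _ _ (lowerPinch_base h _ (Or.inr hz.ge)),
    base _ _ (upperPinch_base h _ (Or.inr hz.le))]

/-- The sum of two squares for `n ≥ 2`: the disk is pinched along the hyperplane on which its first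
two coordinates agree.  In the coordinates `(c, r)` with
`(s, t) = (r * min (2c) 1, r * min (2-2c) 1)` on the first two factors, in which the base point is
given by `c = 0`, `c = 1` or `r = 0` and the remaining boundary by `r = 1`, this is the usual
concatenation of relative spheres along the coordinate `c`.  As in Mathlib's homotopy groups, the
first half of the sum is the second summand. -/
def add (h : 2 ≤ n) (α β : RelSphere n f a₀) : RelSphere n f a₀ where
  disk := ⟨fun x => if (x ⟨0, by omega⟩ : ℝ) ≤ x ⟨1, by omega⟩ then β.disk (lowerPinch h x)
      else α.disk (upperPinch h x),
    (continuous_pinch_disk (Z := Unit) h (fun _ => α) (fun _ => β)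
      (α.disk.continuous.comp continuous_snd) (β.disk.continuous.comp continuous_snd)).comp
      (Continuous.prodMk_right ())⟩
  bdry := ⟨fun x => if (x.1 ⟨0, by omega⟩ : ℝ) ≤ x.1 ⟨1, by omega⟩ then
        β.bdry ⟨lowerPinch h x.1, lowerPinch_mem h _ x.2⟩
      else α.bdry ⟨upperPinch h x.1, upperPinch_mem h _ x.2⟩,
    (continuous_pinch_bdry (Z := Unit) h (fun _ => α) (fun _ => β)
      (α.bdry.continuous.comp continuous_snd) (β.bdry.continuous.comp continuous_snd)).comp
      (Continuous.prodMk_right ())⟩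
  comm x := by
    simp only [ContinuousMap.coe_mk]
    split_ifs
    · exact β.comm _
    · exact α.comm _
  base x hx := by
    simp only [ContinuousMap.coe_mk]
    split_ifs
    · exact β.base _ (lowerPinch_base h _ (Or.inl hx))
    · exact α.base _ (upperPinch_base h _ (Or.inl hx))

theorem add_homotopic (h : 2 ≤ n) {α α' β β' : RelSphere n f a₀} (hα : Homotopic α α')
    (hβ : Homotopic β β') : Homotopic (add h α β) (add h α' β') := by
  obtain ⟨H, hH, rfl, rfl⟩ := hα
  obtain ⟨K, hK, rfl, rfl⟩ := hβ
  exact ⟨fun t => add h (H t) (K t), ⟨continuous_pinch_disk h H K hH.disk hK.disk,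
    continuous_pinch_bdry h H K hH.bdry hK.bdry⟩, rfl, rfl⟩

end RelSphere

end Relative

/-! ### Graded groups -/

/-- Sets `G n`, for degrees `n ≥ 0`, with a zero element and, in degrees `n ≥ d`, an addition and a
negation (not assumed to be commutative). -/
structure GradedPreGroup (d : ℕ) where
  /-- The elements of degree `n`. -/
  carrier : ℕ → Type u
  /-- The zero element of degree `n`. -/
  zero : ∀ n, carrier n
  /-- Addition in degree `n`. -/
  add : ∀ {n}, d ≤ n → carrier n → carrier n → carrier n
  /-- Negation in degree `n`. -/
  neg : ∀ {n}, d ≤ n → carrier n → carrier n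

namespace GradedPreGroup

variable {d : ℕ}

/-- `G n` is a group for `n ≥ d`, which is abelian for `n ≥ d + 1`. -/
structure IsGroup (G : GradedPreGroup.{u} d) : Prop where
  add_assoc : ∀ {n} (h : d ≤ n) (x y z : G.carrier n),
    G.add h (G.add h x y) z = G.add h x (G.add h y z)
  zero_add : ∀ {n} (h : d ≤ n) (x : G.carrier n), G.add h (G.zero n) x = x
  add_zero : ∀ {n} (h : d ≤ n) (x : G.carrier n), G.add h x (G.zero n) = x
  neg_add : ∀ {n} (h : d ≤ n) (x : G.carrier n), G.add h (G.neg h x) x = G.zero n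
  add_comm : ∀ {n} (h : d ≤ n), d + 1 ≤ n → ∀ x y : G.carrier n, G.add h x y = G.add h y x

/-- The element `e x` for a sign `e`.  In degrees below `d`, where there is no negation, `e` is
ignored; all signs in the axioms below are `1` in such degrees. -/
def signed (G : GradedPreGroup.{u} d) (e : ℤˣ) {n : ℕ} (x : G.carrier n) : G.carrier n :=
  if h : e = -1 ∧ d ≤ n then G.neg h.2 x else x

end GradedPreGroup

/-- An operad structure on the graded groups `G k`, `k ≥ 1` (whose parts of degree `0` are only
pointed sets). All operations are additive in each variable of positive degree; signs follow the
Koszul rule. -/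
structure GradedOperad (G : ℕ+ → GradedPreGroup.{u} 1) where
  isGroup : ∀ k, (G k).IsGroup
  /-- The action of the symmetric group. -/
  perm : ∀ (k : ℕ+) {n : ℕ}, Equiv.Perm (Fin k) → (G k).carrier n → (G k).carrier n
  perm_one : ∀ (k : ℕ+) {n : ℕ} (x : (G k).carrier n), perm k 1 x = x
  perm_mul : ∀ (k : ℕ+) {n : ℕ} (θ τ : Equiv.Perm (Fin k)) (x : (G k).carrier n),
    perm k (θ * τ) x = perm k θ (perm k τ x)
  perm_zero : ∀ (k : ℕ+) (n : ℕ) (θ : Equiv.Perm (Fin k)),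
    perm k θ ((G k).zero n) = (G k).zero n
  perm_add : ∀ (k : ℕ+) {n : ℕ} (h : 1 ≤ n) (θ : Equiv.Perm (Fin k)) (x y : (G k).carrier n),
    perm k θ ((G k).add h x y) = (G k).add h (perm k θ x) (perm k θ y)
  /-- The unit. -/
  one : (G 1).carrier 0
  /-- The composition `G k ⊗ G (j 0) ⊗ ⋯ ⊗ G (j (k-1)) ⟶ G l` for `l = j 0 + ⋯ + j (k-1)`, on
  elements of degrees `a₀, a 0, …, a (k-1)` and with values in degree
  `A = a₀ + a 0 + ⋯ + a (k-1)`. -/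
  comp : ∀ {k : ℕ+} (j : Fin k → ℕ+) (l : ℕ+) (_ : ∑ i, (j i : ℕ) = l)
    {a₀ : ℕ} {a : Fin k → ℕ} (A : ℕ) (_ : a₀ + ∑ i, a i = A),
    (G k).carrier a₀ → (∀ i, (G (j i)).carrier (a i)) → (G l).carrier A
  zero_comp : ∀ {k : ℕ+} (j : Fin k → ℕ+) (l : ℕ+) (hl : ∑ i, (j i : ℕ) = l)
    {a₀ : ℕ} {a : Fin k → ℕ} (A : ℕ) (hA : a₀ + ∑ i, a i = A)
    (y : ∀ i, (G (j i)).carrier (a i)),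
    comp j l hl A hA ((G k).zero a₀) y = (G l).zero A
  comp_zero : ∀ {k : ℕ+} (j : Fin k → ℕ+) (l : ℕ+) (hl : ∑ i, (j i : ℕ) = l)
    {a₀ : ℕ} {a : Fin k → ℕ} (A : ℕ) (hA : a₀ + ∑ i, a i = A)
    (x : (G k).carrier a₀) (y : ∀ i, (G (j i)).carrier (a i)),
    (∃ i, y i = (G (j i)).zero (a i)) → comp j l hl A hA x y = (G l).zero A
  add_comp : ∀ {k : ℕ+} (j : Fin k → ℕ+) (l : ℕ+) (hl : ∑ i, (j i : ℕ) = l)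
    {a₀ : ℕ} {a : Fin k → ℕ} (A : ℕ) (hA : a₀ + ∑ i, a i = A) (h₀ : 1 ≤ a₀) (h : 1 ≤ A)
    (x x' : (G k).carrier a₀) (y : ∀ i, (G (j i)).carrier (a i)),
    comp j l hl A hA ((G k).add h₀ x x') y =
      (G l).add h (comp j l hl A hA x y) (comp j l hl A hA x' y)
  comp_add : ∀ {k : ℕ+} (j : Fin k → ℕ+) (l : ℕ+) (hl : ∑ i, (j i : ℕ) = l)
    {a₀ : ℕ} {a : Fin k → ℕ} (A : ℕ) (hA : a₀ + ∑ i, a i = A) (i : Fin k) (hi : 1 ≤ a i)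
    (h : 1 ≤ A) (x : (G k).carrier a₀) (y : ∀ i, (G (j i)).carrier (a i))
    (z z' : (G (j i)).carrier (a i)),
    comp j l hl A hA x (Function.update y i ((G (j i)).add hi z z')) =
      (G l).add h (comp j l hl A hA x (Function.update y i z))
        (comp j l hl A hA x (Function.update y i z'))
  one_comp : ∀ (l : ℕ+) (h : ∑ _i : Fin (1 : ℕ+), (l : ℕ) = l) (A : ℕ)
    (hA : 0 + ∑ _i : Fin (1 : ℕ+), A = A) (x : (G l).carrier A),
    comp (fun _ => l) l h A hA one (fun _ => x) = x
  comp_one : ∀ (k : ℕ+) (h : ∑ _i : Fin k, ((1 : ℕ+) : ℕ) = k) (A : ℕ)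
    (hA : A + ∑ _i : Fin k, 0 = A) (x : (G k).carrier A),
    comp (fun _ => 1) k h A hA x (fun _ => one) = x
  assoc : ∀ {k : ℕ+} (j : Fin k → ℕ+) (l : ℕ+) (hl : ∑ i, (j i : ℕ) = l)
    (r : ∀ i, Fin (j i) → ℕ+) (R : Fin k → ℕ+) (hR : ∀ i, ∑ b, (r i b : ℕ) = R i)
    (L : ℕ+) (hL : ∑ i, (R i : ℕ) = L)
    (hL' : ∑ c : Fin l, (r ((lexEquiv (fun i => (j i : ℕ)) l hl).symm c).1
      ((lexEquiv (fun i => (j i : ℕ)) l hl).symm c).2 : ℕ) = L)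
    {a₀ : ℕ} {a : Fin k → ℕ} (A : ℕ) (hA : a₀ + ∑ i, a i = A)
    {c : ∀ i, Fin (j i) → ℕ} (C : Fin k → ℕ) (hC : ∀ i, a i + ∑ b, c i b = C i)
    (D : ℕ) (hD : a₀ + ∑ i, C i = D)
    (hD' : A + ∑ e : Fin l, c ((lexEquiv (fun i => (j i : ℕ)) l hl).symm e).1
      ((lexEquiv (fun i => (j i : ℕ)) l hl).symm e).2 = D)
    (x : (G k).carrier a₀) (y : ∀ i, (G (j i)).carrier (a i))
    (z : ∀ i b, (G (r i b)).carrier (c i b)),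
    comp (fun e => r ((lexEquiv (fun i => (j i : ℕ)) l hl).symm e).1
        ((lexEquiv (fun i => (j i : ℕ)) l hl).symm e).2) L hL' D hD' (comp j l hl A hA x y)
      (fun e => z ((lexEquiv (fun i => (j i : ℕ)) l hl).symm e).1
        ((lexEquiv (fun i => (j i : ℕ)) l hl).symm e).2) =
    (G L).signed (shuffleSign a (fun i => ∑ b, c i b))
      (comp R L hL D hD x (fun i => comp (r i) (R i) (hR i) (C i) (hC i) (y i) (z i)))
  perm_comp : ∀ {k : ℕ+} (j : Fin k → ℕ+) (l : ℕ+) (hl : ∑ i, (j i : ℕ) = l)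
    (θ : Equiv.Perm (Fin k)) (hl' : ∑ i, (j (θ i) : ℕ) = l)
    {a₀ : ℕ} {a : Fin k → ℕ} (A : ℕ) (hA : a₀ + ∑ i, a i = A) (hA' : a₀ + ∑ i, a (θ i) = A)
    (x : (G k).carrier a₀) (y : ∀ i, (G (j i)).carrier (a i)),
    comp j l hl A hA (perm k θ x) y =
      (G l).signed (koszulSign θ a)
        (perm l (blockPerm θ (fun i => (j i : ℕ)) l hl hl')
          (comp (fun i => j (θ i)) l hl' A hA' x (fun i => y (θ i))))
  comp_perm : ∀ {k : ℕ+} (j : Fin k → ℕ+) (l : ℕ+) (hl : ∑ i, (j i : ℕ) = l)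
    (τ : ∀ i, Equiv.Perm (Fin (j i))) {a₀ : ℕ} {a : Fin k → ℕ} (A : ℕ)
    (hA : a₀ + ∑ i, a i = A) (x : (G k).carrier a₀) (y : ∀ i, (G (j i)).carrier (a i)),
    comp j l hl A hA x (fun i => perm (j i) (τ i) (y i)) =
      perm l (sumPerm (fun i => (j i : ℕ)) l hl τ) (comp j l hl A hA x y)

/-- The structure of an algebra over the graded operad `O` on the filtered graded groups `E m`:
`E m` is a pointed set in degree `1` and a group in degrees `≥ 2`, as relative homotopy groups are;
degree `0` is not used.  The operations are defined on elements of filtration at least `s`, and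
filtrations add up.  They are additive in each variable in the degrees in which there is a group
structure; signs follow the Koszul rule. -/
structure GradedAlgebra {G : ℕ+ → GradedPreGroup.{u} 1} (O : GradedOperad G)
    (E : ℕ → GradedPreGroup.{u} 2) (s : ℕ) where
  isGroup : ∀ m, (E m).IsGroup
  /-- The operation `G k ⊗ E (m 0) ⊗ ⋯ ⊗ E (m (k-1)) ⟶ E M` for `M = m 0 + ⋯ + m (k-1)`, on elements
  of degrees `n₀, n 0, …, n (k-1)` and with values in degree `N = n₀ + n 0 + ⋯ + n (k-1)`. -/
  act : ∀ {k : ℕ+} (m : Fin k → ℕ) (M : ℕ) (_ : ∑ i, m i = M) (_ : ∀ i, s ≤ m i)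
    {n₀ : ℕ} {n : Fin k → ℕ} (_ : ∀ i, 1 ≤ n i) (N : ℕ) (_ : n₀ + ∑ i, n i = N),
    (G k).carrier n₀ → (∀ i, (E (m i)).carrier (n i)) → (E M).carrier N
  zero_act : ∀ {k : ℕ+} (m : Fin k → ℕ) (M : ℕ) (hM : ∑ i, m i = M) (hm : ∀ i, s ≤ m i)
    {n₀ : ℕ} {n : Fin k → ℕ} (hn : ∀ i, 1 ≤ n i) (N : ℕ) (hN : n₀ + ∑ i, n i = N)
    (y : ∀ i, (E (m i)).carrier (n i)),
    act m M hM hm hn N hN ((G k).zero n₀) y = (E M).zero N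
  act_zero : ∀ {k : ℕ+} (m : Fin k → ℕ) (M : ℕ) (hM : ∑ i, m i = M) (hm : ∀ i, s ≤ m i)
    {n₀ : ℕ} {n : Fin k → ℕ} (hn : ∀ i, 1 ≤ n i) (N : ℕ) (hN : n₀ + ∑ i, n i = N)
    (x : (G k).carrier n₀) (y : ∀ i, (E (m i)).carrier (n i)),
    (∃ i, y i = (E (m i)).zero (n i)) → act m M hM hm hn N hN x y = (E M).zero N
  add_act : ∀ {k : ℕ+} (m : Fin k → ℕ) (M : ℕ) (hM : ∑ i, m i = M) (hm : ∀ i, s ≤ m i)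
    {n₀ : ℕ} {n : Fin k → ℕ} (hn : ∀ i, 1 ≤ n i) (N : ℕ) (hN : n₀ + ∑ i, n i = N)
    (h₀ : 1 ≤ n₀) (h : 2 ≤ N) (x x' : (G k).carrier n₀) (y : ∀ i, (E (m i)).carrier (n i)),
    act m M hM hm hn N hN ((G k).add h₀ x x') y =
      (E M).add h (act m M hM hm hn N hN x y) (act m M hM hm hn N hN x' y)
  act_add : ∀ {k : ℕ+} (m : Fin k → ℕ) (M : ℕ) (hM : ∑ i, m i = M) (hm : ∀ i, s ≤ m i)
    {n₀ : ℕ} {n : Fin k → ℕ} (hn : ∀ i, 1 ≤ n i) (N : ℕ) (hN : n₀ + ∑ i, n i = N)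
    (i : Fin k) (hi : 2 ≤ n i) (h : 2 ≤ N) (x : (G k).carrier n₀)
    (y : ∀ i, (E (m i)).carrier (n i)) (z z' : (E (m i)).carrier (n i)),
    act m M hM hm hn N hN x (Function.update y i ((E (m i)).add hi z z')) =
      (E M).add h (act m M hM hm hn N hN x (Function.update y i z))
        (act m M hM hm hn N hN x (Function.update y i z'))
  equivariance : ∀ {k : ℕ+} (m : Fin k → ℕ) (M : ℕ) (hM : ∑ i, m i = M) (hm : ∀ i, s ≤ m i)
    {n₀ : ℕ} {n : Fin k → ℕ} (hn : ∀ i, 1 ≤ n i) (N : ℕ) (hN : n₀ + ∑ i, n i = N)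
    (θ : Equiv.Perm (Fin k)) (hM' : ∑ i, m (θ i) = M) (hN' : n₀ + ∑ i, n (θ i) = N)
    (x : (G k).carrier n₀) (y : ∀ i, (E (m i)).carrier (n i)),
    act m M hM hm hn N hN (O.perm k θ x) y =
      (E M).signed (koszulSign θ n)
        (act (fun i => m (θ i)) M hM' (fun i => hm (θ i)) (fun i => hn (θ i)) N hN' x
          (fun i => y (θ i)))
  assoc : ∀ {k : ℕ+} (j : Fin k → ℕ+) (l : ℕ+) (hl : ∑ i, (j i : ℕ) = l)
    (m : ∀ i, Fin (j i) → ℕ) (hm : ∀ i b, s ≤ m i b)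
    (M : Fin k → ℕ) (hM : ∀ i, ∑ b, m i b = M i) (hM' : ∀ i, s ≤ M i)
    (T : ℕ) (hT : ∑ i, M i = T)
    (hT' : ∑ e : Fin l, m ((lexEquiv (fun i => (j i : ℕ)) l hl).symm e).1
      ((lexEquiv (fun i => (j i : ℕ)) l hl).symm e).2 = T)
    {a₀ : ℕ} {a : Fin k → ℕ} (A : ℕ) (hA : a₀ + ∑ i, a i = A)
    {n : ∀ i, Fin (j i) → ℕ} (hn : ∀ i b, 1 ≤ n i b)
    (N : Fin k → ℕ) (hN : ∀ i, a i + ∑ b, n i b = N i) (hN' : ∀ i, 1 ≤ N i)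
    (D : ℕ) (hD : a₀ + ∑ i, N i = D)
    (hD' : A + ∑ e : Fin l, n ((lexEquiv (fun i => (j i : ℕ)) l hl).symm e).1
      ((lexEquiv (fun i => (j i : ℕ)) l hl).symm e).2 = D)
    (x : (G k).carrier a₀) (y : ∀ i, (G (j i)).carrier (a i))
    (z : ∀ i b, (E (m i b)).carrier (n i b)),
    act (fun e => m ((lexEquiv (fun i => (j i : ℕ)) l hl).symm e).1
        ((lexEquiv (fun i => (j i : ℕ)) l hl).symm e).2) T hT' (fun _ => hm _ _)
      (fun _ => hn _ _) D hD' (O.comp j l hl A hA x y)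
      (fun e => z ((lexEquiv (fun i => (j i : ℕ)) l hl).symm e).1
        ((lexEquiv (fun i => (j i : ℕ)) l hl).symm e).2) =
    (E T).signed (shuffleSign a (fun i => ∑ b, n i b))
      (act M T hT hM' hN' D hD x
        (fun i => act (m i) (M i) (hM i) (hm i) (hn i) (N i) (hN i) (y i) (z i)))

/-- The unit of the graded operad acts as the identity. -/
def GradedAlgebra.Unital {G : ℕ+ → GradedPreGroup.{u} 1} {O : GradedOperad G}
    {E : ℕ → GradedPreGroup.{u} 2} {s : ℕ} (Γ : GradedAlgebra O E s) : Prop :=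
  ∀ (m : ℕ) (hm : s ≤ m) (hM : ∑ _i : Fin (1 : ℕ+), m = m) (n : ℕ) (hn : 1 ≤ n)
    (hN : 0 + ∑ _i : Fin (1 : ℕ+), n = n) (y : (E m).carrier n),
    Γ.act (fun _ => m) m hM (fun _ => hm) (fun _ => hn) n hN O.one (fun _ => y) = y

/-! ### The graded groups `π_*(P(k))` and `π_*(W, W_{+t})` -/

/-- The homotopy groups of a pointed space, with Mathlib's group structure in positive degrees. -/
def homotopyGroups (X : Type u) [TopologicalSpace X] (x : X) : GradedPreGroup.{u} 1 where
  carrier n := π_ n X x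
  zero _ := ⟦GenLoop.const⟧
  add {n} h a b := haveI : Nonempty (Fin n) := ⟨⟨0, h⟩⟩; (a * b : HomotopyGroup (Fin n) X x)
  neg {n} h a := haveI : Nonempty (Fin n) := ⟨⟨0, h⟩⟩; (a⁻¹ : HomotopyGroup (Fin n) X x)

/-- The relative homotopy groups `π_n(B, A)` of a pointed map `f : A ⟶ B`, for `n ≥ 1`: homotopy
classes of commutative squares, with the group structure in degrees `n ≥ 2`.  The inverse of a
class is obtained by interchanging the first two coordinates of the disk. -/
def relHomotopyGroups {A B : Type u} [TopologicalSpace A] [TopologicalSpace B] (f : C(A, B))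
    (a₀ : A) : GradedPreGroup.{u} 2 where
  carrier n := Quotient (RelSphere.setoid n f a₀)
  zero n := ⟦RelSphere.const n f a₀⟧
  add h := Quotient.map₂ (RelSphere.add h) fun _ _ hα _ _ hβ => RelSphere.add_homotopic h hα hβ
  neg {n} h := Quotient.map (RelSphere.permute (Equiv.swap ⟨0, by omega⟩ ⟨1, by omega⟩))
    fun _ _ hα => RelSphere.permute_homotopic _ hα

/-- The graded groups `π_*(P(k))`. -/
def PointedOperad.pi (P : PointedOperad.{u}) (k : ℕ+) : GradedPreGroup.{u} 1 :=
  homotopyGroups (P.space k) (P.base k)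

/-- The graded groups `π_*(W m, W (m+t))`. -/
def Tower.relPi (W : Tower.{u}) (t m : ℕ) : GradedPreGroup.{u} 2 :=
  relHomotopyGroups (W.qpow m t) (W.base (m + t))

/-- The class in `π_n(P(k))` of a map `(I^n, ∂I^n) ⟶ (P(k), *)`. -/
def PointedOperad.cls (P : PointedOperad.{u}) {k : ℕ+} {n : ℕ}
    (ρ : GenLoop (Fin n) (P.space k) (P.base k)) : (P.pi k).carrier n :=
  (⟦ρ⟧ : HomotopyGroup (Fin n) (P.space k) (P.base k))

/-- The squares representing elements of `π_n(W m, W (m+t))`. -/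
abbrev Tower.Square (W : Tower.{u}) (t m n : ℕ) : Type u :=
  RelSphere n (W.qpow m t) (W.base (m + t))

/-- The class in `π_n(W m, W (m+t))` of a square. -/
def Tower.cls (W : Tower.{u}) {t m n : ℕ} (α : W.Square t m n) : (W.relPi t m).carrier n :=
  (⟦α⟧ : Quotient (RelSphere.setoid n (W.qpow m t) (W.base (m + t))))

/-! ### Representatives of products -/

/-- `γ` is the composite `D^a₀ ∧ D^(a 0) ∧ ⋯ ⟶ P(k) ∧ P(j 0) ∧ ⋯ ⟶ P(l)`. -/
def PointedOperad.IsComp (P : PointedOperad.{u}) {k : ℕ+} (j : Fin k → ℕ+) (l : ℕ+)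
    (hl : ∑ i, (j i : ℕ) = l) {a₀ : ℕ} {a : Fin k → ℕ} {A : ℕ} (hA : a₀ + ∑ i, a i = A)
    (ρ : GenLoop (Fin a₀) (P.space k) (P.base k))
    (η : ∀ i, GenLoop (Fin (a i)) (P.space (j i)) (P.base (j i)))
    (γ : GenLoop (Fin A) (P.space l) (P.base l)) : Prop :=
  ∀ x, γ x = P.comp j l hl (ρ (headBlock hA x)) (fun i => η i (block hA i x))

/-- The filtrations `m` with the `i`-th one raised by `t`. -/
def raise {k : ℕ} (m : Fin k → ℕ) (t : ℕ) (i l : Fin k) : ℕ :=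
  m l + bif decide (l = i) then t else 0

theorem sum_raise {k : ℕ} (m : Fin k → ℕ) (t : ℕ) (i : Fin k) {M : ℕ} (h : ∑ l, m l = M) :
    ∑ l, raise m t i l = M + t := by
  simp [raise, Finset.sum_add_distrib, h, Bool.cond_decide]

theorem le_raise {k s : ℕ} {m : Fin k → ℕ} (t : ℕ) (i : Fin k) (h : ∀ l, s ≤ m l) (l : Fin k) :
    s ≤ raise m t i l :=
  (h l).trans (Nat.le_add_right _ _)

/-- A point of `W (m+t)` if `b` is true, and of `W m` otherwise. -/
def Tower.choosePoint (W : Tower.{u}) (m t : ℕ) : ∀ b : Bool,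
    (b = true → W.space (m + t)) → W.space m → W.space (m + bif b then t else 0)
  | true, hi, _ => hi rfl
  | false, _, lo => lo

/-- The square `β` is the product of `ρ : (D^n₀, S^(n₀-1)) ⟶ (P(k), *)` and the squares `α i`.
Under `D^N = D^n₀ ∧ D^(n 0) ∧ ⋯ ∧ D^(n (k-1))`, the map on the disk is the smash product of the maps
on the disks followed by the action.  The boundary `S^(N-1)` is the union of the faces in which one
of the disks is replaced by its boundary sphere (and the colimit of the punctured cube of all
their intersections); on the face of the disk `D^n₀` the map is trivial, and on the face of the disk
`D^(n i)` it is the smash product of `ρ`, the boundary map of `α i` and the disk maps of the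
other `α l`, followed by the action. -/
structure TowerAction.IsProduct {P : PointedOperad.{u}} {W : Tower.{u}} {s : ℕ}
    (Φ : TowerAction P W s) {t : ℕ} {k : ℕ+} (m : Fin k → ℕ) (M : ℕ) (hM : ∑ i, m i = M)
    (hm : ∀ i, s ≤ m i) {n₀ : ℕ} {n : Fin k → ℕ} {N : ℕ} (hN : n₀ + ∑ i, n i = N)
    (ρ : GenLoop (Fin n₀) (P.space k) (P.base k)) (α : ∀ i, W.Square t (m i) (n i))
    (β : W.Square t M N) : Prop where
  disk : ∀ x, β.disk x =
    Φ.act m M hM hm (ρ (headBlock hN x)) (fun i => (α i).disk (block hN i x))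
  bdry_head : ∀ x : Cube.boundary (Fin N), headBlock hN x.1 ∈ Cube.boundary (Fin n₀) →
    β.bdry x = W.base (M + t)
  bdry_block : ∀ (x : Cube.boundary (Fin N)) (i : Fin k)
    (hi : block hN i x.1 ∈ Cube.boundary (Fin (n i))),
    β.bdry x = Φ.act (raise m t i) (M + t) (sum_raise m t i hM) (le_raise t i hm)
      (ρ (headBlock hN x.1))
      (fun l => W.choosePoint (m l) t (decide (l = i))
        (fun hl => (α l).bdry ⟨block hN l x.1, (of_decide_eq_true hl).symm ▸ hi⟩)
        ((α l).disk (block hN l x.1)))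

end OperadTower

end

noncomputable section

namespace OperadTower

/-! ### Self-maps of the disk -/

/-! Every operation is defined on representatives. There the required identities hold strictly, or
after a permutation of the cube coordinates, or after an explicit homotopy. Three points need an
argument.

Group structures. On the square of two coordinates `i`, `j` of the disk use `(c, r)`, where `r` is
the larger coordinate; the points with `c = 0`, `c = 1` or `r = 0` go to the base point, so squares
can be concatenated along `c` (`addAt`). Unit, inverse and associativity come from reparametrizing
`c`. If one way of shrinking two squares to disjoint supports preserves the two sides used by
another way, both shrinkings can be carried out one after the other, and the two sums become
homotopic (`glue_homotopic_glue`). So one index of the pair can be exchanged for a third one, and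
from `n = 3` on `(i, j)` can be moved to `(j, i)`: the sum is commutative and does not depend on the
pair. The same criterion identifies it with concatenation along a single coordinate whenever that is
defined (`addAt_homotopic_concatAt`); this is the link with the absolute groups. Interchanging `i`
and `j` reverses `c` and therefore inverts a class, so permutations of coordinates act through their
sign (`relHomotopyGroups_permute`, `homotopyGroups_permute`).

Existence of products. The boundary map of a product is prescribed on each face. On the intersection
of two faces both prescriptions are the image under `q^t` of one point of `W (M+t+t)`, obtained by
lifting both factors (`face_eq_face`); this is where strict compatibility of the action with `q` in
all variables enters. The faces form a finite closed cover, so the map is continuous. Structure maps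
are continuous only for the compactly generated topology, which suffices because all sources are
compact Hausdorff (`SmashMap.continuous_comp`).

Laws. Homotopies can be multiplied, so products descend to classes. Sums only involve coordinates of
one block, so additivity holds on representatives once a sum may be formed along any pair of
coordinates (ordered correctly if there are only two). Equivariance and associativity are strict up
to a permutation of coordinates, and counting its inversions gives exactly the Koszul sign
(`sign_blockCubePerm`, `sign_shufflePerm`). -/

/-- A self-map of the disk `D^n`, viewed as a cube, that preserves the base point and the
boundary. -/
structure CubeMap (n : ℕ) where
  /-- The underlying map. -/
  toFun : (Fin n → I) → Fin n → I
  continuous_toFun : Continuous toFun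
  map_zero : ∀ x, (∃ i, x i = 0) → ∃ i, toFun x i = 0
  map_bdry : ∀ x ∈ Cube.boundary (Fin n), toFun x ∈ Cube.boundary (Fin n)

instance (n : ℕ) : CoeFun (CubeMap n) (fun _ => (Fin n → I) → Fin n → I) :=
  ⟨CubeMap.toFun⟩

/-! ### Families of squares, pointwise comparison, and gluing -/

namespace RelSphere

variable {A B : Type u} [TopologicalSpace A] [TopologicalSpace B] {n : ℕ} {f : C(A, B)} {a₀ : A}

/-- A continuous family of squares. -/
structure IsFamily {T : Type*} [TopologicalSpace T] (H : T → RelSphere n f a₀) : Prop where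
  disk : Continuous fun z : T × (Fin n → I) => (H z.1).disk z.2
  bdry : Continuous fun z : T × Cube.boundary (Fin n) => (H z.1).bdry z.2

theorem isFamily_const {T : Type*} [TopologicalSpace T] (α : RelSphere n f a₀) :
    IsFamily fun _ : T => α :=
  ⟨α.disk.continuous.comp continuous_snd, α.bdry.continuous.comp continuous_snd⟩

theorem IsFamily.homotopic {H : I → RelSphere n f a₀} (hH : IsFamily H) :
    Homotopic (H 0) (H 1) :=
  ⟨H, ⟨hH.disk, hH.bdry⟩, rfl, rfl⟩

/-- The square `α` takes the base point as its value at `x`. -/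
def BaseAt (α : RelSphere n f a₀) (x : Fin n → I) : Prop :=
  α.disk x = f a₀ ∧ ∀ hx : x ∈ Cube.boundary (Fin n), α.bdry ⟨x, hx⟩ = a₀

theorem baseAt_of_zero (α : RelSphere n f a₀) {x : Fin n → I} (hx : ∃ i, x i = 0) :
    BaseAt α x :=
  ⟨α.disk_base x hx, fun _ => α.base _ hx⟩

/-- Two squares take the same value at `x`. -/
def EqAt (α β : RelSphere n f a₀) (x : Fin n → I) : Prop :=
  α.disk x = β.disk x ∧ ∀ hx : x ∈ Cube.boundary (Fin n), α.bdry ⟨x, hx⟩ = β.bdry ⟨x, hx⟩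

theorem EqAt.rfl {α : RelSphere n f a₀} {x : Fin n → I} : EqAt α α x :=
  ⟨Eq.refl _, fun _ => Eq.refl _⟩

theorem EqAt.symm {α β : RelSphere n f a₀} {x : Fin n → I} (h : EqAt α β x) : EqAt β α x :=
  ⟨h.1.symm, fun hx => (h.2 hx).symm⟩

theorem EqAt.trans {α β γ : RelSphere n f a₀} {x : Fin n → I} (h : EqAt α β x)
    (h' : EqAt β γ x) : EqAt α γ x :=
  ⟨h.1.trans h'.1, fun hx => (h.2 hx).trans (h'.2 hx)⟩

theorem EqAt.baseAt {α β : RelSphere n f a₀} {x : Fin n → I} (h : EqAt α β x)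
    (hβ : BaseAt β x) : BaseAt α x :=
  ⟨h.1.trans hβ.1, fun hx => (h.2 hx).trans (hβ.2 hx)⟩

theorem BaseAt.eqAt {α β : RelSphere n f a₀} {x : Fin n → I} (hα : BaseAt α x)
    (hβ : BaseAt β x) : EqAt α β x :=
  ⟨hα.1.trans hβ.1.symm, fun hx => (hα.2 hx).trans (hβ.2 hx).symm⟩

theorem ext_eqAt {α β : RelSphere n f a₀} (h : ∀ x, EqAt α β x) : α = β := by
  ext
  · exact (h _).1
  · exact (h _).2 _

theorem baseAt_const (x : Fin n → I) : BaseAt (const n f a₀) x :=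
  ⟨rfl, fun _ => rfl⟩

theorem eq_const {α : RelSphere n f a₀} (h : ∀ x, BaseAt α x) : α = const n f a₀ :=
  ext_eqAt fun x => (h x).eqAt (baseAt_const x)

/-- Precomposition with a self-map of the disk. -/
def precomp (α : RelSphere n f a₀) (φ : CubeMap n) : RelSphere n f a₀ where
  disk := ⟨fun x => α.disk (φ x), α.disk.continuous.comp φ.continuous_toFun⟩
  bdry := ⟨fun x => α.bdry ⟨φ x, φ.map_bdry _ x.2⟩,
    α.bdry.continuous.comp ((φ.continuous_toFun.comp continuous_subtype_val).subtype_mk _)⟩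
  comm _ := α.comm _
  base _ hx := α.base _ (φ.map_zero _ hx)

theorem precomp_eqAt (α : RelSphere n f a₀) {φ ψ : CubeMap n} {x : Fin n → I}
    (h : φ x = ψ x) : EqAt (α.precomp φ) (α.precomp ψ) x := by
  refine ⟨congrArg α.disk h, fun hx => congrArg α.bdry (Subtype.ext h)⟩

theorem EqAt.precomp {α β : RelSphere n f a₀} {φ : CubeMap n} {x : Fin n → I}
    (h : EqAt α β (φ x)) : EqAt (α.precomp φ) (β.precomp φ) x :=
  ⟨h.1, fun _ => h.2 _⟩

theorem precomp_precomp_eqAt (α : RelSphere n f a₀) {φ ψ χ : CubeMap n} {x : Fin n → I}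
    (h : φ (ψ x) = χ x) : EqAt ((α.precomp φ).precomp ψ) (α.precomp χ) x :=
  ⟨congrArg α.disk h, fun _ => congrArg α.bdry (Subtype.ext h)⟩

theorem precomp_baseAt {α : RelSphere n f a₀} {φ : CubeMap n} {x : Fin n → I}
    (h : BaseAt α (φ x)) : BaseAt (α.precomp φ) x :=
  ⟨h.1, fun _ => h.2 _⟩

theorem precomp_eq_self (α : RelSphere n f a₀) {φ : CubeMap n} (h : ∀ x, φ x = x) :
    α.precomp φ = α :=
  ext_eqAt fun x => ⟨congrArg α.disk (h x), fun _ => congrArg α.bdry (Subtype.ext (h x))⟩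

theorem IsFamily.precomp {T : Type*} [TopologicalSpace T] {H : T → RelSphere n f a₀}
    (hH : IsFamily H) {φ : T → CubeMap n}
    (hφ : Continuous fun z : T × (Fin n → I) => φ z.1 z.2) :
    IsFamily fun t => (H t).precomp (φ t) := by
  constructor
  · exact hH.disk.comp (continuous_fst.prodMk hφ)
  · exact hH.bdry.comp (continuous_fst.prodMk ((hφ.comp
      (continuous_fst.prodMk (continuous_subtype_val.comp continuous_snd))).subtype_mk
      fun z => (φ z.1).map_bdry _ z.2.2))

/-- Both pieces are at the base point where `g` vanishes, so the two formulas match along the cut.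
The parameter space makes this serve both for a single glued square and for homotopies of glued
squares. -/
theorem IsFamily.glue_aux {T : Type*} [TopologicalSpace T] {H K : T → RelSphere n f a₀}
    (hH : IsFamily H) (hK : IsFamily K) {g : T → (Fin n → I) → ℝ}
    (hg : Continuous fun z : T × (Fin n → I) => g z.1 z.2)
    (hH0 : ∀ t x, g t x = 0 → BaseAt (H t) x) (hK0 : ∀ t x, g t x = 0 → BaseAt (K t) x) :
    (Continuous fun z : T × (Fin n → I) =>
      if g z.1 z.2 ≤ 0 then (K z.1).disk z.2 else (H z.1).disk z.2) ∧
    Continuous fun z : T × Cube.boundary (Fin n) =>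
      if g z.1 z.2.1 ≤ 0 then (K z.1).bdry z.2 else (H z.1).bdry z.2 := by
  constructor
  · exact Continuous.if_le hK.disk hH.disk hg continuous_const fun z hz =>
      (hK0 _ _ hz).1.trans (hH0 _ _ hz).1.symm
  · exact Continuous.if_le hK.bdry hH.bdry (hg.comp
      (continuous_fst.prodMk (continuous_subtype_val.comp continuous_snd))) continuous_const
      fun z hz => ((hK0 _ _ hz).2 z.2.2).trans ((hH0 _ _ hz).2 z.2.2).symm

/-- The square that agrees with `β` where `g ≤ 0` and with `α` where `g > 0`. -/
def glue (g : (Fin n → I) → ℝ) (hg : Continuous g) (α β : RelSphere n f a₀)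
    (hα : ∀ x, g x = 0 → BaseAt α x) (hβ : ∀ x, g x = 0 → BaseAt β x) : RelSphere n f a₀ where
  disk := ⟨fun x => if g x ≤ 0 then β.disk x else α.disk x,
    (IsFamily.glue_aux (T := Unit) (isFamily_const α) (isFamily_const β) (g := fun _ => g)
      (hg.comp continuous_snd) (fun _ => hα) (fun _ => hβ)).1.comp (Continuous.prodMk_right ())⟩
  bdry := ⟨fun x => if g x.1 ≤ 0 then β.bdry x else α.bdry x,
    (IsFamily.glue_aux (T := Unit) (isFamily_const α) (isFamily_const β) (g := fun _ => g)
      (hg.comp continuous_snd) (fun _ => hα) (fun _ => hβ)).2.comp (Continuous.prodMk_right ())⟩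
  comm x := by
    simp only [ContinuousMap.coe_mk]
    split_ifs
    · exact β.comm _
    · exact α.comm _
  base x hx := by
    simp only [ContinuousMap.coe_mk]
    split_ifs
    · exact β.base _ hx
    · exact α.base _ hx

section glue

variable {g : (Fin n → I) → ℝ} {hg : Continuous g} {α β : RelSphere n f a₀}
  {hα : ∀ x, g x = 0 → BaseAt α x} {hβ : ∀ x, g x = 0 → BaseAt β x}

theorem glue_eqAt_of_le {x : Fin n → I} (hx : g x ≤ 0) : EqAt (glue g hg α β hα hβ) β x :=
  ⟨if_pos hx, fun _ => if_pos hx⟩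

theorem glue_eqAt_of_lt {x : Fin n → I} (hx : 0 < g x) : EqAt (glue g hg α β hα hβ) α x :=
  ⟨if_neg hx.not_ge, fun _ => if_neg hx.not_ge⟩

/-- The asymmetric choice at `g = 0` is harmless, since both squares take the base point there. -/
theorem glue_eqAt_of_ge {x : Fin n → I} (hx : 0 ≤ g x) : EqAt (glue g hg α β hα hβ) α x := by
  rcases hx.lt_or_eq with h | h
  · exact glue_eqAt_of_lt h
  · exact (glue_eqAt_of_le h.ge).trans ((hβ x h.symm).eqAt (hα x h.symm))

theorem glue_congr {α' β' : RelSphere n f a₀} (h : α = α') (h' : β = β') :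
    glue g hg α β hα hβ = glue g hg α' β' (h ▸ hα) (h' ▸ hβ) := by
  subst h h'
  rfl

theorem glue_eq {γ : RelSphere n f a₀} (h : ∀ x, g x ≤ 0 → EqAt β γ x)
    (h' : ∀ x, 0 ≤ g x → EqAt α γ x) : glue g hg α β hα hβ = γ :=
  ext_eqAt fun x => (le_total (g x) 0).elim (fun hx => (glue_eqAt_of_le hx).trans (h x hx))
    (fun hx => (glue_eqAt_of_ge hx).trans (h' x hx))

end glue

theorem IsFamily.glue {T : Type*} [TopologicalSpace T] {H K : T → RelSphere n f a₀}
    (hH : IsFamily H) (hK : IsFamily K) {g : T → (Fin n → I) → ℝ}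
    (hg : Continuous fun z : T × (Fin n → I) => g z.1 z.2)
    (hH0 : ∀ t x, g t x = 0 → BaseAt (H t) x) (hK0 : ∀ t x, g t x = 0 → BaseAt (K t) x) :
    IsFamily fun t => RelSphere.glue (g t) (hg.comp (Continuous.prodMk_right t)) (H t) (K t)
      (hH0 t) (hK0 t) :=
  ⟨(IsFamily.glue_aux hH hK hg hH0 hK0).1, (IsFamily.glue_aux hH hK hg hH0 hK0).2⟩

/-- Two sums, obtained by shrinking the supports of `α` and `β` to the two sides of `g = 0` and
of `h = 0`, respectively, are homotopic if the second shrinking respects the sides of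
`g = 0`. -/
theorem glue_homotopic_glue {α β : RelSphere n f a₀} {g h : (Fin n → I) → ℝ}
    (hg : Continuous g) (hh : Continuous h) {u l d m : I → CubeMap n}
    (hu : Continuous fun z : I × (Fin n → I) => u z.1 z.2)
    (hl : Continuous fun z : I × (Fin n → I) => l z.1 z.2)
    (hd : Continuous fun z : I × (Fin n → I) => d z.1 z.2)
    (hm : Continuous fun z : I × (Fin n → I) => m z.1 z.2)
    (hu0 : ∀ x, u 0 x = x) (hl0 : ∀ x, l 0 x = x) (hd0 : ∀ x, d 0 x = x) (hm0 : ∀ x, m 0 x = x)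
    (hgu : ∀ x, g x ≤ 0 → BaseAt α (u 1 x)) (hgl : ∀ x, 0 ≤ g x → BaseAt β (l 1 x))
    (hhd : ∀ t x, h x ≤ 0 → BaseAt α (u t (d 1 x)))
    (hhm : ∀ t x, 0 ≤ h x → BaseAt β (l t (m 1 x)))
    (hgd : ∀ t x, g x ≤ 0 → g (d t x) ≤ 0) (hgm : ∀ t x, 0 ≤ g x → 0 ≤ g (m t x))
    (c₁ : ∀ x, g x = 0 → BaseAt (α.precomp (u 1)) x)
    (c₂ : ∀ x, g x = 0 → BaseAt (β.precomp (l 1)) x)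
    (c₃ : ∀ x, h x = 0 → BaseAt (α.precomp (d 1)) x)
    (c₄ : ∀ x, h x = 0 → BaseAt (β.precomp (m 1)) x) :
    Homotopic (glue g hg (α.precomp (u 1)) (β.precomp (l 1)) c₁ c₂)
      (glue h hh (α.precomp (d 1)) (β.precomp (m 1)) c₃ c₄) := by
  -- Carry out both shrinkings. During the homotopy `F` the second one is switched on while the cut
  -- stays at `g = 0`; during `G` the first one is switched on while the cut stays at `h = 0`. These
  -- four facts make both families well defined along their cuts.
  have b₁ : ∀ t x, g x ≤ 0 → BaseAt ((α.precomp (u 1)).precomp (d t)) x := fun t x hx =>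
    precomp_baseAt (precomp_baseAt (hgu _ (hgd t x hx)))
  have b₂ : ∀ t x, 0 ≤ g x → BaseAt ((β.precomp (l 1)).precomp (m t)) x := fun t x hx =>
    precomp_baseAt (precomp_baseAt (hgl _ (hgm t x hx)))
  have b₃ : ∀ t x, h x ≤ 0 → BaseAt ((α.precomp (u t)).precomp (d 1)) x := fun t x hx =>
    precomp_baseAt (precomp_baseAt (hhd t x hx))
  have b₄ : ∀ t x, 0 ≤ h x → BaseAt ((β.precomp (l t)).precomp (m 1)) x := fun t x hx =>
    precomp_baseAt (precomp_baseAt (hhm t x hx))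
  have e : ∀ φ : CubeMap n, Continuous fun z : I × (Fin n → I) => φ z.2 := fun φ =>
    φ.continuous_toFun.comp continuous_snd
  have F := (((isFamily_const (T := I) α).precomp (e (u 1))).precomp hd).glue
    (((isFamily_const (T := I) β).precomp (e (l 1))).precomp hm) (g := fun _ => g)
    (hg.comp continuous_snd) (fun t x hx => b₁ t x hx.le) (fun t x hx => b₂ t x hx.ge)
  have G := (((isFamily_const (T := I) α).precomp hu).precomp (e (d 1))).glue
    (((isFamily_const (T := I) β).precomp hl).precomp (e (m 1))) (g := fun _ => h)
    (hh.comp continuous_snd) (fun t x hx => b₃ t x hx.le) (fun t x hx => b₄ t x hx.ge)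
  -- After both shrinkings `α` is trivial where `g ≤ 0` or `h ≤ 0`, and `β` where `g ≥ 0` or `h ≥
  -- 0`. Where the two cuts disagree both squares are trivial, so the ends of `F` and `G` are the
  -- same square.
  have mid : glue g (hg.comp continuous_id) _ _ (fun x hx => b₁ 1 x hx.le)
      (fun x hx => b₂ 1 x hx.ge) = glue h (hh.comp continuous_id) _ _
      (fun x hx => b₃ 1 x hx.le) (fun x hx => b₄ 1 x hx.ge) := by
    refine glue_eq (fun x hx => ?_) (fun x hx => ?_)
    · rcases le_total (h x) 0 with h' | h'
      · exact (glue_eqAt_of_le h').symm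
      · exact ((b₄ 1 x h').eqAt (b₁ 1 x hx)).trans (glue_eqAt_of_ge h').symm
    · rcases le_total (h x) 0 with h' | h'
      · exact ((b₃ 1 x h').eqAt (b₂ 1 x hx)).trans (glue_eqAt_of_le h').symm
      · exact (glue_eqAt_of_ge h').symm
  have key := F.homotopic.trans (mid ▸ G.homotopic.symm)
  rw [glue_congr (precomp_eq_self _ hd0) (precomp_eq_self _ hm0),
    glue_congr (g := h) (congrArg (fun γ => precomp γ _) (precomp_eq_self _ hu0))
      (congrArg (fun γ => precomp γ _) (precomp_eq_self _ hl0))] at key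
  exact key

end RelSphere

/-! ### Reparametrizing a pair of coordinates -/

section Pair

variable {n : ℕ} {i j : Fin n} {x : Fin n → I}

/-- The larger one of two coordinates. -/
def pairMax (i j : Fin n) (x : Fin n → I) : ℝ :=
  max (x i : ℝ) (x j)

/-- In the coordinates `(c, r)` with `(x i, x j) = (r * min (2c) 1, r * min (2-2c) 1)` on the
square, this is the product `c * r`. -/
def pairPos (i j : Fin n) (x : Fin n → I) : ℝ :=
  ((x i : ℝ) - x j + pairMax i j x) / 2

/-- The point with the same coordinates as `x`, except that `pairPos i j` has the value `k`. -/
def setPair (i j : Fin n) (k : ℝ) (x : Fin n → I) : Fin n → I :=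
  Function.update (Function.update x i (Set.projIcc 0 1 zero_le_one (min (2 * k) (pairMax i j x))))
    j (Set.projIcc 0 1 zero_le_one (min (2 * (pairMax i j x - k)) (pairMax i j x)))

theorem pairMax_nonneg : 0 ≤ pairMax i j x :=
  (x i).2.1.trans (le_max_left _ _)

theorem pairMax_le_one : pairMax i j x ≤ 1 :=
  max_le (x i).2.2 (x j).2.2

theorem pairPos_nonneg : 0 ≤ pairPos i j x := by
  have := le_max_right (x i : ℝ) (x j)
  have := (x i).2.1
  unfold pairPos pairMax
  linarith

theorem pairPos_le : pairPos i j x ≤ pairMax i j x := by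
  have := le_max_left (x i : ℝ) (x j)
  have := (x j).2.1
  unfold pairPos pairMax
  linarith

/-- With `right_eq_min`, this recovers the pair from `r` and `c * r`. Working with `c * r` instead
of `c` avoids a division at `r = 0`. -/
theorem left_eq_min : (x i : ℝ) = min (2 * pairPos i j x) (pairMax i j x) := by
  have := (x j).2.1
  have := (x i).2.1
  unfold pairPos pairMax
  rcases le_total (x i : ℝ) (x j) with h | h
  · rw [max_eq_right h, min_eq_left] <;> linarith
  · rw [max_eq_left h, min_eq_right]; linarith

theorem right_eq_min :
    (x j : ℝ) = min (2 * (pairMax i j x - pairPos i j x)) (pairMax i j x) := by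
  have := (x j).2.1
  have := (x i).2.1
  unfold pairPos pairMax
  rcases le_total (x i : ℝ) (x j) with h | h
  · rw [max_eq_right h, min_eq_right]; linarith
  · rw [max_eq_left h, min_eq_left] <;> linarith

/-- The diagonal `x i = x j` is the middle `c = 1/2`. -/
theorem sub_nonpos_iff_pairPos :
    (x i : ℝ) - x j ≤ 0 ↔ 2 * pairPos i j x ≤ pairMax i j x := by
  unfold pairPos
  constructor <;> intro h <;> linarith

theorem sub_nonneg_iff_pairPos :
    0 ≤ (x i : ℝ) - x j ↔ pairMax i j x ≤ 2 * pairPos i j x := by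
  unfold pairPos
  constructor <;> intro h <;> linarith

theorem pairPos_eq_zero (h : x i = 0) : pairPos i j x = 0 := by
  have := (x j).2.1
  simp [pairPos, pairMax, h, this]

theorem pairPos_eq_pairMax (h : x j = 0) : pairPos i j x = pairMax i j x := by
  have := (x i).2.1
  simp [pairPos, pairMax, h, this]

theorem setPair_left (hij : i ≠ j) {k : ℝ} (hk : 0 ≤ k) :
    (setPair i j k x i : ℝ) = min (2 * k) (pairMax i j x) := by
  rw [setPair, Function.update_of_ne hij, Function.update_self, Set.coe_projIcc,
    min_eq_right ((min_le_right _ _).trans pairMax_le_one),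
    max_eq_right (le_min (by linarith) pairMax_nonneg)]

theorem setPair_right {k : ℝ} (hk : k ≤ pairMax i j x) :
    (setPair i j k x j : ℝ) = min (2 * (pairMax i j x - k)) (pairMax i j x) := by
  rw [setPair, Function.update_self, Set.coe_projIcc,
    min_eq_right ((min_le_right _ _).trans pairMax_le_one),
    max_eq_right (le_min (by linarith) pairMax_nonneg)]

theorem setPair_of_ne {k : ℝ} {l : Fin n} (hi : l ≠ i) (hj : l ≠ j) :
    setPair i j k x l = x l := by
  rw [setPair, Function.update_of_ne hj, Function.update_of_ne hi]

theorem setPair_zero (hij : i ≠ j) : setPair i j 0 x i = 0 :=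
  Subtype.ext ((setPair_left hij le_rfl).trans (by simp [pairMax_nonneg]))

theorem setPair_pairMax : setPair i j (pairMax i j x) x j = 0 :=
  Subtype.ext ((setPair_right le_rfl).trans (by simp [pairMax_nonneg]))

theorem pairMax_setPair (hij : i ≠ j) {k : ℝ} (hk : 0 ≤ k) (hk' : k ≤ pairMax i j x) :
    pairMax i j (setPair i j k x) = pairMax i j x := by
  rw [pairMax, setPair_left hij hk, setPair_right hk']
  rcases le_total (2 * k) (pairMax i j x) with h | h
  · rw [min_eq_left h, min_eq_right (by linarith), max_eq_right h]
  · rw [min_eq_right h, min_eq_left (by linarith), max_eq_left (by linarith)]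

theorem pairPos_setPair (hij : i ≠ j) {k : ℝ} (hk : 0 ≤ k) (hk' : k ≤ pairMax i j x) :
    pairPos i j (setPair i j k x) = k := by
  rw [pairPos, pairMax_setPair hij hk hk', setPair_left hij hk, setPair_right hk']
  rcases le_total (2 * k) (pairMax i j x) with h | h
  · rw [min_eq_left h, min_eq_right (by linarith)]; ring
  · rw [min_eq_right h, min_eq_left (by linarith)]; ring

theorem ext_pair {y : Fin n → I} (hi : (x i : ℝ) = y i) (hj : (x j : ℝ) = y j)
    (h : ∀ l, l ≠ i → l ≠ j → x l = y l) : x = y := by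
  funext l
  by_cases li : l = i
  · subst li; exact Subtype.ext hi
  by_cases lj : l = j
  · subst lj; exact Subtype.ext hj
  exact h l li lj

theorem setPair_setPair (hij : i ≠ j) {k k' : ℝ} (hk : 0 ≤ k) (hk' : k ≤ pairMax i j x)
    (hl : 0 ≤ k') (hl' : k' ≤ pairMax i j x) :
    setPair i j k' (setPair i j k x) = setPair i j k' x := by
  have e := pairMax_setPair hij hk hk'
  apply ext_pair (i := i) (j := j)
  · rw [setPair_left hij hl, setPair_left hij hl, e]
  · rw [setPair_right (e ▸ hl'), setPair_right hl', e]
  · intro l hi hj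
    rw [setPair_of_ne hi hj, setPair_of_ne hi hj, setPair_of_ne hi hj]

theorem setPair_pairPos (hij : i ≠ j) : setPair i j (pairPos i j x) x = x := by
  apply ext_pair (i := i) (j := j)
  · rw [setPair_left hij pairPos_nonneg, ← left_eq_min]
  · rw [setPair_right pairPos_le, ← right_eq_min]
  · intro l hi hj
    rw [setPair_of_ne hi hj]

theorem pairMax_swap : pairMax j i x = pairMax i j x :=
  max_comm _ _

/-- Exchanging the coordinates is the reflection `c ↦ 1 - c`. In `setPair_swap` it is the indices
that are exchanged, in `setPair_comp_swap` the entries of the point. -/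
theorem pairPos_swap : pairPos j i x = pairMax i j x - pairPos i j x := by
  rw [pairPos, pairPos, pairMax_swap]; ring

theorem setPair_swap (hij : i ≠ j) {k : ℝ} (hk : 0 ≤ k) (hk' : k ≤ pairMax i j x) :
    setPair j i (pairMax i j x - k) x = setPair i j k x := by
  apply ext_pair (i := i) (j := j)
  · rw [setPair_left hij hk, setPair_right (by rw [pairMax_swap]; linarith), pairMax_swap]
    ring_nf
  · rw [setPair_right hk', setPair_left hij.symm (by linarith), pairMax_swap]
  · intro l hi hj
    rw [setPair_of_ne hi hj, setPair_of_ne hj hi]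

theorem setPair_comp_swap (hij : i ≠ j) {k : ℝ} (hk : 0 ≤ k) (hk' : k ≤ pairMax i j x) :
    (fun l => setPair i j k x (Equiv.swap i j l)) = setPair i j (pairMax i j x - k) x := by
  apply ext_pair (i := i) (j := j)
  · rw [Equiv.swap_apply_left, setPair_right hk', setPair_left hij (by linarith)]
  · rw [Equiv.swap_apply_right, setPair_left hij hk, setPair_right (by linarith)]
    ring_nf
  · intro l hi hj
    rw [Equiv.swap_apply_of_ne_of_ne hi hj, setPair_of_ne hi hj, setPair_of_ne hi hj]

theorem continuous_pairMax : Continuous (pairMax i j) := by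
  unfold pairMax
  fun_prop

theorem continuous_pairPos : Continuous (pairPos i j) := by
  have := continuous_pairMax (i := i) (j := j)
  unfold pairPos
  fun_prop

theorem Continuous.setPair {T : Type*} [TopologicalSpace T] {κ : T → ℝ} {y : T → Fin n → I}
    (hκ : Continuous κ) (hy : Continuous y) : Continuous fun t => setPair i j (κ t) (y t) := by
  have := continuous_pairMax (i := i) (j := j)
  have hm : Continuous fun t => pairMax i j (y t) := this.comp hy
  unfold OperadTower.setPair
  refine (hy.update _ ?_).update _ ?_ <;> exact continuous_projIcc.comp (by fun_prop)

/-- If the entry `1` sits at `i` or `j`, then `r = 1`, and whatever `k` is, one of the two new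
entries equals `r`. Any other entry is unchanged. -/
theorem setPair_mem_boundary (hij : i ≠ j) {k : ℝ} (hk : 0 ≤ k) (hk' : k ≤ pairMax i j x)
    (hx : ∃ l, x l = 1) : setPair i j k x ∈ Cube.boundary (Fin n) := by
  obtain ⟨l, hl⟩ := hx
  by_cases h : l = i ∨ l = j
  · have e : pairMax i j x = 1 := by
      refine le_antisymm pairMax_le_one ?_
      rcases h with rfl | rfl
      · exact (congrArg Subtype.val hl).ge.trans (le_max_left _ _)
      · exact (congrArg Subtype.val hl).ge.trans (le_max_right _ _)
    rcases le_total (2 * k) 1 with h | h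
    · exact ⟨j, Or.inr (Subtype.ext ((setPair_right hk').trans
        (by rw [e, min_eq_right (by linarith)]; rfl)))⟩
    · exact ⟨i, Or.inr (Subtype.ext ((setPair_left hij hk).trans
        (by rw [e, min_eq_right (by linarith)]; rfl)))⟩
  · push Not at h
    exact ⟨l, Or.inr ((setPair_of_ne h.1 h.2).trans hl)⟩

/-- The self-map of the disk that changes `pairPos i j` to a given function. -/
def pairCubeMap (hij : i ≠ j) (κ : (Fin n → I) → ℝ) (hκ : Continuous κ) (h₀ : ∀ x, 0 ≤ κ x)
    (h₁ : ∀ x, κ x ≤ pairMax i j x) (hi : ∀ x, x i = 0 → κ x = 0)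
    (hj : ∀ x, x j = 0 → κ x = 0 ∨ κ x = pairMax i j x) : CubeMap n where
  toFun x := setPair i j (κ x) x
  continuous_toFun := Continuous.setPair hκ continuous_id
  map_zero x := by
    rintro ⟨l, hl⟩
    by_cases li : l = i
    · subst li
      exact ⟨l, by rw [hi x hl, setPair_zero hij]⟩
    by_cases lj : l = j
    · subst lj
      rcases hj x hl with h | h
      · exact ⟨i, by rw [h, setPair_zero hij]⟩
      · exact ⟨l, by rw [h, setPair_pairMax]⟩
    · exact ⟨l, (setPair_of_ne li lj).trans hl⟩
  map_bdry x := by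
    rintro ⟨l, hl | hl⟩
    · by_cases li : l = i
      · subst li
        exact ⟨l, Or.inl (by rw [hi x hl, setPair_zero hij])⟩
      by_cases lj : l = j
      · subst lj
        rcases hj x hl with h | h
        · exact ⟨i, Or.inl (by rw [h, setPair_zero hij])⟩
        · exact ⟨l, Or.inl (by rw [h, setPair_pairMax])⟩
      · exact ⟨l, Or.inl ((setPair_of_ne li lj).trans hl)⟩
    · exact setPair_mem_boundary hij (h₀ x) (h₁ x) ⟨l, hl⟩

/-- The truncation of `k` to the interval `[0, r]`. -/
def clamp (r k : ℝ) : ℝ :=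
  max 0 (min r k)

theorem clamp_nonneg (r k : ℝ) : 0 ≤ clamp r k :=
  le_max_left _ _

theorem clamp_le {r : ℝ} (hr : 0 ≤ r) (k : ℝ) : clamp r k ≤ r :=
  max_le hr (min_le_left _ _)

theorem clamp_of_nonpos {r k : ℝ} (hk : k ≤ 0) : clamp r k = 0 :=
  max_eq_left ((min_le_right _ _).trans hk)

theorem clamp_of_ge {r k : ℝ} (hr : 0 ≤ r) (hk : r ≤ k) : clamp r k = r := by
  rw [clamp, min_eq_left hk, max_eq_right hr]

theorem clamp_of_mem {r k : ℝ} (hk : 0 ≤ k) (hk' : k ≤ r) : clamp r k = k := by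
  rw [clamp, min_eq_right hk', max_eq_right hk]

theorem clamp_sub {r k : ℝ} (hr : 0 ≤ r) : clamp r (r - k) = r - clamp r k := by
  rcases le_total k 0 with h | h
  · rw [clamp_of_nonpos h, clamp_of_ge hr (by linarith), sub_zero]
  rcases le_total k r with h' | h'
  · rw [clamp_of_mem h h', clamp_of_mem (by linarith) (by linarith)]
  · rw [clamp_of_ge hr h', clamp_of_nonpos (by linarith), sub_self]

/-- The affine map sends `k ≤ 0` to nonpositive values and, because `p - q ≥ 1`, sends `k ≥ r` to
values at least `r`. So the inner truncation is absorbed by the outer one. -/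
theorem clamp_affine_clamp {r k p q : ℝ} (hr : 0 ≤ r) (hq : 0 ≤ q) (hp : q + 1 ≤ p) :
    clamp r (p * clamp r k - q * r) = clamp r (p * k - q * r) := by
  have hp0 : 0 ≤ p := by linarith
  have hqr := mul_nonneg hq hr
  have hpr := mul_le_mul_of_nonneg_right hp hr
  rcases le_total k 0 with h | h
  · have := mul_nonpos_of_nonneg_of_nonpos hp0 h
    rw [clamp_of_nonpos h, clamp_of_nonpos (by linarith), clamp_of_nonpos (by linarith)]
  rcases le_total k r with h' | h'
  · rw [clamp_of_mem h h']
  · have := mul_le_mul_of_nonneg_left h' hp0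
    rw [clamp_of_ge hr h', clamp_of_ge hr (by linarith), clamp_of_ge hr (by linarith)]

/-- The self-map of the disk with `c ↦ p * c - q` (truncated to the interval `[0, 1]`) in the
coordinates `(c, r)` on the square of the coordinates `i` and `j`. -/
def stretch (hij : i ≠ j) (p q : ℝ) (hq : 0 ≤ q) (hp : q + 1 ≤ p) : CubeMap n :=
  pairCubeMap hij (fun x => clamp (pairMax i j x) (p * pairPos i j x - q * pairMax i j x))
    (by
      have := continuous_pairMax (i := i) (j := j)
      have := continuous_pairPos (i := i) (j := j)
      unfold clamp
      fun_prop)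
    (fun _ => clamp_nonneg _ _) (fun _ => clamp_le pairMax_nonneg _)
    (fun x hx => clamp_of_nonpos (by
      have := mul_nonneg hq (pairMax_nonneg (i := i) (j := j) (x := x))
      rw [pairPos_eq_zero hx]
      linarith))
    (fun x hx => Or.inr (clamp_of_ge pairMax_nonneg (by
      have := mul_le_mul_of_nonneg_right hp (pairMax_nonneg (i := i) (j := j) (x := x))
      rw [pairPos_eq_pairMax hx]
      linarith)))

variable {hij : i ≠ j} {p q : ℝ} {hq : 0 ≤ q} {hp : q + 1 ≤ p}

theorem stretch_apply : stretch hij p q hq hp x =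
    setPair i j (clamp (pairMax i j x) (p * pairPos i j x - q * pairMax i j x)) x :=
  rfl

theorem stretch_eq {k : ℝ}
    (h : clamp (pairMax i j x) (p * pairPos i j x - q * pairMax i j x) = k) :
    stretch hij p q hq hp x = setPair i j k x := by
  rw [stretch_apply, h]

theorem stretch_one_zero (hq : 0 ≤ (0 : ℝ)) (hp : (0 : ℝ) + 1 ≤ 1) :
    stretch hij 1 0 hq hp x = x := by
  rw [stretch_eq (k := pairPos i j x), setPair_pairPos hij]
  rw [clamp_of_mem] <;> have := pairPos_nonneg (i := i) (j := j) (x := x) <;>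
    have := pairPos_le (i := i) (j := j) (x := x) <;> linarith

theorem pairMax_stretch : pairMax i j (stretch hij p q hq hp x) = pairMax i j x :=
  pairMax_setPair hij (clamp_nonneg _ _) (clamp_le pairMax_nonneg _)

theorem pairPos_stretch : pairPos i j (stretch hij p q hq hp x) =
    clamp (pairMax i j x) (p * pairPos i j x - q * pairMax i j x) :=
  pairPos_setPair hij (clamp_nonneg _ _) (clamp_le pairMax_nonneg _)

/-- Composition of affine maps: `p' (p c - q) - q' = p' p c - (p' q + q')`; the intermediate
truncation does not matter. -/
theorem stretch_stretch {p' q' : ℝ} {hq' : 0 ≤ q'} {hp' : q' + 1 ≤ p'}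
    {p'' q'' : ℝ} {hq'' : 0 ≤ q''} {hp'' : q'' + 1 ≤ p''} (h₁ : p' * p = p'')
    (h₂ : p' * q + q' = q'') :
    stretch hij p' q' hq' hp' (stretch hij p q hq hp x) = stretch hij p'' q'' hq'' hp'' x := by
  rw [stretch_apply (p := p'), pairMax_stretch, pairPos_stretch,
    clamp_affine_clamp pairMax_nonneg hq' hp', stretch_apply, setPair_setPair hij (clamp_nonneg _ _)
    (clamp_le pairMax_nonneg _) (clamp_nonneg _ _) (clamp_le pairMax_nonneg _), stretch_apply,
    ← h₁, ← h₂]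
  ring_nf

theorem stretch_left_eq_zero (h : p * pairPos i j x ≤ q * pairMax i j x) :
    stretch hij p q hq hp x i = 0 := by
  rw [stretch_eq (clamp_of_nonpos (by linarith)), setPair_zero hij]

theorem stretch_right_eq_zero (h : (q + 1) * pairMax i j x ≤ p * pairPos i j x) :
    stretch hij p q hq hp x j = 0 := by
  rw [stretch_eq (clamp_of_ge pairMax_nonneg (by linarith)), setPair_pairMax]

theorem stretch_of_ne {l : Fin n} (hi : l ≠ i) (hj : l ≠ j) :
    stretch hij p q hq hp x l = x l :=
  setPair_of_ne hi hj

/-- For `p = q + 1` the end `c = 1` is fixed and `c` can only decrease, while `x i` is monotone in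
`c`. Dually, `le_stretch_left` treats the maps fixing `c = 0`. These monotonicities ensure that a
shrinking respects the sides of another cut. -/
theorem stretch_left_le (h : p = q + 1) : (stretch hij p q hq hp x i : ℝ) ≤ x i := by
  rw [stretch_apply, setPair_left hij (clamp_nonneg _ _), left_eq_min (i := i) (j := j) (x := x)]
  refine min_le_min (mul_le_mul_of_nonneg_left ?_ zero_le_two) le_rfl
  have h1 := pairPos_le (i := i) (j := j) (x := x)
  have := mul_le_mul_of_nonneg_left h1 hq
  refine max_le pairPos_nonneg ((min_le_right _ _).trans ?_)
  rw [h]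
  linarith

theorem le_stretch_left (h : q = 0) : (x i : ℝ) ≤ stretch hij p q hq hp x i := by
  rw [stretch_apply, setPair_left hij (clamp_nonneg _ _), left_eq_min (i := i) (j := j) (x := x)]
  refine min_le_min (mul_le_mul_of_nonneg_left ?_ zero_le_two) le_rfl
  have h1 := pairPos_nonneg (i := i) (j := j) (x := x)
  subst h
  have := mul_le_mul_of_nonneg_right hp h1
  refine le_max_of_le_right (le_min pairPos_le ?_)
  linarith

theorem continuous_stretch {T : Type*} [TopologicalSpace T] {p q : T → ℝ} (hq : ∀ t, 0 ≤ q t)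
    (hp : ∀ t, q t + 1 ≤ p t) (cp : Continuous p) (cq : Continuous q) :
    Continuous fun z : T × (Fin n → I) => stretch hij (p z.1) (q z.1) (hq z.1) (hp z.1) z.2 := by
  have h₁ : Continuous fun z : T × (Fin n → I) => pairMax i j z.2 :=
    continuous_pairMax.comp continuous_snd
  have h₂ : Continuous fun z : T × (Fin n → I) => pairPos i j z.2 :=
    continuous_pairPos.comp continuous_snd
  refine Continuous.setPair ?_ continuous_snd
  unfold clamp
  fun_prop

end Pair

/-! ### Addition along a pair of coordinates -/

namespace RelSphere

variable {A B : Type u} [TopologicalSpace A] [TopologicalSpace B] {n : ℕ} {f : C(A, B)} {a₀ : A}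
  {i j : Fin n}

theorem continuous_coord_sub (i j : Fin n) :
    Continuous fun x : Fin n → I => (x i : ℝ) - x j := by
  fun_prop

theorem baseAt_upper (hij : i ≠ j) (α : RelSphere n f a₀) {x : Fin n → I}
    (hx : (x i : ℝ) - x j ≤ 0) :
    BaseAt (α.precomp (stretch hij 2 1 (by norm_num) (by norm_num))) x := by
  rw [sub_nonpos_iff_pairPos] at hx
  exact precomp_baseAt (baseAt_of_zero _ ⟨i, stretch_left_eq_zero (by linarith)⟩)

theorem baseAt_lower (hij : i ≠ j) (α : RelSphere n f a₀) {x : Fin n → I}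
    (hx : 0 ≤ (x i : ℝ) - x j) :
    BaseAt (α.precomp (stretch hij 2 0 le_rfl (by norm_num))) x := by
  rw [sub_nonneg_iff_pairPos] at hx
  exact precomp_baseAt (baseAt_of_zero _ ⟨j, stretch_right_eq_zero (by linarith)⟩)

/-- The sum of two squares along the coordinates `i` and `j`. -/
def addAt (hij : i ≠ j) (α β : RelSphere n f a₀) : RelSphere n f a₀ :=
  glue (fun x => (x i : ℝ) - x j) (continuous_coord_sub i j)
    (α.precomp (stretch hij 2 1 (by norm_num) (by norm_num)))
    (β.precomp (stretch hij 2 0 le_rfl (by norm_num)))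
    (fun _ hx => baseAt_upper hij α hx.le) (fun _ hx => baseAt_lower hij β hx.ge)

theorem addAt_eqAt_lower (hij : i ≠ j) (α β : RelSphere n f a₀) {x : Fin n → I}
    (hx : (x i : ℝ) ≤ x j) :
    EqAt (addAt hij α β) (β.precomp (stretch hij 2 0 le_rfl (by norm_num))) x :=
  glue_eqAt_of_le (sub_nonpos.2 hx)

theorem addAt_eqAt_upper (hij : i ≠ j) (α β : RelSphere n f a₀) {x : Fin n → I}
    (hx : (x j : ℝ) ≤ x i) :
    EqAt (addAt hij α β) (α.precomp (stretch hij 2 1 (by norm_num) (by norm_num))) x :=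
  glue_eqAt_of_ge (sub_nonneg.2 hx)

/-- The pinch maps are written with one fixed coordinate in place of `r`. On the half where each of
them is used, that coordinate is the larger one, so it is `r`. -/
theorem lowerPinch_eq_stretch (h : 2 ≤ n) {x : Fin n → I}
    (hx : (x ⟨0, by omega⟩ : ℝ) ≤ x ⟨1, by omega⟩) :
    lowerPinch h x = stretch (i := ⟨0, by omega⟩) (j := ⟨1, by omega⟩) (by simp) 2 0 le_rfl
      (by norm_num) x := by
  have e : pairMax ⟨0, by omega⟩ ⟨1, by omega⟩ x = (x ⟨1, by omega⟩ : ℝ) := max_eq_right hx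
  have e' : pairPos ⟨0, by omega⟩ ⟨1, by omega⟩ x = (x ⟨0, by omega⟩ : ℝ) / 2 := by
    rw [pairPos, e]; ring
  have h0 := (x ⟨0, by omega⟩).2.1
  rw [stretch_eq (k := (x ⟨0, by omega⟩ : ℝ)), setPair, e, lowerPinch]
  rw [e, e', clamp_of_mem] <;> linarith

theorem upperPinch_eq_stretch (h : 2 ≤ n) {x : Fin n → I}
    (hx : (x ⟨1, by omega⟩ : ℝ) ≤ x ⟨0, by omega⟩) :
    upperPinch h x = stretch (i := ⟨0, by omega⟩) (j := ⟨1, by omega⟩) (by simp) 2 1 (by norm_num)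
      (by norm_num) x := by
  have e : pairMax ⟨0, by omega⟩ ⟨1, by omega⟩ x = (x ⟨0, by omega⟩ : ℝ) := max_eq_left hx
  have e' : pairPos ⟨0, by omega⟩ ⟨1, by omega⟩ x =
      (x ⟨0, by omega⟩ : ℝ) - (x ⟨1, by omega⟩ : ℝ) / 2 := by
    rw [pairPos, e]; ring
  have h0 := (x ⟨1, by omega⟩).2.1
  rw [stretch_eq (k := (x ⟨0, by omega⟩ : ℝ) - x ⟨1, by omega⟩), setPair, e, upperPinch,
    sub_sub_cancel]
  rw [e, e', clamp_of_mem] <;> linarith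

theorem add_eq_addAt (h : 2 ≤ n) (α β : RelSphere n f a₀) :
    add h α β = addAt (i := ⟨0, by omega⟩) (j := ⟨1, by omega⟩) (by simp) α β := by
  refine ext_eqAt fun x => ?_
  rcases le_or_gt (x ⟨0, by omega⟩ : ℝ) (x ⟨1, by omega⟩) with hx | hx
  · have e : EqAt (add h α β) (β.precomp (stretch (i := ⟨0, by omega⟩) (j := ⟨1, by omega⟩)
        (by simp) 2 0 le_rfl (by norm_num))) x :=
      ⟨(if_pos hx).trans (congrArg β.disk (lowerPinch_eq_stretch h hx)),
        fun _ => (if_pos hx).trans (congrArg β.bdry (Subtype.ext (lowerPinch_eq_stretch h hx)))⟩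
    exact e.trans (addAt_eqAt_lower _ _ _ hx).symm
  · have e : EqAt (add h α β) (α.precomp (stretch (i := ⟨0, by omega⟩) (j := ⟨1, by omega⟩)
        (by simp) 2 1 (by norm_num) (by norm_num))) x :=
      ⟨(if_neg hx.not_ge).trans (congrArg α.disk (upperPinch_eq_stretch h hx.le)), fun _ =>
        (if_neg hx.not_ge).trans (congrArg α.bdry (Subtype.ext (upperPinch_eq_stretch h hx.le)))⟩
    exact e.trans (addAt_eqAt_upper _ _ _ hx.le).symm

/-- Exchanging the indices replaces `c` by `1 - c`, so it interchanges the halves and the maps `2c`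
and `2c - 1` up to reflection. This is an equality of squares, not only a homotopy. -/
theorem addAt_swap_index (hij : i ≠ j) (α β : RelSphere n f a₀) :
    addAt hij α β = addAt hij.symm β α := by
  refine ext_eqAt fun x => ?_
  have h0 := pairPos_nonneg (i := i) (j := j) (x := x)
  have h1 := pairPos_le (i := i) (j := j) (x := x)
  rcases le_total (x i : ℝ) (x j) with hx | hx
  · refine (addAt_eqAt_lower _ _ _ hx).trans (EqAt.trans ?_ (addAt_eqAt_upper _ _ _ hx).symm)
    refine precomp_eqAt _ ?_
    rw [stretch_apply, ← setPair_swap hij (clamp_nonneg _ _) (clamp_le pairMax_nonneg _),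
      ← clamp_sub pairMax_nonneg, stretch_apply, pairPos_swap, pairMax_swap]
    ring_nf
  · refine (addAt_eqAt_upper _ _ _ hx).trans (EqAt.trans ?_ (addAt_eqAt_lower _ _ _ hx).symm)
    refine precomp_eqAt _ ?_
    rw [stretch_apply, ← setPair_swap hij (clamp_nonneg _ _) (clamp_le pairMax_nonneg _),
      ← clamp_sub pairMax_nonneg, stretch_apply, pairPos_swap, pairMax_swap]
    ring_nf

/-- The sum is `α` precomposed with the tent map `c ↦ 2 min (c, 1 - c)`: one runs through `α` and
back. Multiplying the tent map by `1 - t` contracts it to `c = 0`. -/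
theorem permute_swap_addAt_homotopic (hij : i ≠ j) (α : RelSphere n f a₀) :
    Homotopic (addAt hij (permute (Equiv.swap i j) α) α) (const n f a₀) := by
  have hc : Continuous fun z : I × (Fin n → I) => (1 - (z.1 : ℝ)) * (2 * min (pairPos i j z.2)
      (pairMax i j z.2 - pairPos i j z.2)) := by
    have h₁ : Continuous fun z : I × (Fin n → I) => pairMax i j z.2 :=
      continuous_pairMax.comp continuous_snd
    have h₂ : Continuous fun z : I × (Fin n → I) => pairPos i j z.2 :=
      continuous_pairPos.comp continuous_snd
    fun_prop
  have h0 : ∀ x : Fin n → I, 0 ≤ 2 * min (pairPos i j x) (pairMax i j x - pairPos i j x) :=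
    fun x => mul_nonneg zero_le_two (le_min pairPos_nonneg (sub_nonneg.2 pairPos_le))
  have h1 : ∀ x : Fin n → I,
      2 * min (pairPos i j x) (pairMax i j x - pairPos i j x) ≤ pairMax i j x := fun x => by
    have := min_le_left (pairPos i j x) (pairMax i j x - pairPos i j x)
    have := min_le_right (pairPos i j x) (pairMax i j x - pairPos i j x)
    linarith
  let φ : I → CubeMap n := fun t => pairCubeMap hij
    (fun x => (1 - (t : ℝ)) * (2 * min (pairPos i j x) (pairMax i j x - pairPos i j x)))
    (hc.comp (Continuous.prodMk_right t))
    (fun x => mul_nonneg (sub_nonneg.2 t.2.2) (h0 x))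
    (fun x => (mul_le_of_le_one_left (h0 x) (by linarith [t.2.1])).trans (h1 x))
    (fun x hx => by rw [pairPos_eq_zero hx, min_eq_left (by simp [pairMax_nonneg])]; ring)
    (fun x hx => Or.inl (by
      rw [pairPos_eq_pairMax hx, sub_self, min_eq_right pairMax_nonneg]; ring))
  have F : IsFamily fun t : I => α.precomp (φ t) :=
    (isFamily_const α).precomp (Continuous.setPair hc continuous_snd)
  have e0 : addAt hij (permute (Equiv.swap i j) α) α = α.precomp (φ 0) := by
    refine glue_eq (fun x hx => precomp_eqAt _ ?_) fun x hx => ?_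
    · rw [sub_nonpos_iff_pairPos] at hx
      have hp := pairPos_nonneg (i := i) (j := j) (x := x)
      refine stretch_eq ?_
      dsimp only
      rw [min_eq_left (by linarith), clamp_of_mem (by linarith) (by linarith)]
      simp
    · rw [sub_nonneg_iff_pairPos] at hx
      have hp := pairPos_le (i := i) (j := j) (x := x)
      have key : (fun l => stretch hij 2 1 (by norm_num) (by norm_num) x (Equiv.swap i j l)) =
          φ 0 x := by
        rw [stretch_eq (k := 2 * pairPos i j x - pairMax i j x),
          setPair_comp_swap hij (by linarith) (by linarith)]
        · change _ = setPair i j _ x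
          congr 1
          dsimp only
          rw [min_eq_right (by linarith)]
          simp
          ring
        · rw [clamp_of_mem] <;> linarith
      exact ⟨congrArg α.disk key, fun _ => congrArg α.bdry (Subtype.ext key)⟩
  have e1 : α.precomp (φ 1) = const n f a₀ := by
    refine eq_const fun x => precomp_baseAt (baseAt_of_zero _ ⟨i, ?_⟩)
    change setPair i j _ x i = 0
    simp [setPair_zero hij]
  rw [e0, ← e1]
  exact F.homotopic

/-- The homotopy from the identity that shrinks the support of a first summand. -/
def shrinkUpper (hij : i ≠ j) (t : I) : CubeMap n :=
  stretch hij (1 + t) t t.2.1 (by linarith)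

/-- The homotopy from the identity that shrinks the support of a second summand. -/
def shrinkLower (hij : i ≠ j) (t : I) : CubeMap n :=
  stretch hij (1 + t) 0 le_rfl (by linarith [t.2.1])

theorem continuous_shrinkUpper (hij : i ≠ j) :
    Continuous fun z : I × (Fin n → I) => shrinkUpper hij z.1 z.2 :=
  continuous_stretch (T := I) (p := fun t => 1 + (t : ℝ)) (q := fun t => t)
    (fun t => t.2.1) (fun t => by linarith) (by fun_prop) (by fun_prop)

theorem continuous_shrinkLower (hij : i ≠ j) :
    Continuous fun z : I × (Fin n → I) => shrinkLower hij z.1 z.2 :=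
  continuous_stretch (T := I) (p := fun t => 1 + (t : ℝ)) (q := fun t => 0)
    (fun t => le_rfl) (fun t => by linarith [t.2.1]) (by fun_prop) (by fun_prop)

theorem shrinkUpper_zero (hij : i ≠ j) (x : Fin n → I) : shrinkUpper hij 0 x = x := by
  simpa [shrinkUpper] using stretch_one_zero le_rfl (by simp)

theorem shrinkLower_zero (hij : i ≠ j) (x : Fin n → I) : shrinkLower hij 0 x = x := by
  simpa [shrinkLower] using stretch_one_zero le_rfl (by simp)

theorem shrinkUpper_one (hij : i ≠ j) :
    shrinkUpper hij 1 = stretch hij 2 1 (by norm_num) (by norm_num) := by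
  have h2 : (1 : ℝ) + ((1 : I) : ℝ) = 2 := by simp; norm_num
  simp only [shrinkUpper, h2]
  rfl

theorem shrinkLower_one (hij : i ≠ j) :
    shrinkLower hij 1 = stretch hij 2 0 le_rfl (by norm_num) := by
  have h2 : (1 : ℝ) + ((1 : I) : ℝ) = 2 := by simp; norm_num
  simp only [shrinkLower, h2]

theorem exists_shrinkUpper_eq_zero (hij : i ≠ j) {x : Fin n → I} (hx : (x i : ℝ) - x j ≤ 0) :
    ∃ c, shrinkUpper hij 1 x c = 0 := by
  rw [sub_nonpos_iff_pairPos] at hx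
  rw [shrinkUpper_one]
  exact ⟨i, stretch_left_eq_zero (by linarith)⟩

theorem exists_shrinkLower_eq_zero (hij : i ≠ j) {x : Fin n → I} (hx : 0 ≤ (x i : ℝ) - x j) :
    ∃ c, shrinkLower hij 1 x c = 0 := by
  rw [sub_nonneg_iff_pairPos] at hx
  rw [shrinkLower_one]
  exact ⟨j, stretch_right_eq_zero (by linarith)⟩

/-- A sum with a trivial first summand is `α` with its support shrunk to one half, which is the end
of `shrinkLower`. -/
theorem const_addAt_homotopic (hij : i ≠ j) (α : RelSphere n f a₀) :
    Homotopic (addAt hij (const n f a₀) α) α := by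
  have F := ((isFamily_const α).precomp (continuous_shrinkLower hij)).homotopic
  have e : addAt hij (const n f a₀) α = α.precomp (shrinkLower hij 1) := by
    rw [shrinkLower_one]
    exact glue_eq (fun _ _ => EqAt.rfl) fun x hx =>
      (precomp_baseAt (baseAt_const _)).eqAt (baseAt_lower hij α hx)
  rw [precomp_eq_self _ (shrinkLower_zero hij), ← e] at F
  exact F.symm

theorem addAt_const_homotopic (hij : i ≠ j) (α : RelSphere n f a₀) :
    Homotopic (addAt hij α (const n f a₀)) α := by
  rw [addAt_swap_index]
  exact const_addAt_homotopic hij.symm α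

/-- A criterion for another way of separating the supports of two squares to describe their sum. -/
theorem addAt_homotopic_glue (hij : i ≠ j) {α β : RelSphere n f a₀} {h : (Fin n → I) → ℝ}
    (hh : Continuous h) {d m : I → CubeMap n}
    (hd : Continuous fun z : I × (Fin n → I) => d z.1 z.2)
    (hm : Continuous fun z : I × (Fin n → I) => m z.1 z.2)
    (hd0 : ∀ x, d 0 x = x) (hm0 : ∀ x, m 0 x = x)
    (hhd : ∀ x, h x ≤ 0 → ∃ c, d 1 x c = 0)
    (hhm : ∀ x, 0 ≤ h x → (∃ c, m 1 x c = 0) ∨ (m 1 x i = 1 ∧ ∀ y, y i = 1 → BaseAt β y))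
    (hdi : ∀ t x, (d t x i : ℝ) ≤ x i) (hdj : ∀ t x, d t x j = x j)
    (hmi : ∀ t x, (x i : ℝ) ≤ m t x i) (hmj : ∀ t x, m t x j = x j)
    (c₃ : ∀ x, h x = 0 → BaseAt (α.precomp (d 1)) x)
    (c₄ : ∀ x, h x = 0 → BaseAt (β.precomp (m 1)) x) :
    Homotopic (addAt hij α β) (glue h hh (α.precomp (d 1)) (β.precomp (m 1)) c₃ c₄) := by
  have key := glue_homotopic_glue (α := α) (β := β) (continuous_coord_sub i j)
    hh (continuous_shrinkUpper hij) (continuous_shrinkLower hij) hd hm (shrinkUpper_zero hij)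
    (shrinkLower_zero hij) hd0 hm0
    (fun x hx => baseAt_of_zero _ (exists_shrinkUpper_eq_zero hij hx))
    (fun x hx => baseAt_of_zero _ (exists_shrinkLower_eq_zero hij hx))
    (fun t x hx => baseAt_of_zero _ ((shrinkUpper hij t).map_zero _ (hhd x hx)))
    (fun t x hx => (hhm x hx).elim
      (fun h => baseAt_of_zero _ ((shrinkLower hij t).map_zero _ h)) fun h => h.2 _ (by
        -- Shrinking a second summand never decreases the coordinate `i`, so a point on the face `x
        -- i = 1`, where `β` is trivial, stays on it.
        have h₁ : (m 1 x i : ℝ) ≤ shrinkLower hij t (m 1 x) i := le_stretch_left rfl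
        rw [h.1] at h₁
        exact Subtype.ext (le_antisymm (shrinkLower hij t (m 1 x) i).2.2 h₁)))
    (fun t x hx => by
      rw [hdj]
      linarith [hdi t x])
    (fun t x hx => by
      rw [hmj]
      linarith [hmi t x])
    (fun x hx => precomp_baseAt (baseAt_of_zero _ (exists_shrinkUpper_eq_zero hij hx.le)))
    (fun x hx => precomp_baseAt (baseAt_of_zero _ (exists_shrinkLower_eq_zero hij hx.ge))) c₃ c₄
  simp only [shrinkUpper_one, shrinkLower_one] at key
  exact key

/-- Shrinking along `(i, k)` leaves `x j` fixed, lowers `x i` for the first summand and raises it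
for the second, so it preserves the sides of `x i = x j`. -/
theorem addAt_indep_right {k : Fin n} (hij : i ≠ j) (hik : i ≠ k) (hjk : j ≠ k)
    (α β : RelSphere n f a₀) : Homotopic (addAt hij α β) (addAt hik α β) := by
  have key := addAt_homotopic_glue hij (α := α) (β := β) (continuous_coord_sub i k)
    (continuous_shrinkUpper hik) (continuous_shrinkLower hik) (shrinkUpper_zero hik)
    (shrinkLower_zero hik) (fun x hx => exists_shrinkUpper_eq_zero hik hx)
    (fun x hx => Or.inl (exists_shrinkLower_eq_zero hik hx))
    (fun t x => stretch_left_le (add_comm _ _)) (fun t x => stretch_of_ne hij.symm hjk)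
    (fun t x => le_stretch_left rfl) (fun t x => stretch_of_ne hij.symm hjk)
    (fun x hx => precomp_baseAt (baseAt_of_zero _ (exists_shrinkUpper_eq_zero hik hx.le)))
    (fun x hx => precomp_baseAt (baseAt_of_zero _ (exists_shrinkLower_eq_zero hik hx.ge)))
  simp only [shrinkUpper_one, shrinkLower_one] at key
  exact key

theorem addAt_indep_left {k : Fin n} (hij : i ≠ j) (hkj : k ≠ j) (hik : i ≠ k)
    (α β : RelSphere n f a₀) : Homotopic (addAt hij α β) (addAt hkj α β) := by
  rw [addAt_swap_index hij, addAt_swap_index hkj]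
  exact addAt_indep_right hij.symm hkj.symm hik β α

/-- With a third coordinate `k` the pair moves along `(i, j)`, `(i, k)`, `(j, k)`, `(j, i)`, and
reversing the pair is the same as exchanging the summands. -/
theorem addAt_comm_homotopic (hn : 3 ≤ n) (hij : i ≠ j) (α β : RelSphere n f a₀) :
    Homotopic (addAt hij α β) (addAt hij β α) := by
  obtain ⟨k, hk⟩ : ∃ k, k ∉ ({i, j} : Finset (Fin n)) := by
    by_contra! h
    have := Finset.card_le_card (fun x _ => h x : Finset.univ ⊆ ({i, j} : Finset (Fin n)))
    have := Finset.card_le_two (a := i) (b := j)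
    rw [Finset.card_univ, Fintype.card_fin] at *
    omega
  simp only [Finset.mem_insert, Finset.mem_singleton, not_or] at hk
  rw [addAt_swap_index hij β α]
  exact (addAt_indep_right hij (Ne.symm hk.1) (Ne.symm hk.2) α β).trans
    ((addAt_indep_left (Ne.symm hk.1) (Ne.symm hk.2) hij α β).trans
      (addAt_indep_right (Ne.symm hk.2) hij.symm hk.1 α β))

theorem addAt_indep (hn : 3 ≤ n) {i' j' : Fin n} (hij : i ≠ j) (hij' : i' ≠ j')
    (α β : RelSphere n f a₀) : Homotopic (addAt hij α β) (addAt hij' α β) := by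
  by_cases h : i' = j
  · subst h
    by_cases h' : j' = i
    · subst h'
      rw [addAt_swap_index hij']
      exact addAt_comm_homotopic hn hij α β
    · rw [addAt_swap_index hij']
      exact (addAt_comm_homotopic hn hij α β).trans
        (addAt_indep_left hij hij'.symm (Ne.symm h') β α)
  · by_cases h' : i = i'
    · subst h'
      by_cases h'' : j = j'
      · subst h''
        exact Homotopic.refl _
      · exact addAt_indep_right _ _ h'' _ _
    · refine (addAt_indep_left hij h h' α β).trans ?_
      by_cases h'' : j = j'
      · subst h''
        exact Homotopic.refl _
      · exact addAt_indep_right _ _ h'' _ _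

/-- Glue three squares along cuts `c = (2-t)/4` and `c = (3-t)/4`, which move from `1/2, 3/4` to
`1/4, 1/2`. Below, between and above the cuts one uses `γ`, `β`, `α` at `(2+2t)c`, `4c - (2-t)` and
`(4-2t)c - (3-2t)`. The middle map fits its interval exactly; the coefficients of the others are
linear in `t` to avoid quotients, so their supports may be smaller than the intervals for `0 < t <
1`. -/
theorem addAt_assoc_homotopic (hij : i ≠ j) (α β γ : RelSphere n f a₀) :
    Homotopic (addAt hij (addAt hij α β) γ) (addAt hij α (addAt hij β γ)) := by
  have cm : Continuous fun z : I × (Fin n → I) => pairMax i j z.2 :=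
    continuous_pairMax.comp continuous_snd
  have cp : Continuous fun z : I × (Fin n → I) => pairPos i j z.2 :=
    continuous_pairPos.comp continuous_snd
  have FG : IsFamily fun t : I =>
      γ.precomp (stretch hij (2 + 2 * t) 0 le_rfl (by linarith [t.2.1])) :=
    (isFamily_const γ).precomp (continuous_stretch (T := I) (p := fun t => 2 + 2 * (t : ℝ))
      (q := fun _ => 0) (fun _ => le_rfl) (fun t => by linarith [t.2.1]) (by fun_prop)
      (by fun_prop))
  have FB : IsFamily fun t : I =>
      β.precomp (stretch hij 4 (2 - t) (by linarith [t.2.2]) (by linarith [t.2.1])) :=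
    (isFamily_const β).precomp (continuous_stretch (T := I) (p := fun t => 4)
      (q := fun t => 2 - (t : ℝ)) (fun t => by linarith [t.2.2]) (fun t => by linarith [t.2.1])
      (by fun_prop) (by fun_prop))
  have FA : IsFamily fun t : I => α.precomp (stretch hij (4 - 2 * t) (3 - 2 * t)
      (by linarith [t.2.2]) (by linarith)) :=
    (isFamily_const α).precomp (continuous_stretch (T := I) (p := fun t => 4 - 2 * (t : ℝ))
      (q := fun t => 3 - 2 * (t : ℝ)) (fun t => by linarith [t.2.2]) (fun t => by linarith)
      (by fun_prop) (by fun_prop))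
  have FAB := FA.glue FB (g := fun t x => 4 * pairPos i j x - (3 - t) * pairMax i j x)
    (by fun_prop)
    (fun t x hx => precomp_baseAt (baseAt_of_zero _ ⟨i, stretch_left_eq_zero (by
      -- The support of `α` begins at `(3-2t)/(4-2t)`, which is at least `(3-t)/4` because `t (1-t)
      -- ≥ 0`. The same inequality handles the upper end of the support of `γ` below.
      have := mul_nonneg (mul_nonneg t.2.1 (sub_nonneg.2 t.2.2))
        (pairMax_nonneg (i := i) (j := j) (x := x))
      rw [show pairPos i j x = (3 - t) * pairMax i j x / 4 by linarith]
      linarith)⟩))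
    (fun t x hx => precomp_baseAt (baseAt_of_zero _ ⟨j, stretch_right_eq_zero (by linarith)⟩))
  have F := FAB.glue FG (g := fun t x => 4 * pairPos i j x - (2 - t) * pairMax i j x)
    (by fun_prop)
    (fun t x hx => by
      have hm := pairMax_nonneg (i := i) (j := j) (x := x)
      exact (glue_eqAt_of_le (by linarith)).baseAt
        (precomp_baseAt (baseAt_of_zero _ ⟨i, stretch_left_eq_zero (by linarith)⟩)))
    (fun t x hx => precomp_baseAt (baseAt_of_zero _ ⟨j, stretch_right_eq_zero (by
      have := mul_nonneg (mul_nonneg t.2.1 (sub_nonneg.2 t.2.2))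
        (pairMax_nonneg (i := i) (j := j) (x := x))
      rw [show pairPos i j x = (2 - t) * pairMax i j x / 4 by linarith]
      linarith)⟩))
  have key := F.homotopic
  have hm : ∀ x, 0 ≤ pairMax i j x := fun x => pairMax_nonneg
  have hp : ∀ x, 0 ≤ pairPos i j x := fun x => pairPos_nonneg
  have hpm : ∀ x, pairPos i j x ≤ pairMax i j x := fun x => pairPos_le
  convert key using 1
  · refine ext_eqAt fun x => ?_
    rcases le_total ((x i : ℝ) - x j) 0 with hx | hx
    · refine (glue_eqAt_of_le hx).trans (EqAt.trans ?_ (glue_eqAt_of_le ?_).symm)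
      · exact precomp_eqAt _ (by simp [stretch_apply])
      · rw [sub_nonpos_iff_pairPos] at hx
        simp only [Set.Icc.coe_zero]
        linarith
    · refine (glue_eqAt_of_ge hx).trans (EqAt.trans ?_ (glue_eqAt_of_ge ?_).symm)
      · rw [sub_nonneg_iff_pairPos] at hx
        have e : pairPos i j (stretch hij 2 1 (by norm_num) (by norm_num) x) =
            2 * pairPos i j x - pairMax i j x := by
          rw [pairPos_stretch, clamp_of_mem] <;> linarith [hpm x]
        rcases le_total (4 * pairPos i j x) (3 * pairMax i j x) with hy | hy
        · refine ((glue_eqAt_of_le ?_).precomp).trans (EqAt.trans ?_ (glue_eqAt_of_le ?_).symm)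
          · rw [sub_nonpos_iff_pairPos, e, pairMax_stretch]
            linarith
          · exact precomp_precomp_eqAt _ (stretch_stretch (by norm_num) (by norm_num))
          · simp only [Set.Icc.coe_zero]
            linarith
        · refine ((glue_eqAt_of_ge ?_).precomp).trans (EqAt.trans ?_ (glue_eqAt_of_ge ?_).symm)
          · rw [sub_nonneg_iff_pairPos, e, pairMax_stretch]
            linarith
          · exact precomp_precomp_eqAt _ (stretch_stretch (by norm_num) (by norm_num))
          · simp only [Set.Icc.coe_zero]
            linarith
      · rw [sub_nonneg_iff_pairPos] at hx
        simp only [Set.Icc.coe_zero]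
        linarith
  · refine ext_eqAt fun x => ?_
    rcases le_total ((x i : ℝ) - x j) 0 with hx | hx
    · refine (glue_eqAt_of_le hx).trans ?_
      rw [sub_nonpos_iff_pairPos] at hx
      have e : pairPos i j (stretch hij 2 0 le_rfl (by norm_num) x) = 2 * pairPos i j x := by
        rw [pairPos_stretch, clamp_of_mem] <;> linarith [hp x]
      rcases le_total (4 * pairPos i j x) (pairMax i j x) with hy | hy
      · refine ((glue_eqAt_of_le ?_).precomp).trans (EqAt.trans ?_ (glue_eqAt_of_le ?_).symm)
        · rw [sub_nonpos_iff_pairPos, e, pairMax_stretch]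
          linarith
        · exact precomp_precomp_eqAt _ (stretch_stretch (by norm_num) (by norm_num))
        · simp only [Set.Icc.coe_one]
          linarith
      · refine ((glue_eqAt_of_ge ?_).precomp).trans (EqAt.trans ?_
          ((glue_eqAt_of_ge ?_).trans (glue_eqAt_of_le ?_)).symm)
        · rw [sub_nonneg_iff_pairPos, e, pairMax_stretch]
          linarith
        · exact precomp_precomp_eqAt _ (stretch_stretch (by norm_num) (by norm_num))
        · simp only [Set.Icc.coe_one]
          linarith
        · simp only [Set.Icc.coe_one]
          linarith
    · refine (glue_eqAt_of_ge hx).trans ?_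
      rw [sub_nonneg_iff_pairPos] at hx
      refine EqAt.trans (precomp_eqAt _ ?_)
        ((glue_eqAt_of_ge ?_).trans (glue_eqAt_of_ge ?_)).symm
      · simp only [stretch_apply, Set.Icc.coe_one]
        norm_num
      · simp only [Set.Icc.coe_one]
        linarith [hm x]
      · simp only [Set.Icc.coe_one]
        linarith

end RelSphere

/-! ### Concatenation along one coordinate -/

namespace RelSphere

variable {A B : Type u} [TopologicalSpace A] [TopologicalSpace B] {n : ℕ} {f : C(A, B)} {a₀ : A}
  {i j : Fin n}

/-- The self-map of the disk that changes the coordinate `x i` to `p * x i - q`, truncated to the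
unit interval. -/
def coordMap (i : Fin n) (p q : ℝ) (hq : 0 ≤ q) (hp : q + 1 ≤ p) : CubeMap n where
  toFun x := Function.update x i (Set.projIcc 0 1 zero_le_one (p * x i - q))
  continuous_toFun := continuous_id.update _ (continuous_projIcc.comp (by fun_prop))
  map_zero x := by
    rintro ⟨l, hl⟩
    refine ⟨l, ?_⟩
    by_cases h : l = i
    · subst h
      rw [Function.update_self, projIcc_eq_zero]
      simpa [hl] using hq
    · rw [Function.update_of_ne h, hl]
  map_bdry x := by
    rintro ⟨l, hl⟩
    refine ⟨l, ?_⟩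
    by_cases h : l = i
    · subst h
      rw [Function.update_self]
      refine hl.imp (fun hl => projIcc_eq_zero ?_) (fun hl => projIcc_eq_one ?_)
      · simpa [hl] using hq
      · simp only [hl, Set.Icc.coe_one]
        linarith
    · rwa [Function.update_of_ne h]

variable {p q : ℝ} {hq : 0 ≤ q} {hp : q + 1 ≤ p}

theorem coordMap_self {x : Fin n → I} :
    coordMap i p q hq hp x i = Set.projIcc 0 1 zero_le_one (p * x i - q) :=
  Function.update_self _ _ _

theorem coordMap_of_ne {l : Fin n} (h : l ≠ i) {x : Fin n → I} : coordMap i p q hq hp x l = x l :=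
  Function.update_of_ne h _ _

theorem continuous_coordMap {p q : I → ℝ} (hq : ∀ t, 0 ≤ q t) (hp : ∀ t, q t + 1 ≤ p t)
    (cp : Continuous p) (cq : Continuous q) : Continuous fun z : I × (Fin n → I) =>
      coordMap i (p z.1) (q z.1) (hq z.1) (hp z.1) z.2 :=
  continuous_snd.update _ (continuous_projIcc.comp (by fun_prop))

theorem coordMap_one_zero (hq : 0 ≤ (0 : ℝ)) (hp : (0 : ℝ) + 1 ≤ 1) (x : Fin n → I) :
    coordMap i 1 0 hq hp x = x := by
  funext l
  by_cases h : l = i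
  · subst h
    rw [coordMap_self, one_mul, sub_zero, Set.projIcc_val]
  · rw [coordMap_of_ne h]

theorem baseAt_coordMap_upper (α : RelSphere n f a₀) {x : Fin n → I} (hx : (x i : ℝ) ≤ 1 / 2) :
    BaseAt (α.precomp (coordMap i 2 1 (by norm_num) (by norm_num))) x :=
  precomp_baseAt (baseAt_of_zero _ ⟨i, coordMap_self.trans (projIcc_eq_zero (by linarith))⟩)

theorem baseAt_coordMap_lower {β : RelSphere n f a₀} (hβ : ∀ x, x i = 1 → BaseAt β x)
    {x : Fin n → I} (hx : 1 / 2 ≤ (x i : ℝ)) :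
    BaseAt (β.precomp (coordMap i 2 0 le_rfl (by norm_num))) x :=
  precomp_baseAt (hβ _ (coordMap_self.trans (projIcc_eq_one (by linarith))))

/-- The concatenation of two squares along the coordinate `i`, if the first half is trivial at the
end. -/
def concatAt (i : Fin n) (α β : RelSphere n f a₀) (hβ : ∀ x, x i = 1 → BaseAt β x) :
    RelSphere n f a₀ :=
  glue (fun x => (x i : ℝ) - 1 / 2) (by fun_prop)
    (α.precomp (coordMap i 2 1 (by norm_num) (by norm_num)))
    (β.precomp (coordMap i 2 0 le_rfl (by norm_num)))
    (fun _ hx => baseAt_coordMap_upper α (by linarith))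
    (fun _ hx => baseAt_coordMap_lower hβ (by linarith))

/-- The maps `(1+t) x i - t` and `(1+t) x i` move `x i` down and up, respectively, and fix `x j`, so
they preserve the sides of `x i = x j`. The triviality of `β` at `x i = 1` replaces the base point
condition at the cut. -/
theorem addAt_homotopic_concatAt (hij : i ≠ j) (α β : RelSphere n f a₀)
    (hβ : ∀ x, x i = 1 → BaseAt β x) : Homotopic (addAt hij α β) (concatAt i α β hβ) := by
  have h2 : (1 : ℝ) + ((1 : I) : ℝ) = 2 := by simp; norm_num
  have key := addAt_homotopic_glue hij (α := α) (β := β)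
    (h := fun x => (x i : ℝ) - 1 / 2) (by fun_prop)
    (d := fun t => coordMap i (1 + t) t t.2.1 (by linarith))
    (m := fun t => coordMap i (1 + t) 0 le_rfl (by linarith [t.2.1]))
    (continuous_coordMap (p := fun t => 1 + (t : ℝ)) (q := fun t => t) (fun t => t.2.1)
      (fun t => by linarith) (by fun_prop) (by fun_prop))
    (continuous_coordMap (p := fun t => 1 + (t : ℝ)) (q := fun t => 0) (fun t => le_rfl)
      (fun t => by linarith [t.2.1]) (by fun_prop) (by fun_prop))
    (fun x => by simpa using coordMap_one_zero le_rfl (by simp) x)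
    (fun x => by simpa using coordMap_one_zero le_rfl (by simp) x)
    (fun x hx => ⟨i, coordMap_self.trans (projIcc_eq_zero (by
      simp only [Set.Icc.coe_one]
      linarith))⟩)
    (fun x hx => Or.inr ⟨coordMap_self.trans (projIcc_eq_one (by
      simp only [Set.Icc.coe_one]
      linarith)), hβ⟩)
    (fun t x => by
      rw [coordMap_self, Set.coe_projIcc]
      have := mul_nonneg t.2.1 (sub_nonneg.2 (x i).2.2)
      exact max_le (x i).2.1 ((min_le_right _ _).trans (by linarith)))
    (fun t x => coordMap_of_ne hij.symm)
    (fun t x => by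
      rw [coordMap_self, Set.coe_projIcc]
      have := mul_nonneg t.2.1 (x i).2.1
      exact le_max_of_le_right (le_min (x i).2.2 (by linarith)))
    (fun t x => coordMap_of_ne hij.symm)
    (fun x hx => by
      simp only [h2]
      exact baseAt_coordMap_upper α (by linarith))
    (fun x hx => by
      simp only [h2]
      exact baseAt_coordMap_lower hβ (by linarith))
  simp only [h2] at key
  exact key

end RelSphere

/-! ### The group structures, and the action of permutations of the coordinates -/

namespace GradedPreGroup.IsGroup

variable {d n : ℕ} {G : GradedPreGroup.{u} d}

theorem add_neg (hG : G.IsGroup) (h : d ≤ n) (x : G.carrier n) : G.add h x (G.neg h x) = G.zero n := by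
  rw [← hG.zero_add h (G.add h x _), ← hG.neg_add h (G.neg h x), hG.add_assoc h,
    ← hG.add_assoc h _ x, hG.neg_add h x, hG.zero_add h]

theorem eq_neg_of_add_eq_zero (hG : G.IsGroup) (h : d ≤ n) {x y : G.carrier n}
    (e : G.add h y x = G.zero n) : y = G.neg h x := by
  rw [← hG.add_zero h y, ← hG.add_neg h x, ← hG.add_assoc, e, hG.zero_add]

theorem neg_neg (hG : G.IsGroup) (h : d ≤ n) (x : G.carrier n) : G.neg h (G.neg h x) = x :=
  (hG.eq_neg_of_add_eq_zero h (hG.add_neg h x)).symm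

theorem neg_signed (hG : G.IsGroup) (h : d ≤ n) (e : ℤˣ) (x : G.carrier n) :
    G.neg h (G.signed e x) = G.signed (-e) x := by
  rcases Int.units_eq_one_or e with rfl | rfl
  · have h1 : ¬ ((1 : ℤˣ) = -1) := by decide
    simp [signed, h, h1]
  · have h1 : ¬ ((1 : ℤˣ) = -1) := by decide
    simp [signed, h, h1, hG.neg_neg]

end GradedPreGroup.IsGroup

theorem GradedPreGroup.signed_one {d n : ℕ} (G : GradedPreGroup.{u} d) (x : G.carrier n) :
    G.signed 1 x = x := by
  have h1 : ¬ ((1 : ℤˣ) = -1) := by decide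
  simp [signed, h1]

/-- The class of a square in the relative homotopy group. -/
def RelSphere.cls {A B : Type u} [TopologicalSpace A] [TopologicalSpace B] {f : C(A, B)} {a₀ : A}
    {n : ℕ} (α : RelSphere n f a₀) : (relHomotopyGroups f a₀).carrier n :=
  (⟦α⟧ : Quotient (RelSphere.setoid n f a₀))

/-- The class of a map `(I^n, ∂I^n) ⟶ (X, x₀)` in the homotopy group. -/
def loopCls {X : Type u} [TopologicalSpace X] {x₀ : X} {n : ℕ} (ρ : GenLoop (Fin n) X x₀) :
    (homotopyGroups X x₀).carrier n :=
  (⟦ρ⟧ : HomotopyGroup (Fin n) X x₀)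

theorem relHomotopyGroups_isGroup {A B : Type u} [TopologicalSpace A] [TopologicalSpace B]
    (f : C(A, B)) (a₀ : A) : (relHomotopyGroups f a₀).IsGroup where
  add_assoc h := by
    rintro ⟨α⟩ ⟨β⟩ ⟨γ⟩
    refine Quotient.sound ?_
    simp only [RelSphere.add_eq_addAt]
    exact RelSphere.addAt_assoc_homotopic _ α β γ
  zero_add h := by
    rintro ⟨α⟩
    refine Quotient.sound ?_
    simp only [RelSphere.add_eq_addAt]
    exact RelSphere.const_addAt_homotopic _ α
  add_zero h := by
    rintro ⟨α⟩
    refine Quotient.sound ?_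
    simp only [RelSphere.add_eq_addAt]
    exact RelSphere.addAt_const_homotopic _ α
  neg_add h := by
    rintro ⟨α⟩
    refine Quotient.sound ?_
    simp only [RelSphere.add_eq_addAt]
    exact RelSphere.permute_swap_addAt_homotopic _ α
  add_comm h h' := by
    rintro ⟨α⟩ ⟨β⟩
    refine Quotient.sound ?_
    simp only [RelSphere.add_eq_addAt]
    exact RelSphere.addAt_comm_homotopic h' _ α β

/-! ### Coordinate permutations act on relative homotopy groups through their sign -/

section Permute

variable {A B : Type u} [TopologicalSpace A] [TopologicalSpace B] {f : C(A, B)} {a₀ : A} {n : ℕ}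

/-- For `n = 2` the only increasing pair is `(0, 1)`, used in the definition of the sum; for a
decreasing pair the summands would be exchanged. For `n ≥ 3` the choice of pair is immaterial. -/
theorem RelSphere.add_homotopic_addAt (h : 2 ≤ n) {i j : Fin n} (hij : i ≠ j)
    (hn : n = 2 → i < j) (α β : RelSphere n f a₀) : Homotopic (add h α β) (addAt hij α β) := by
  rw [add_eq_addAt]
  rcases h.eq_or_lt with h | h
  · have h₁ := hn h.symm
    have h1 : 1 < n := h.le
    have hi : ⟨0, zero_lt_one.trans h1⟩ = i := Fin.ext (by have := j.2; simp only; omega)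
    have hj : ⟨1, h1⟩ = j := Fin.ext (by have := j.2; simp only; omega)
    subst hi hj
    exact Homotopic.refl _
  · exact addAt_indep h _ _ α β

/-- The transposed square is a left inverse for the sum along `(i, j)`, and that sum represents the
group operation once `i < j`. -/
theorem relHomotopyGroups_swap (h : 2 ≤ n) {i j : Fin n} (hij : i ≠ j) (α : RelSphere n f a₀) :
    (RelSphere.permute (Equiv.swap i j) α).cls = (relHomotopyGroups f a₀).neg h α.cls := by
  wlog hlt : i < j generalizing i j
  · rw [Equiv.swap_comm]
    exact this hij.symm (lt_of_le_of_ne (not_lt.1 hlt) hij.symm)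
  · refine (relHomotopyGroups_isGroup f a₀).eq_neg_of_add_eq_zero h (Quotient.sound ?_)
    exact (RelSphere.add_homotopic_addAt h hij (fun _ => hlt) _ _).trans
      (RelSphere.permute_swap_addAt_homotopic hij α)

/-- Transpositions generate, and each contributes one negation. A transposition exists only for `n ≥
2`, where negation is defined. -/
theorem relHomotopyGroups_permute (θ : Equiv.Perm (Fin n)) (α : RelSphere n f a₀) :
    (RelSphere.permute θ α).cls =
      (relHomotopyGroups f a₀).signed (Equiv.Perm.sign θ) α.cls := by
  induction θ using Equiv.Perm.swap_induction_on with
  | one => rw [Equiv.Perm.sign_one, GradedPreGroup.signed_one]; rfl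
  | swap_mul θ i j hij ih =>
    have h : 2 ≤ n := by
      have := i.2
      have := j.2
      have := Fin.val_ne_of_ne hij
      omega
    rw [Equiv.Perm.sign_mul, Equiv.Perm.sign_swap hij, neg_one_mul,
      ← (relHomotopyGroups_isGroup f a₀).neg_signed h, ← ih, ← relHomotopyGroups_swap h hij]
    rfl

end Permute

/-! ### Absolute homotopy groups, regarded as relative groups of the inclusion of the base point -/

section Absolute

variable {X : Type u} [TopologicalSpace X] {x₀ : X} {n : ℕ}

/-- A map `(I^n, ∂I^n) ⟶ (X, x₀)` as a square, for the inclusion of the base point into `X`. -/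
def RelSphere.ofGenLoop (ρ : GenLoop (Fin n) X x₀) :
    RelSphere n (ContinuousMap.const PUnit.{u + 1} x₀) PUnit.unit where
  disk := ρ.1
  bdry := ContinuousMap.const _ PUnit.unit
  comm x := (ρ.2 x.1 x.2).symm
  base _ _ := rfl

theorem GenLoop.homotopic_of_ofGenLoop {ρ η : GenLoop (Fin n) X x₀}
    (h : RelSphere.Homotopic (RelSphere.ofGenLoop ρ) (RelSphere.ofGenLoop η)) :
    GenLoop.Homotopic ρ η := by
  obtain ⟨H, hH, h0, h1⟩ := h
  refine ⟨⟨⟨⟨fun z => (H z.1).disk z.2, hH.disk⟩, fun x => ?_, fun x => ?_⟩, fun t x hx => ?_⟩⟩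
  · exact congrArg (fun α => RelSphere.disk α x) h0
  · exact congrArg (fun α => RelSphere.disk α x) h1
  · exact ((H t).comm ⟨x, hx⟩).symm.trans (ρ.2 x hx).symm

theorem RelSphere.ofGenLoop_baseAt (ρ : GenLoop (Fin n) X x₀) {x : Fin n → I}
    (hx : x ∈ Cube.boundary (Fin n)) : BaseAt (ofGenLoop ρ) x :=
  ⟨ρ.2 x hx, fun _ => rfl⟩

/-- The order is reversed because the second argument of `concatAt` occupies the first half. -/
theorem RelSphere.ofGenLoop_transAt (i : Fin n) (ρ η : GenLoop (Fin n) X x₀) :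
    ofGenLoop (GenLoop.transAt i ρ η) = concatAt i (ofGenLoop η) (ofGenLoop ρ)
      (fun _ hx => ofGenLoop_baseAt _ ⟨i, Or.inr hx⟩) := by
  refine ext_eqAt fun x => ⟨?_, fun _ => rfl⟩
  rcases le_or_gt (x i : ℝ) (1 / 2) with hx | hx
  · refine ((if_pos hx).trans ?_).trans (glue_eqAt_of_le (by linarith)).1.symm
    change ρ _ = ρ (Function.update x i _)
    rw [sub_zero]
  · refine ((if_neg hx.not_ge).trans ?_).trans (glue_eqAt_of_ge (by linarith)).1.symm
    rfl

theorem homotopyGroups_add (h : 1 ≤ n) (i : Fin n) (ρ η : GenLoop (Fin n) X x₀) :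
    (homotopyGroups X x₀).add h (loopCls ρ) (loopCls η) = loopCls (GenLoop.transAt i η ρ) :=
  haveI : Nonempty (Fin n) := ⟨⟨0, h⟩⟩
  HomotopyGroup.mul_spec

theorem homotopyGroups_isGroup (X : Type u) [TopologicalSpace X] (x₀ : X) :
    (homotopyGroups X x₀).IsGroup where
  add_assoc {n} h x y z :=
    haveI : Nonempty (Fin n) := ⟨⟨0, h⟩⟩
    mul_assoc (G := HomotopyGroup (Fin n) X x₀) x y z
  zero_add {n} h x :=
    haveI : Nonempty (Fin n) := ⟨⟨0, h⟩⟩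
    one_mul (M := HomotopyGroup (Fin n) X x₀) x
  add_zero {n} h x :=
    haveI : Nonempty (Fin n) := ⟨⟨0, h⟩⟩
    mul_one (M := HomotopyGroup (Fin n) X x₀) x
  neg_add {n} h x :=
    haveI : Nonempty (Fin n) := ⟨⟨0, h⟩⟩
    inv_mul_cancel (G := HomotopyGroup (Fin n) X x₀) x
  add_comm {n} h h' := by
    rintro ⟨ρ⟩ ⟨η⟩
    refine (homotopyGroups_add h ⟨0, h⟩ ρ η).trans (Eq.trans ?_
      (homotopyGroups_add h ⟨0, h⟩ η ρ).symm)
    have : Nontrivial (Fin n) := Fin.nontrivial_iff_two_le.2 h'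
    have : Nonempty (Fin n) := ⟨⟨0, h⟩⟩
    refine (HomotopyGroup.mul_spec (i := (⟨0, h⟩ : Fin n))).symm.trans
      (Eq.trans ?_ HomotopyGroup.mul_spec)
    exact mul_comm (G := HomotopyGroup (Fin n) X x₀) _ _

/-- Concatenation along `i` is homotopic to the sum along `(i, j)`, for which the transposed square
is an inverse. -/
theorem homotopyGroups_swap (h : 1 ≤ n) {i j : Fin n} (hij : i ≠ j) (ρ : GenLoop (Fin n) X x₀) :
    loopCls (GenLoop.congr x₀ (Equiv.swap i j) ρ) = (homotopyGroups X x₀).neg h (loopCls ρ) := by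
  refine (homotopyGroups_isGroup X x₀).eq_neg_of_add_eq_zero h ?_
  refine (homotopyGroups_add h i _ ρ).trans (Quotient.sound (GenLoop.homotopic_of_ofGenLoop ?_))
  rw [RelSphere.ofGenLoop_transAt]
  exact (RelSphere.addAt_homotopic_concatAt hij _ _ _).symm.trans
    (RelSphere.permute_swap_addAt_homotopic hij (RelSphere.ofGenLoop ρ))

theorem homotopyGroups_permute (θ : Equiv.Perm (Fin n)) (ρ : GenLoop (Fin n) X x₀) :
    loopCls (GenLoop.congr x₀ θ ρ) =
      (homotopyGroups X x₀).signed (Equiv.Perm.sign θ) (loopCls ρ) := by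
  induction θ using Equiv.Perm.swap_induction_on with
  | one => rw [Equiv.Perm.sign_one, GradedPreGroup.signed_one]; rfl
  | swap_mul θ i j hij ih =>
    have h : 1 ≤ n := by
      have := i.2
      omega
    rw [Equiv.Perm.sign_mul, Equiv.Perm.sign_swap hij, neg_one_mul,
      ← (homotopyGroups_isGroup X x₀).neg_signed h, ← ih, ← homotopyGroups_swap h hij]
    rfl

end Absolute

/-! ### Signs of block permutations -/

section Signs

variable {k : ℕ}

theorem finSigmaFinEquiv_lt_of_lt {n : Fin k → ℕ} {i j : Fin k} (h : i < j) (a : Fin (n i))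
    (b : Fin (n j)) : finSigmaFinEquiv ⟨i, a⟩ < finSigmaFinEquiv ⟨j, b⟩ := by
  -- Extending the block sizes by zero turns the offsets of the blocks into partial sums over
  -- ranges, which can be compared.
  let N : ℕ → ℕ := fun l => if h : l < k then n ⟨l, h⟩ else 0
  have hN : ∀ i : Fin k, ∑ l : Fin i, n (Fin.castLE i.2.le l) = ∑ l ∈ Finset.range i, N l := by
    intro i
    rw [Finset.sum_range]
    refine Finset.sum_congr rfl fun l _ => ?_
    simp only [N]
    rw [dif_pos (l.2.trans i.2)]
    rfl
  rw [Fin.lt_def, finSigmaFinEquiv_apply, finSigmaFinEquiv_apply]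
  simp only [hN]
  have h1 : ∑ l ∈ Finset.range (i + 1), N l ≤ ∑ l ∈ Finset.range j, N l :=
    Finset.sum_le_sum_of_subset (Finset.range_mono h)
  have h2 : N i = n i := by simp [N]
  rw [Finset.sum_range_succ, h2] at h1
  have := a.2
  omega

theorem finSigmaFinEquiv_lt_iff {n : Fin k → ℕ} {i j : Fin k} {a : Fin (n i)} {b : Fin (n j)} :
    finSigmaFinEquiv ⟨i, a⟩ < finSigmaFinEquiv ⟨j, b⟩ ↔ i < j ∨ i = j ∧ (a : ℕ) < b := by
  rcases lt_trichotomy i j with h | h | h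
  · simp [h, finSigmaFinEquiv_lt_of_lt h]
  · subst h
    rw [Fin.lt_def, finSigmaFinEquiv_apply, finSigmaFinEquiv_apply]
    simp
  · simp [h.ne', h.not_gt, (finSigmaFinEquiv_lt_of_lt h b a).le]

theorem lexEquiv_symm_lt_iff {n : Fin k → ℕ} {N : ℕ} {h : ∑ i, n i = N} {e e' : Fin N} :
    e < e' ↔ ((lexEquiv n N h).symm e).1 < ((lexEquiv n N h).symm e').1 ∨
      ((lexEquiv n N h).symm e).1 = ((lexEquiv n N h).symm e').1 ∧
        (((lexEquiv n N h).symm e).2 : ℕ) < ((lexEquiv n N h).symm e').2 := by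
  obtain ⟨⟨i, a⟩, rfl⟩ := (lexEquiv n N h).surjective e
  obtain ⟨⟨j, b⟩, rfl⟩ := (lexEquiv n N h).surjective e'
  rw [Equiv.symm_apply_apply, Equiv.symm_apply_apply]
  exact finSigmaFinEquiv_lt_iff

variable {n₀ : ℕ} {n : Fin k → ℕ} {N : ℕ} {h : n₀ + ∑ i, n i = N}

theorem cubeEquiv_inl_val (a : Fin n₀) : (cubeEquiv n₀ n N h (Sum.inl a) : ℕ) = a := by
  simp [cubeEquiv]

theorem cubeEquiv_inr_val (p : Σ i, Fin (n i)) :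
    (cubeEquiv n₀ n N h (Sum.inr p) : ℕ) = n₀ + finSigmaFinEquiv p := by
  simp [cubeEquiv]

theorem cubeEquiv_inl_lt_inl {a b : Fin n₀} :
    cubeEquiv n₀ n N h (Sum.inl a) < cubeEquiv n₀ n N h (Sum.inl b) ↔ a < b := by
  rw [Fin.lt_def, cubeEquiv_inl_val, cubeEquiv_inl_val, Fin.lt_def]

theorem cubeEquiv_inl_lt_inr {a : Fin n₀} {p : Σ i, Fin (n i)} :
    cubeEquiv n₀ n N h (Sum.inl a) < cubeEquiv n₀ n N h (Sum.inr p) ↔ True := by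
  rw [Fin.lt_def, cubeEquiv_inl_val, cubeEquiv_inr_val]
  have := a.2
  simp only [iff_true]
  omega

theorem cubeEquiv_inr_lt_inl {a : Fin n₀} {p : Σ i, Fin (n i)} :
    cubeEquiv n₀ n N h (Sum.inr p) < cubeEquiv n₀ n N h (Sum.inl a) ↔ False :=
  iff_false_intro (cubeEquiv_inl_lt_inr.2 trivial).le.not_gt

theorem cubeEquiv_inr_lt_inr {i j : Fin k} {a : Fin (n i)} {b : Fin (n j)} :
    cubeEquiv n₀ n N h (Sum.inr ⟨i, a⟩) < cubeEquiv n₀ n N h (Sum.inr ⟨j, b⟩) ↔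
      i < j ∨ i = j ∧ (a : ℕ) < b := by
  rw [Fin.lt_def, cubeEquiv_inr_val, cubeEquiv_inr_val, Nat.add_lt_add_iff_left, ← Fin.lt_def,
    finSigmaFinEquiv_lt_iff]

/-- Two enumerations of `X` give two linear orders, and the sign of the comparison counts the pairs
ordered differently. This permits counting on sums and sigma types, without arithmetic in `Fin N`.
-/
theorem sign_symm_trans {X : Type*} [Fintype X] (e₁ e₂ : X ≃ Fin N) :
    Equiv.Perm.sign (e₁.symm.trans e₂) =
      ∏ x, ∏ y, if e₁ x < e₁ y ∧ e₂ y < e₂ x then (-1 : ℤˣ) else 1 := by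
  rw [Equiv.Perm.sign_eq_prod_prod_Ioi, ← e₁.prod_comp]
  refine Finset.prod_congr rfl fun x _ => ?_
  rw [← Finset.filter_lt_eq_Ioi, Finset.prod_filter, ← e₁.prod_comp]
  refine Finset.prod_congr rfl fun y _ => ?_
  simp only [Equiv.trans_apply, Equiv.symm_apply_apply]
  by_cases h1 : e₁ x < e₁ y
  · have : e₂ x ≠ e₂ y := fun h => h1.ne (congrArg e₁ (e₂.injective h))
    rcases lt_or_gt_of_ne this with h2 | h2
    · simp [h1, h2, h2.not_gt]
    · simp [h1, h2, h2.not_gt]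
  · simp [h1]

/-- The permutation of the coordinates of `I^N` induced by a permutation of the blocks. -/
def blockCubePerm (θ : Equiv.Perm (Fin k)) (h : n₀ + ∑ i, n i = N)
    (h' : n₀ + ∑ i, n (θ i) = N) : Equiv.Perm (Fin N) :=
  (cubeEquiv n₀ (fun i => n (θ i)) N h').symm.trans
    (((Equiv.refl _).sumCongr (Equiv.sigmaCongrLeft (β := fun i => Fin (n i)) θ)).trans
      (cubeEquiv n₀ n N h))

variable {θ : Equiv.Perm (Fin k)} {h' : n₀ + ∑ i, n (θ i) = N}

theorem blockCubePerm_inl (a : Fin n₀) :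
    blockCubePerm θ h h' (cubeEquiv n₀ (fun i => n (θ i)) N h' (Sum.inl a)) =
      cubeEquiv n₀ n N h (Sum.inl a) := by
  simp [blockCubePerm]

theorem blockCubePerm_inr (i : Fin k) (a : Fin (n (θ i))) :
    blockCubePerm θ h h' (cubeEquiv n₀ (fun i => n (θ i)) N h' (Sum.inr ⟨i, a⟩)) =
      cubeEquiv n₀ n N h (Sum.inr ⟨θ i, a⟩) := by
  simp [blockCubePerm, Equiv.sigmaCongrLeft]

/-- Entries of the head block come first in both orders and are never inverted. Two entries of the
other blocks are inverted exactly if their blocks are, so an inverted pair of blocks contributes the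
product of its sizes. -/
theorem sign_blockCubePerm : Equiv.Perm.sign (blockCubePerm θ h h') = koszulSign θ n := by
  rw [blockCubePerm, sign_symm_trans, koszulSign, Fintype.prod_prod_type, Fintype.prod_sum_type]
  have h1 : ∀ a : Fin n₀, ∏ y : Fin n₀ ⊕ (Σ i, Fin (n (θ i))),
      (if cubeEquiv n₀ (fun i => n (θ i)) N h' (Sum.inl a) <
          cubeEquiv n₀ (fun i => n (θ i)) N h' y ∧
        (((Equiv.refl _).sumCongr (Equiv.sigmaCongrLeft (β := fun i => Fin (n i)) θ)).trans
          (cubeEquiv n₀ n N h)) y <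
        (((Equiv.refl _).sumCongr (Equiv.sigmaCongrLeft (β := fun i => Fin (n i)) θ)).trans
          (cubeEquiv n₀ n N h)) (Sum.inl a) then (-1 : ℤˣ) else 1) = 1 := by
    intro a
    refine Finset.prod_eq_one fun y _ => if_neg ?_
    rcases y with b | ⟨i, b⟩
    · simp only [Equiv.trans_apply, Equiv.sumCongr_apply, Sum.map_inl, Equiv.refl_apply,
        cubeEquiv_inl_lt_inl]
      exact fun h => h.1.not_gt h.2
    · simp [cubeEquiv_inr_lt_inl]
  simp only [h1, Finset.prod_const_one, one_mul, Fintype.prod_sigma]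
  refine Finset.prod_congr rfl fun i _ => ?_
  have h2 : ∀ a : Fin (n (θ i)), ∏ y : Fin n₀ ⊕ (Σ i, Fin (n (θ i))),
      (if cubeEquiv n₀ (fun i => n (θ i)) N h' (Sum.inr ⟨i, a⟩) <
          cubeEquiv n₀ (fun i => n (θ i)) N h' y ∧
        (((Equiv.refl _).sumCongr (Equiv.sigmaCongrLeft (β := fun i => Fin (n i)) θ)).trans
          (cubeEquiv n₀ n N h)) y <
        (((Equiv.refl _).sumCongr (Equiv.sigmaCongrLeft (β := fun i => Fin (n i)) θ)).trans
          (cubeEquiv n₀ n N h)) (Sum.inr ⟨i, a⟩) then (-1 : ℤˣ) else 1) =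
      ∏ j, if i < j ∧ θ j < θ i then (-1 : ℤˣ) ^ n (θ j) else 1 := by
    intro a
    rw [Fintype.prod_sum_type, Finset.prod_eq_one, one_mul, Fintype.prod_sigma]
    · refine Finset.prod_congr rfl fun j _ => ?_
      have : ∀ b : Fin (n (θ j)), (cubeEquiv n₀ (fun i => n (θ i)) N h' (Sum.inr ⟨i, a⟩) <
          cubeEquiv n₀ (fun i => n (θ i)) N h' (Sum.inr ⟨j, b⟩) ∧
        (((Equiv.refl _).sumCongr (Equiv.sigmaCongrLeft (β := fun i => Fin (n i)) θ)).trans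
          (cubeEquiv n₀ n N h)) (Sum.inr ⟨j, b⟩) <
        (((Equiv.refl _).sumCongr (Equiv.sigmaCongrLeft (β := fun i => Fin (n i)) θ)).trans
          (cubeEquiv n₀ n N h)) (Sum.inr ⟨i, a⟩)) ↔ i < j ∧ θ j < θ i := by
        intro b
        simp only [Equiv.trans_apply, Equiv.sumCongr_apply, Sum.map_inr, Equiv.sigmaCongrLeft_apply,
          cubeEquiv_inr_lt_inr, θ.injective.eq_iff]
        constructor
        · rintro ⟨h | h, h' | h'⟩
          · exact ⟨h, h'⟩
          · exact absurd h'.1 h.ne'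
          · exact absurd (congrArg θ h.1) h'.ne'
          · omega
        · exact fun h => ⟨Or.inl h.1, Or.inl h.2⟩
      simp only [this]
      split_ifs <;> simp
    · intro b _
      simp [cubeEquiv_inr_lt_inl]
  simp only [h2]
  rw [Finset.prod_comm]
  refine Finset.prod_congr rfl fun j _ => ?_
  rw [Finset.prod_const, Finset.card_univ, Fintype.card_fin]
  split_ifs with hlt
  · rw [← pow_mul, mul_comm]
  · exact one_pow _

end Signs

/-! ### The shuffle of coordinates in iterated products, and its sign -/

section Shuffle

variable {k : ℕ} {j : Fin k → ℕ} {l : ℕ} (hl : ∑ i, j i = l) {a₀ : ℕ} {a : Fin k → ℕ} {A : ℕ}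
  (hA : a₀ + ∑ i, a i = A) {c : ∀ i, Fin (j i) → ℕ} {C : Fin k → ℕ}
  (hC : ∀ i, a i + ∑ b, c i b = C i) {D : ℕ} (hD : a₀ + ∑ i, C i = D)
  (hD' : A + ∑ e : Fin l, c ((lexEquiv j l hl).symm e).1 ((lexEquiv j l hl).symm e).2 = D)

/-- The coordinates in the order in which all `a i` precede all `c i b`. -/
def shuffleLeft : (Fin a₀ ⊕ Σ i, Fin (a i)) ⊕
    (Σ e : Fin l, Fin (c ((lexEquiv j l hl).symm e).1 ((lexEquiv j l hl).symm e).2)) ≃ Fin D :=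
  ((cubeEquiv a₀ a A hA).sumCongr (Equiv.refl _)).trans (cubeEquiv A _ D hD')

/-- The coordinates in the order in which `a i` is followed by all `c i b`. -/
def shuffleRight : (Fin a₀ ⊕ Σ i, Fin (a i)) ⊕
    (Σ e : Fin l, Fin (c ((lexEquiv j l hl).symm e).1 ((lexEquiv j l hl).symm e).2)) ≃ Fin D :=
  (Equiv.sumAssoc _ _ _).trans (((Equiv.refl _).sumCongr
    (((Equiv.refl _).sumCongr ((Equiv.sigmaCongrLeft
      (β := fun p : Σ i, Fin (j i) => Fin (c p.1 p.2)) (lexEquiv j l hl).symm).trans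
        (Equiv.sigmaAssoc fun i b => Fin (c i b)))).trans
      ((Equiv.sigmaSumDistrib _ _).symm.trans
        (Equiv.sigmaCongrRight fun i => cubeEquiv (a i) (c i) (C i) (hC i))))).trans
    (cubeEquiv a₀ C D hD))

/-- The permutation of coordinates that occurs in the associativity of products. -/
def shufflePerm : Equiv.Perm (Fin D) :=
  (shuffleRight hl hC hD).symm.trans (shuffleLeft hl hA hD')

theorem shuffleRight_head (x : Fin a₀) : shuffleRight hl hC hD (Sum.inl (Sum.inl x)) =
    cubeEquiv a₀ C D hD (Sum.inl x) :=
  rfl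

theorem shuffleRight_inl (i : Fin k) (x : Fin (a i)) :
    shuffleRight hl hC hD (Sum.inl (Sum.inr ⟨i, x⟩)) =
      cubeEquiv a₀ C D hD (Sum.inr ⟨i, cubeEquiv _ _ _ (hC i) (Sum.inl x)⟩) :=
  rfl

theorem shuffleRight_inr (e : Fin l)
    (x : Fin (c ((lexEquiv j l hl).symm e).1 ((lexEquiv j l hl).symm e).2)) :
    shuffleRight hl hC hD (Sum.inr ⟨e, x⟩) =
      cubeEquiv a₀ C D hD (Sum.inr ⟨((lexEquiv j l hl).symm e).1,
        cubeEquiv _ _ _ (hC _) (Sum.inr ⟨((lexEquiv j l hl).symm e).2, x⟩)⟩) :=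
  rfl

theorem shufflePerm_shuffleRight (y) :
    shufflePerm hl hA hC hD hD' (shuffleRight hl hC hD y) = shuffleLeft hl hA hD' y := by
  rw [shufflePerm, Equiv.trans_apply, Equiv.symm_apply_apply]

theorem shufflePerm_head (x : Fin a₀) :
    shufflePerm hl hA hC hD hD' (cubeEquiv a₀ C D hD (Sum.inl x)) =
      cubeEquiv A _ D hD' (Sum.inl (cubeEquiv a₀ a A hA (Sum.inl x))) :=
  shufflePerm_shuffleRight hl hA hC hD hD' (Sum.inl (Sum.inl x))

theorem shufflePerm_inl (i : Fin k) (x : Fin (a i)) :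
    shufflePerm hl hA hC hD hD' (cubeEquiv a₀ C D hD (Sum.inr ⟨i, cubeEquiv _ _ _ (hC i)
      (Sum.inl x)⟩)) =
      cubeEquiv A _ D hD' (Sum.inl (cubeEquiv a₀ a A hA (Sum.inr ⟨i, x⟩))) :=
  shufflePerm_shuffleRight hl hA hC hD hD' (Sum.inl (Sum.inr ⟨i, x⟩))

theorem shufflePerm_inr (e : Fin l)
    (x : Fin (c ((lexEquiv j l hl).symm e).1 ((lexEquiv j l hl).symm e).2)) :
    shufflePerm hl hA hC hD hD' (cubeEquiv a₀ C D hD (Sum.inr ⟨((lexEquiv j l hl).symm e).1,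
      cubeEquiv _ _ _ (hC _) (Sum.inr ⟨((lexEquiv j l hl).symm e).2, x⟩)⟩)) =
      cubeEquiv A _ D hD' (Sum.inr ⟨e, x⟩) :=
  shufflePerm_shuffleRight hl hA hC hD hD' (Sum.inr ⟨e, x⟩)

theorem cubeEquiv_inr_val_lt_iff {i i' : Fin k} (h : i = i') {p : Σ b, Fin (c i b)}
    {p' : Σ b, Fin (c i' b)} : (cubeEquiv (a i) (c i) (C i) (hC i) (Sum.inr p) : ℕ) <
      cubeEquiv (a i') (c i') (C i') (hC i') (Sum.inr p') ↔
    (p.1 : ℕ) < p'.1 ∨ (p.1 : ℕ) = p'.1 ∧ (p.2 : ℕ) < p'.2 := by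
  subst h
  rw [← Fin.lt_def, cubeEquiv_inr_lt_inr, Fin.lt_def, Fin.ext_iff]

/-- The pairs of coordinates whose order is changed. -/
theorem shuffle_inversion_iff (x y : (Fin a₀ ⊕ Σ i, Fin (a i)) ⊕
    (Σ e : Fin l, Fin (c ((lexEquiv j l hl).symm e).1 ((lexEquiv j l hl).symm e).2))) :
    (shuffleRight hl hC hD x < shuffleRight hl hC hD y ∧
      shuffleLeft hl hA hD' y < shuffleLeft hl hA hD' x) ↔
    ∃ e z i w, x = Sum.inr ⟨e, z⟩ ∧ y = Sum.inl (Sum.inr ⟨i, w⟩) ∧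
      ((lexEquiv j l hl).symm e).1 < i := by
  rcases x with (x | ⟨i, x⟩) | ⟨e, x⟩ <;> rcases y with (y | ⟨i', y⟩) | ⟨e', y⟩
  · simp only [shuffleRight_head, shuffleLeft, Equiv.trans_apply, Equiv.sumCongr_apply,
      Sum.map_inl, cubeEquiv_inl_lt_inl]
    simp only [reduceCtorEq, false_and, exists_false, iff_false]
    exact fun h => h.1.not_gt h.2
  · simp [shuffleLeft, cubeEquiv_inl_lt_inl, cubeEquiv_inr_lt_inl]
  · simp [shuffleLeft, cubeEquiv_inr_lt_inl]
  · simp [shuffleRight_head, shuffleRight_inl, cubeEquiv_inr_lt_inl]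
  · simp only [shuffleRight_inl, shuffleLeft, Equiv.trans_apply, Equiv.sumCongr_apply,
      Sum.map_inl, cubeEquiv_inl_lt_inl, cubeEquiv_inr_lt_inr, cubeEquiv_inl_val]
    simp only [reduceCtorEq, false_and, exists_false, iff_false]
    omega
  · simp [shuffleLeft, cubeEquiv_inr_lt_inl]
  · simp [shuffleRight_head, shuffleRight_inr, cubeEquiv_inr_lt_inl]
  · simp only [shuffleRight_inl, shuffleRight_inr, shuffleLeft, Equiv.trans_apply,
      Equiv.sumCongr_apply, Sum.map_inl, Sum.map_inr, Equiv.refl_apply, cubeEquiv_inl_lt_inr,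
      and_true, cubeEquiv_inr_lt_inr]
    constructor
    · rintro (h | ⟨h, h'⟩)
      · exact ⟨e, x, i', y, rfl, rfl, h⟩
      -- Within one block `i` the coordinates of `a i` precede those of all `c i b` in both orders,
      -- so there is no inversion.
      · rw [cubeEquiv_inr_val, cubeEquiv_inl_val] at h'
        have := y.2
        subst h
        omega
    · rintro ⟨e₁, z, i₁, w, h₁, h₂, h⟩
      simp only [Sum.inr.injEq, Sum.inl.injEq] at h₁ h₂
      obtain rfl : e = e₁ := congrArg Sigma.fst h₁
      obtain rfl : i' = i₁ := congrArg Sigma.fst h₂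
      exact Or.inl h
  · simp only [reduceCtorEq, false_and, and_false, exists_false, iff_false]
    simp only [shuffleRight_inr, shuffleLeft, Equiv.trans_apply,
      Equiv.sumCongr_apply, Sum.map_inr, Equiv.refl_apply,
      cubeEquiv_inr_lt_inr]
    rintro ⟨h | ⟨h, h₂⟩, h' | ⟨rfl, h'⟩⟩
    · rw [lexEquiv_symm_lt_iff (h := hl)] at h'
      omega
    · exact lt_irrefl _ h
    · rw [cubeEquiv_inr_val_lt_iff hC h] at h₂
      rw [lexEquiv_symm_lt_iff (h := hl)] at h'
      simp only at h₂
      omega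
    · rw [cubeEquiv_inr_val_lt_iff hC h] at h₂
      simp only at h₂
      omega

/-- The only inversions are between a coordinate of some `c i b` and a coordinate of `a i'` with `i
< i'`. Each pair `i < i'` therefore contributes the total size of the `c i b` times `a i'`. -/
theorem sign_shufflePerm :
    Equiv.Perm.sign (shufflePerm hl hA hC hD hD') = shuffleSign a (fun i => ∑ b, c i b) := by
  classical
  rw [shufflePerm, sign_symm_trans, shuffleSign, Fintype.prod_prod_type]
  simp only [shuffle_inversion_iff]
  have h1 : ∀ (e : Fin l)
      (z : Fin (c ((lexEquiv j l hl).symm e).1 ((lexEquiv j l hl).symm e).2)),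
      (∏ y : (Fin a₀ ⊕ Σ i, Fin (a i)) ⊕
        (Σ e : Fin l, Fin (c ((lexEquiv j l hl).symm e).1 ((lexEquiv j l hl).symm e).2)),
        if ∃ e' z' i w, (Sum.inr ⟨e, z⟩ : (Fin a₀ ⊕ Σ i, Fin (a i)) ⊕
          (Σ e : Fin l, Fin (c ((lexEquiv j l hl).symm e).1 ((lexEquiv j l hl).symm e).2))) =
            Sum.inr ⟨e', z'⟩ ∧ y = Sum.inl (Sum.inr ⟨i, w⟩) ∧
            ((lexEquiv j l hl).symm e').1 < i then (-1 : ℤˣ) else 1) =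
      ∏ i, if ((lexEquiv j l hl).symm e).1 < i then (-1) ^ a i else 1 := by
    intro e z
    rw [Fintype.prod_sum_type, Fintype.prod_sum_type, Fintype.prod_sigma]
    refine Eq.trans (congrArg₂ (· * ·) (congrArg₂ (· * ·) (Finset.prod_eq_one fun y _ => ?_)
      (Finset.prod_congr rfl fun i _ => ?_ : _ = ∏ i, if ((lexEquiv j l hl).symm e).1 < i then
        (-1) ^ a i else (1 : ℤˣ))) (Finset.prod_eq_one fun y _ => ?_))
      (by simp only [one_mul, mul_one])
    · simp
    swap
    · simp
    have : ∀ w : Fin (a i), (∃ e' z' i' w', (Sum.inr ⟨e, z⟩ : (Fin a₀ ⊕ Σ i, Fin (a i)) ⊕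
          (Σ e : Fin l, Fin (c ((lexEquiv j l hl).symm e).1 ((lexEquiv j l hl).symm e).2))) =
            Sum.inr ⟨e', z'⟩ ∧ (Sum.inl (Sum.inr ⟨i, w⟩) : (Fin a₀ ⊕ Σ i, Fin (a i)) ⊕
          (Σ e : Fin l, Fin (c ((lexEquiv j l hl).symm e).1 ((lexEquiv j l hl).symm e).2))) =
            Sum.inl (Sum.inr ⟨i', w'⟩) ∧
            ((lexEquiv j l hl).symm e').1 < i') ↔ ((lexEquiv j l hl).symm e).1 < i := by
      intro w
      constructor
      · rintro ⟨e₁, z', i₁, w', h₁, h₂, h⟩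
        simp only [Sum.inr.injEq, Sum.inl.injEq] at h₁ h₂
        obtain rfl : e = e₁ := congrArg Sigma.fst h₁
        obtain rfl : i = i₁ := congrArg Sigma.fst h₂
        exact h
      · exact fun h => ⟨e, z, i, w, rfl, rfl, h⟩
    simp only [this]
    split_ifs <;> simp
  rw [Fintype.prod_sum_type, Fintype.prod_sigma]
  simp only [h1]
  simp only [reduceCtorEq, false_and, exists_false, if_false, Finset.prod_const_one,
      one_mul, Finset.prod_const, Finset.card_univ, Fintype.card_fin]
  rw [(lexEquiv j l hl).symm.prod_comp
    (fun p => (∏ i, if p.1 < i then (-1 : ℤˣ) ^ a i else 1) ^ c p.1 p.2), Fintype.prod_sigma]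
  refine Finset.prod_congr rfl fun i _ => ?_
  refine (Finset.prod_pow_eq_pow_sum Finset.univ (c i)
    (∏ i', if i < i' then (-1 : ℤˣ) ^ a i' else 1)).trans ?_
  rw [← Finset.prod_pow]
  refine Finset.prod_congr rfl fun i' _ => ?_
  split_ifs
  · rw [← pow_mul, mul_comm]
  · exact one_pow _

end Shuffle

/-! ### Blocks of coordinates -/

section Blocks

variable {k : ℕ} {n₀ : ℕ} {n : Fin k → ℕ} {N : ℕ} {h : n₀ + ∑ i, n i = N}

theorem mem_boundary_iff_blocks {x : Fin N → I} : x ∈ Cube.boundary (Fin N) ↔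
    headBlock h x ∈ Cube.boundary (Fin n₀) ∨ ∃ i, block h i x ∈ Cube.boundary (Fin (n i)) := by
  constructor
  · rintro ⟨c, hc⟩
    obtain ⟨a | ⟨i, a⟩, rfl⟩ := (cubeEquiv n₀ n N h).surjective c
    · exact Or.inl ⟨a, hc⟩
    · exact Or.inr ⟨i, a, hc⟩
  · rintro (⟨a, ha⟩ | ⟨i, a, ha⟩)
    · exact ⟨_, ha⟩
    · exact ⟨_, ha⟩

theorem continuous_headBlock : Continuous (headBlock h) :=
  continuous_pi fun _ => continuous_apply _

theorem continuous_block (i : Fin k) : Continuous (block h i) :=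
  continuous_pi fun _ => continuous_apply _

theorem headBlock_update_inl (x : Fin N → I) (a : Fin n₀) (v : I) :
    headBlock h (Function.update x (cubeEquiv n₀ n N h (Sum.inl a)) v) =
      Function.update (headBlock h x) a v := by
  funext b
  simp [headBlock, Function.update_apply]

theorem block_update_inl (x : Fin N → I) (a : Fin n₀) (v : I) (i : Fin k) :
    block h i (Function.update x (cubeEquiv n₀ n N h (Sum.inl a)) v) = block h i x := by
  funext b
  simp [block]

theorem headBlock_update_inr (x : Fin N → I) (i : Fin k) (a : Fin (n i)) (v : I) :
    headBlock h (Function.update x (cubeEquiv n₀ n N h (Sum.inr ⟨i, a⟩)) v) = headBlock h x := by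
  funext b
  simp [headBlock]

theorem block_update_inr (x : Fin N → I) (i : Fin k) (a : Fin (n i)) (v : I) :
    block h i (Function.update x (cubeEquiv n₀ n N h (Sum.inr ⟨i, a⟩)) v) =
      Function.update (block h i x) a v := by
  funext b
  simp [block, Function.update_apply]

theorem block_update_inr_of_ne (x : Fin N → I) {i j : Fin k} (hij : j ≠ i) (a : Fin (n i)) (v : I) :
    block h j (Function.update x (cubeEquiv n₀ n N h (Sum.inr ⟨i, a⟩)) v) = block h j x := by
  funext b
  simp [block, hij]

theorem headBlock_eq_self {n : Fin k → ℕ} {h : N + ∑ i, n i = N} (x : Fin N → I) :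
    headBlock h x = x :=
  funext fun a => congrArg x (Fin.ext (cubeEquiv_inl_val a))

/-- The block with index `0` has offset zero, as neither a head block nor another block precedes it.
It is applied to products with a single factor. -/
theorem block_eq_self {h : 0 + ∑ _i : Fin k, N = N} {i : Fin k} (hi : (i : ℕ) = 0)
    (x : Fin N → I) : block h i x = x := by
  refine funext fun a => congrArg x (Fin.ext ?_)
  have : IsEmpty (Fin i) := by rw [hi]; infer_instance
  rw [cubeEquiv_inr_val, finSigmaFinEquiv_apply]
  simp

theorem headBlock_comp_blockCubePerm {θ : Equiv.Perm (Fin k)} {h' : n₀ + ∑ i, n (θ i) = N}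
    (x : Fin N → I) :
    headBlock h' (fun c => x (blockCubePerm θ h h' c)) = headBlock h x :=
  funext fun a => congrArg x (blockCubePerm_inl a)

theorem block_comp_blockCubePerm {θ : Equiv.Perm (Fin k)} {h' : n₀ + ∑ i, n (θ i) = N}
    (x : Fin N → I) (i : Fin k) :
    block h' i (fun c => x (blockCubePerm θ h h' c)) = block h (θ i) x :=
  funext fun a => congrArg x (blockCubePerm_inr i a)

variable {j : Fin k → ℕ} {l : ℕ} (hl : ∑ i, j i = l) {a₀ : ℕ} {a : Fin k → ℕ} {A : ℕ}
  (hA : a₀ + ∑ i, a i = A) {c : ∀ i, Fin (j i) → ℕ} {C : Fin k → ℕ}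
  (hC : ∀ i, a i + ∑ b, c i b = C i) {D : ℕ} (hD : a₀ + ∑ i, C i = D)
  (hD' : A + ∑ e : Fin l, c ((lexEquiv j l hl).symm e).1 ((lexEquiv j l hl).symm e).2 = D)

/-- With the next two lemmas, this says that the shuffle matches the decomposition of the cube for a
composed operation with that for the nested product. -/
theorem headBlock_comp_shufflePerm (x : Fin D → I) :
    headBlock hD (fun c => x (shufflePerm hl hA hC hD hD' c)) =
      headBlock hA (headBlock hD' x) :=
  funext fun b => congrArg x (shufflePerm_head hl hA hC hD hD' b)

theorem headBlock_block_comp_shufflePerm (x : Fin D → I) (i : Fin k) :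
    headBlock (hC i) (block hD i (fun c => x (shufflePerm hl hA hC hD hD' c))) =
      block hA i (headBlock hD' x) :=
  funext fun b => congrArg x (shufflePerm_inl hl hA hC hD hD' i b)

theorem block_block_comp_shufflePerm (x : Fin D → I) (e : Fin l) :
    block (hC _) ((lexEquiv j l hl).symm e).2
      (block hD ((lexEquiv j l hl).symm e).1 (fun c => x (shufflePerm hl hA hC hD hD' c))) =
      block hD' e x :=
  funext fun b => congrArg x (shufflePerm_inr hl hA hC hD hD' e b)

end Blocks

/-! ### Products of maps on cubes -/

section Smash

variable {X : Type u} [TopologicalSpace X] {x₀ : X} {k : ℕ} {Y : Fin k → Type u}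
  [∀ j, TopologicalSpace (Y j)] {y₀ : ∀ j, Y j} {Z : Type u} [TopologicalSpace Z] {z₀ : Z}

/-- The compactly generated topology is coinduced from maps out of compact Hausdorff spaces, so `μ`
is continuous along any continuous map from such a `K`. `ULift` adjusts the universe. -/
theorem SmashMap.continuous_comp (μ : SmashMap X x₀ Y y₀ Z z₀) {K : Type} [TopologicalSpace K]
    [CompactSpace K] [T2Space K] {φ : K → X} {ψ : K → ∀ j, Y j} (hφ : Continuous φ)
    (hψ : Continuous ψ) : Continuous fun z => μ (φ z) (ψ z) := by
  have h := μ.continuous_toFun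
  rw [continuous_coinduced_dom] at h
  let S : CompHaus.{u} := CompHaus.of (ULift.{u} K)
  let g : C(S, X × (∀ j, Y j)) :=
    ⟨fun z => (φ z.down, ψ z.down), (hφ.comp continuous_uliftDown).prodMk
      (hψ.comp continuous_uliftDown)⟩
  have h' := h.comp (continuous_sigmaMk
    (i := (⟨S, g⟩ : (S : CompHaus.{u}) × C(S, X × (∀ j, Y j)))))
  exact h'.comp continuous_uliftUp

variable {n₀ : ℕ} {n : Fin k → ℕ} {N : ℕ}

/-- The product `D^n₀ ∧ D^(n 0) ∧ ⋯ ⟶ X ∧ Y 0 ∧ ⋯ ⟶ Z` of maps that are trivial on the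
boundaries. -/
def smashLoop (μ : SmashMap X x₀ Y y₀ Z z₀) (h : n₀ + ∑ i, n i = N)
    (ρ : GenLoop (Fin n₀) X x₀) (η : ∀ i, GenLoop (Fin (n i)) (Y i) (y₀ i)) :
    GenLoop (Fin N) Z z₀ :=
  ⟨⟨fun x => μ (ρ (headBlock h x)) (fun i => η i (block h i x)),
    μ.continuous_comp (ρ.1.continuous.comp continuous_headBlock)
      (continuous_pi fun i => (η i).1.continuous.comp (continuous_block i))⟩, fun x hx => by
    change μ (ρ (headBlock h x)) (fun i => η i (block h i x)) = z₀
    rcases (mem_boundary_iff_blocks (h := h)).1 hx with hx | ⟨i, hx⟩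
    · rw [GenLoop.boundary ρ _ hx]
      exact μ.base_left _
    · exact μ.base_right _ _ ⟨i, (η i).2 _ hx⟩⟩

theorem smashLoop_apply (μ : SmashMap X x₀ Y y₀ Z z₀) (h : n₀ + ∑ i, n i = N)
    (ρ : GenLoop (Fin n₀) X x₀) (η : ∀ i, GenLoop (Fin (n i)) (Y i) (y₀ i)) (x : Fin N → I) :
    smashLoop μ h ρ η x = μ (ρ (headBlock h x)) (fun i => η i (block h i x)) :=
  rfl

theorem smashLoop_homotopic (μ : SmashMap X x₀ Y y₀ Z z₀) (h : n₀ + ∑ i, n i = N)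
    {ρ ρ' : GenLoop (Fin n₀) X x₀} {η η' : ∀ i, GenLoop (Fin (n i)) (Y i) (y₀ i)}
    (hρ : GenLoop.Homotopic ρ ρ') (hη : ∀ i, GenLoop.Homotopic (η i) (η' i)) :
    GenLoop.Homotopic (smashLoop μ h ρ η) (smashLoop μ h ρ' η') := by
  obtain ⟨H⟩ := hρ
  have K := fun i => (hη i).some
  refine ⟨⟨⟨⟨fun z => μ (H (z.1, headBlock h z.2)) (fun i => K i (z.1, block h i z.2)),
    μ.continuous_comp (H.continuous.comp (continuous_fst.prodMk
      (continuous_headBlock.comp continuous_snd)))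
      (continuous_pi fun i => (K i).continuous.comp (continuous_fst.prodMk
        ((continuous_block i).comp continuous_snd)))⟩, fun x => ?_, fun x => ?_⟩,
        fun t x hx => ?_⟩⟩
  · simp [smashLoop_apply]
  · simp [smashLoop_apply]
  · refine Eq.trans ?_ ((smashLoop μ h ρ η).2 x hx).symm
    change μ (H (t, headBlock h x)) (fun i => K i (t, block h i x)) = z₀
    rcases (mem_boundary_iff_blocks (h := h)).1 hx with hx | ⟨i, hx⟩
    · rw [H.eq_fst t hx]
      exact (congrArg (μ.toFun · _) (ρ.2 _ hx)).trans (μ.base_left _)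
    · exact μ.base_right _ _ ⟨i, ((K i).eq_fst t hx).trans ((η i).2 _ hx)⟩

theorem smashLoop_const_left (μ : SmashMap X x₀ Y y₀ Z z₀) (h : n₀ + ∑ i, n i = N)
    (η : ∀ i, GenLoop (Fin (n i)) (Y i) (y₀ i)) :
    smashLoop μ h GenLoop.const η = GenLoop.const :=
  GenLoop.ext _ _ fun _ => μ.base_left _

theorem smashLoop_const_right (μ : SmashMap X x₀ Y y₀ Z z₀) (h : n₀ + ∑ i, n i = N)
    (ρ : GenLoop (Fin n₀) X x₀) {η : ∀ i, GenLoop (Fin (n i)) (Y i) (y₀ i)}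
    (hη : ∃ i, η i = GenLoop.const) : smashLoop μ h ρ η = GenLoop.const := by
  obtain ⟨i, hi⟩ := hη
  exact GenLoop.ext _ _ fun x => μ.base_right _ _ ⟨i, by rw [hi]; rfl⟩

theorem transAt_apply {m : ℕ} (i : Fin m) (ρ η : GenLoop (Fin m) X x₀) (x : Fin m → I) :
    GenLoop.transAt i ρ η x = if (x i : ℝ) ≤ 1 / 2 then
        ρ (Function.update x i (Set.projIcc 0 1 zero_le_one (2 * (x i : ℝ))))
      else η (Function.update x i (Set.projIcc 0 1 zero_le_one (2 * (x i : ℝ) - 1))) :=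
  rfl

/-- Concatenation only changes the coordinate `a`, which is one coordinate of the large cube and is
not seen by the other factors. Additivity follows because the group operation may be computed along
any coordinate. -/
theorem smashLoop_transAt_left (μ : SmashMap X x₀ Y y₀ Z z₀) (h : n₀ + ∑ i, n i = N) (a : Fin n₀)
    (ρ ρ' : GenLoop (Fin n₀) X x₀) (η : ∀ i, GenLoop (Fin (n i)) (Y i) (y₀ i)) :
    smashLoop μ h (GenLoop.transAt a ρ ρ') η =
      GenLoop.transAt (cubeEquiv n₀ n N h (Sum.inl a)) (smashLoop μ h ρ η)
        (smashLoop μ h ρ' η) := by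
  refine GenLoop.ext _ _ fun x => ?_
  have e : headBlock h x a = x (cubeEquiv n₀ n N h (Sum.inl a)) := rfl
  rw [transAt_apply, smashLoop_apply, smashLoop_apply, smashLoop_apply, transAt_apply, e]
  simp only [headBlock_update_inl, block_update_inl]
  split_ifs <;> rfl

theorem smashLoop_transAt_right (μ : SmashMap X x₀ Y y₀ Z z₀) (h : n₀ + ∑ i, n i = N)
    (i : Fin k) (a : Fin (n i)) (ρ : GenLoop (Fin n₀) X x₀)
    (η : ∀ i, GenLoop (Fin (n i)) (Y i) (y₀ i)) (ζ ζ' : GenLoop (Fin (n i)) (Y i) (y₀ i)) :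
    smashLoop μ h ρ (Function.update η i (GenLoop.transAt a ζ ζ')) =
      GenLoop.transAt (cubeEquiv n₀ n N h (Sum.inr ⟨i, a⟩))
        (smashLoop μ h ρ (Function.update η i ζ)) (smashLoop μ h ρ (Function.update η i ζ')) := by
  refine GenLoop.ext _ _ fun x => ?_
  have e : block h i x a = x (cubeEquiv n₀ n N h (Sum.inr ⟨i, a⟩)) := rfl
  rw [transAt_apply, smashLoop_apply, smashLoop_apply, smashLoop_apply]
  simp only [headBlock_update_inr]
  rw [← apply_ite (μ.toFun (ρ (headBlock h x)))]
  congr 1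
  funext c
  by_cases hc : c = i
  · subst hc
    rw [Function.update_self, transAt_apply, e]
    split_ifs <;> simp only [Function.update_self, block_update_inr]
  · rw [Function.update_of_ne hc]
    split_ifs <;> simp only [Function.update_of_ne hc, block_update_inr_of_ne _ hc]

/-- The composite of a map on a cube with a pointed map. -/
def mapLoop {x₁ : X} {m : ℕ} (f : C(X, Z)) (hf : f x₁ = z₀) (ρ : GenLoop (Fin m) X x₁) :
    GenLoop (Fin m) Z z₀ :=
  ⟨f.comp ρ.1, fun x hx => (congrArg f (ρ.2 x hx)).trans hf⟩

theorem mapLoop_apply {m : ℕ} (f : C(X, Z)) (hf : f x₀ = z₀) (ρ : GenLoop (Fin m) X x₀)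
    (x : Fin m → I) : mapLoop f hf ρ x = f (ρ x) :=
  rfl

theorem mapLoop_homotopic {m : ℕ} (f : C(X, Z)) (hf : f x₀ = z₀) {ρ η : GenLoop (Fin m) X x₀}
    (h : GenLoop.Homotopic ρ η) : GenLoop.Homotopic (mapLoop f hf ρ) (mapLoop f hf η) :=
  h.map fun H => H.compContinuousMap f

theorem mapLoop_transAt {m : ℕ} (f : C(X, Z)) (hf : f x₀ = z₀) (i : Fin m)
    (ρ η : GenLoop (Fin m) X x₀) : mapLoop f hf (GenLoop.transAt i ρ η) =
      GenLoop.transAt i (mapLoop f hf ρ) (mapLoop f hf η) := by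
  refine GenLoop.ext _ _ fun x => ?_
  rw [mapLoop_apply, transAt_apply, transAt_apply, apply_ite f]
  rfl

end Smash

/-! ### The operad of homotopy groups -/

section Classes

variable {X : Type u} [TopologicalSpace X] {x₀ : X} {n : ℕ}

theorem loopCls_eq_iff {ρ η : GenLoop (Fin n) X x₀} :
    loopCls ρ = loopCls η ↔ GenLoop.Homotopic ρ η :=
  Quotient.eq (r := GenLoop.Homotopic.setoid (Fin n) x₀)

theorem exists_loopCls (x : (homotopyGroups X x₀).carrier n) : ∃ ρ, loopCls ρ = x :=
  Quotient.exists_rep (s := GenLoop.Homotopic.setoid (Fin n) x₀) x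

/-- A representative of an element of a homotopy group. -/
def loopRep (x : (homotopyGroups X x₀).carrier n) : GenLoop (Fin n) X x₀ :=
  (exists_loopCls x).choose

theorem loopCls_loopRep (x : (homotopyGroups X x₀).carrier n) : loopCls (loopRep x) = x :=
  (exists_loopCls x).choose_spec

theorem loopRep_loopCls (ρ : GenLoop (Fin n) X x₀) :
    GenLoop.Homotopic (loopRep (loopCls ρ)) ρ :=
  loopCls_eq_iff.1 (loopCls_loopRep _)

end Classes

section Operad

variable (P : PointedOperad.{u})

/-- The composition on homotopy groups. -/
def PointedOperad.piComp {k : ℕ+} (j : Fin k → ℕ+) (l : ℕ+) (hl : ∑ i, (j i : ℕ) = l)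
    {a₀ : ℕ} {a : Fin k → ℕ} (A : ℕ) (hA : a₀ + ∑ i, a i = A)
    (x : (P.pi k).carrier a₀) (y : ∀ i, (P.pi (j i)).carrier (a i)) : (P.pi l).carrier A :=
  loopCls (smashLoop (P.comp j l hl) hA (loopRep x) (fun i => loopRep (y i)))

theorem PointedOperad.piComp_cls {k : ℕ+} (j : Fin k → ℕ+) (l : ℕ+) (hl : ∑ i, (j i : ℕ) = l)
    {a₀ : ℕ} {a : Fin k → ℕ} (A : ℕ) (hA : a₀ + ∑ i, a i = A)
    (ρ : GenLoop (Fin a₀) (P.space k) (P.base k))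
    (η : ∀ i, GenLoop (Fin (a i)) (P.space (j i)) (P.base (j i))) :
    P.piComp j l hl A hA (loopCls ρ) (fun i => loopCls (η i)) =
      loopCls (smashLoop (P.comp j l hl) hA ρ η) :=
  loopCls_eq_iff.2 (smashLoop_homotopic _ _ (loopRep_loopCls ρ) fun i => loopRep_loopCls (η i))

/-- The action of the symmetric groups on homotopy groups. -/
def PointedOperad.piPerm (k : ℕ+) {n : ℕ} (θ : Equiv.Perm (Fin k)) (x : (P.pi k).carrier n) :
    (P.pi k).carrier n :=
  loopCls (mapLoop (P.perm k θ) (P.perm_base k θ) (loopRep x))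

theorem PointedOperad.piPerm_cls (k : ℕ+) {n : ℕ} (θ : Equiv.Perm (Fin k))
    (ρ : GenLoop (Fin n) (P.space k) (P.base k)) :
    P.piPerm k θ (loopCls ρ) = loopCls (mapLoop (P.perm k θ) (P.perm_base k θ) ρ) :=
  loopCls_eq_iff.2 (mapLoop_homotopic _ _ (loopRep_loopCls ρ))

theorem PointedOperad.exists_cls {k : ℕ+} {j : Fin k → ℕ+} {a : Fin k → ℕ}
    (y : ∀ i, (P.pi (j i)).carrier (a i)) :
    ∃ η : ∀ i, GenLoop (Fin (a i)) (P.space (j i)) (P.base (j i)),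
      (fun i => (loopCls (η i) : (P.pi (j i)).carrier (a i))) = y :=
  ⟨fun i => loopRep (y i), funext fun i => loopCls_loopRep (y i)⟩

theorem PointedOperad.update_cls {k : ℕ+} {j : Fin k → ℕ+} {a : Fin k → ℕ}
    (η : ∀ i, GenLoop (Fin (a i)) (P.space (j i)) (P.base (j i))) (i : Fin k)
    (ζ : GenLoop (Fin (a i)) (P.space (j i)) (P.base (j i))) :
    Function.update (β := fun i => (P.pi (j i)).carrier (a i)) (fun i => loopCls (η i)) i
      (loopCls ζ) = fun c => loopCls (Function.update η i ζ c) := by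
  funext c
  by_cases h : c = i
  · subst h
    exact (Function.update_self _ _ _).trans (congrArg loopCls (by rw [Function.update_self]))
  · exact (Function.update_of_ne h _ _).trans
      (congrArg loopCls (Function.update_of_ne h _ _).symm)

/-- The operad of homotopy groups. -/
def PointedOperad.piOperad : GradedOperad P.pi where
  isGroup k := homotopyGroups_isGroup _ _
  perm k _ θ := P.piPerm k θ
  perm_one k n x := by
    obtain ⟨ρ, rfl⟩ := exists_loopCls x
    rw [P.piPerm_cls]
    exact congrArg loopCls (GenLoop.ext _ _ fun x => P.perm_one k _)
  perm_mul k n θ τ x := by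
    obtain ⟨ρ, rfl⟩ := exists_loopCls x
    rw [P.piPerm_cls, P.piPerm_cls, P.piPerm_cls]
    exact congrArg loopCls (GenLoop.ext _ _ fun x => P.perm_mul k _ _ _)
  perm_zero k n θ := by
    refine (P.piPerm_cls k θ GenLoop.const).trans ?_
    exact congrArg loopCls (GenLoop.ext _ _ fun x => P.perm_base k θ)
  perm_add k n h θ x y := by
    obtain ⟨ρ, rfl⟩ := exists_loopCls x
    obtain ⟨η, rfl⟩ := exists_loopCls y
    rw [P.piPerm_cls, P.piPerm_cls]
    refine (congrArg (P.piPerm k θ) (homotopyGroups_add h ⟨0, h⟩ ρ η)).trans ?_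
    rw [P.piPerm_cls, mapLoop_transAt]
    exact (homotopyGroups_add h ⟨0, h⟩ _ _).symm
  one := loopCls ⟨ContinuousMap.const _ P.one, fun x hx => hx.choose.elim0⟩
  comp j l hl _ _ A hA := P.piComp j l hl A hA
  zero_comp {k} j l hl a₀ a A hA y := by
    obtain ⟨η, rfl⟩ := P.exists_cls y
    refine (P.piComp_cls j l hl A hA GenLoop.const η).trans ?_
    rw [smashLoop_const_left]
    rfl
  comp_zero {k} j l hl a₀ a A hA x y := by
    rintro ⟨i, hi⟩
    obtain ⟨ρ, rfl⟩ := exists_loopCls x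
    -- The chosen representative of a zero class need not be constant, so it is replaced by the
    -- constant map.
    have e : (fun c => loopCls (Function.update (fun i => loopRep (y i)) i GenLoop.const c)) = y := by
      rw [← P.update_cls, funext fun c => loopCls_loopRep (y c)]
      exact Function.update_eq_iff.2 ⟨hi.symm, fun _ _ => rfl⟩
    refine (congrArg (P.piComp j l hl A hA _) e.symm).trans ?_
    rw [P.piComp_cls, smashLoop_const_right _ _ _ ⟨i, Function.update_self _ _ _⟩]
    rfl
  add_comp {k} j l hl a₀ a A hA h₀ h x x' y := by
    obtain ⟨ρ, rfl⟩ := exists_loopCls x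
    obtain ⟨ρ', rfl⟩ := exists_loopCls x'
    obtain ⟨η, rfl⟩ := P.exists_cls y
    refine (congrArg (P.piComp j l hl A hA · _) (homotopyGroups_add h₀ ⟨0, h₀⟩ ρ ρ')).trans ?_
    rw [P.piComp_cls, P.piComp_cls, P.piComp_cls, smashLoop_transAt_left]
    exact (homotopyGroups_add h _ _ _).symm
  comp_add {k} j l hl a₀ a A hA i hi h x y z z' := by
    obtain ⟨ρ, rfl⟩ := exists_loopCls x
    obtain ⟨η, rfl⟩ := P.exists_cls y
    obtain ⟨ζ, rfl⟩ := exists_loopCls z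
    obtain ⟨ζ', rfl⟩ := exists_loopCls z'
    refine (congrArg (fun z => P.piComp j l hl A hA _ (Function.update _ i z))
      (homotopyGroups_add hi ⟨0, hi⟩ ζ ζ')).trans ?_
    simp only [P.update_cls]
    rw [P.piComp_cls, P.piComp_cls, P.piComp_cls, smashLoop_transAt_right]
    exact (homotopyGroups_add h _ _ _).symm
  one_comp l h A hA x := by
    obtain ⟨ρ, rfl⟩ := exists_loopCls x
    rw [P.piComp_cls]
    refine congrArg loopCls (GenLoop.ext _ _ fun x => ?_)
    rw [smashLoop_apply]
    have : ∀ i : Fin (1 : ℕ+), block hA i x = x := fun i =>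
      block_eq_self (Nat.lt_one_iff.1 i.2) x
    simp only [this]
    exact P.one_comp l h _
  comp_one k h A hA x := by
    obtain ⟨ρ, rfl⟩ := exists_loopCls x
    refine (P.piComp_cls _ _ _ _ hA ρ _).trans ?_
    refine congrArg loopCls (GenLoop.ext _ _ fun x => ?_)
    rw [smashLoop_apply, headBlock_eq_self]
    exact P.comp_one k h _
  assoc {k} j l hl r R hR L hL hL' a₀ a A hA c C hC D hD hD' x y z := by
    obtain ⟨ρ, rfl⟩ := exists_loopCls x
    obtain ⟨η, rfl⟩ := P.exists_cls y
    obtain ⟨ζ, rfl⟩ : ∃ ζ : ∀ i b, GenLoop (Fin (c i b)) (P.space (r i b)) (P.base (r i b)),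
        (fun i b => (loopCls (ζ i b) : (P.pi (r i b)).carrier (c i b))) = z :=
      ⟨fun i b => loopRep (z i b), funext fun i => funext fun b => loopCls_loopRep (z i b)⟩
    simp only [P.piComp_cls]
    -- The two sides are represented by maps that differ exactly by the shuffle of the coordinates.
    rw [← sign_shufflePerm hl hA hC hD hD']
    refine Eq.trans ?_ (homotopyGroups_permute _ _)
    refine congrArg loopCls (GenLoop.ext _ _ fun x => ?_)
    change smashLoop _ _ _ _ x =
      smashLoop _ _ _ _ (fun c => x (shufflePerm hl hA hC hD hD' c))
    simp only [smashLoop_apply, headBlock_comp_shufflePerm, headBlock_block_comp_shufflePerm]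
    rw [← P.assoc j l hl r R hR L hL hL']
    simp only [block_block_comp_shufflePerm]
  perm_comp {k} j l hl θ hl' a₀ a A hA hA' x y := by
    obtain ⟨ρ, rfl⟩ := exists_loopCls x
    obtain ⟨η, rfl⟩ := P.exists_cls y
    rw [P.piPerm_cls, P.piComp_cls, P.piComp_cls, P.piPerm_cls, ← sign_blockCubePerm (h := hA)
      (h' := hA')]
    refine Eq.trans ?_ (homotopyGroups_permute _ _)
    refine congrArg loopCls (GenLoop.ext _ _ fun x => ?_)
    change smashLoop _ _ _ _ x =
      P.perm l _ (smashLoop _ _ _ _ (fun c => x (blockCubePerm θ hA hA' c)))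
    simp only [smashLoop_apply, mapLoop_apply, headBlock_comp_blockCubePerm,
      block_comp_blockCubePerm]
    exact P.perm_comp j l hl θ hl' _ _
  comp_perm {k} j l hl τ a₀ a A hA x y := by
    obtain ⟨ρ, rfl⟩ := exists_loopCls x
    obtain ⟨η, rfl⟩ := P.exists_cls y
    simp only [P.piPerm_cls, P.piComp_cls]
    exact congrArg loopCls (GenLoop.ext _ _ fun x => P.comp_perm _ _ _ _ _ _)

end Operad

/-! ### Points of a tower -/

section Tower

variable {P : PointedOperad.{u}} {W : Tower.{u}} {s : ℕ}

theorem Tower.qpow_base (W : Tower.{u}) (m t : ℕ) : W.qpow m t (W.base (m + t)) = W.base m := by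
  induction t with
  | zero => rfl
  | succ t ih => exact (congrArg (W.qpow m t) (W.q_base (m + t))).trans ih

/-- A point of one of the spaces of the tower. -/
abbrev Tower.Point (W : Tower.{u}) : Type u :=
  Σ m, W.space m

/-- Equations between points whose filtrations agree only propositionally are proved in the total
space, without transports, and brought back by this. -/
theorem Tower.point_inj {m : ℕ} {x y : W.space m} (h : (⟨m, x⟩ : W.Point) = ⟨m, y⟩) : x = y :=
  sigma_mk_injective h

/-- The action on points of arbitrary filtrations `≥ s`. -/
def TowerAction.actPoint (Φ : TowerAction P W s) {k : ℕ+} (p : P.space k) (w : Fin k → W.Point) :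
    W.Point :=
  if h : ∀ i, s ≤ (w i).1 then ⟨∑ i, (w i).1, Φ.act _ _ rfl h p (fun i => (w i).2)⟩
  -- A default value; the laws below are only stated for filtrations at least `s`.
  else ⟨0, W.base 0⟩

variable (Φ : TowerAction P W s)

theorem TowerAction.mk_act {k : ℕ+} (m : Fin k → ℕ) (M : ℕ) (hM : ∑ i, m i = M)
    (hm : ∀ i, s ≤ m i) (p : P.space k) (w : ∀ i, W.space (m i)) :
    (⟨M, Φ.act m M hM hm p w⟩ : W.Point) = Φ.actPoint p (fun i => ⟨m i, w i⟩) := by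
  subst hM
  rw [actPoint, dif_pos hm]

theorem TowerAction.actPoint_perm {k : ℕ+} (θ : Equiv.Perm (Fin k)) (p : P.space k)
    (w : Fin k → W.Point) (hw : ∀ i, s ≤ (w i).1) :
    Φ.actPoint (P.perm k θ p) w = Φ.actPoint p (fun i => w (θ i)) := by
  have h : ∑ i, (w (θ i)).1 = ∑ i, (w i).1 := Equiv.sum_comp θ fun i => (w i).1
  refine (Φ.mk_act (fun i => (w i).1) _ rfl hw _ (fun i => (w i).2)).symm.trans ?_
  rw [Φ.equivariance _ _ _ _ θ h (fun i => hw (θ i)), Φ.mk_act]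

theorem TowerAction.actPoint_comp {k : ℕ+} (j : Fin k → ℕ+) (l : ℕ+) (hl : ∑ i, (j i : ℕ) = l)
    (p : P.space k) (q : ∀ i, P.space (j i)) (w : (Σ i, Fin (j i)) → W.Point)
    (hw : ∀ e, s ≤ (w e).1) :
    Φ.actPoint (P.comp j l hl p q) (fun e => w ((lexEquiv (fun i => (j i : ℕ)) l hl).symm e)) =
      Φ.actPoint p (fun i => Φ.actPoint (q i) (fun b => w ⟨i, b⟩)) := by
  -- The operad starts in arity `1`, so each inner sum has at least one part, and this part is
  -- already at least `s`.
  have hM : ∀ i, s ≤ ∑ b, (w ⟨i, b⟩).1 := fun i =>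
    (hw ⟨i, ⟨0, (j i).pos⟩⟩).trans (Finset.single_le_sum (f := fun b => (w ⟨i, b⟩).1)
      (fun _ _ => Nat.zero_le _) (Finset.mem_univ _))
  have hT : ∑ c : Fin l, (w ((lexEquiv (fun i => (j i : ℕ)) l hl).symm c)).1 =
      ∑ i, ∑ b, (w ⟨i, b⟩).1 := by
    rw [Equiv.sum_comp (lexEquiv (fun i => (j i : ℕ)) l hl).symm (fun e => (w e).1),
      Fintype.sum_sigma]
  refine (Φ.mk_act _ _ hT (fun _ => hw _) _ (fun e =>
    (w ((lexEquiv (fun i => (j i : ℕ)) l hl).symm e)).2)).symm.trans ?_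
  have := Φ.assoc j l hl (fun i b => (w ⟨i, b⟩).1) (fun _ _ => hw _) _ (fun _ => rfl) hM _ rfl hT
    p q (fun i b => (w ⟨i, b⟩).2)
  refine (congrArg (Sigma.mk _) this).trans ?_
  rw [Φ.mk_act]
  congr 1
  funext i
  exact Φ.mk_act _ _ _ _ _ _

theorem Tower.choosePoint_base {m t : ℕ} {b : Bool} {hi : b = true → W.space (m + t)}
    {lo : W.space m} (h : ∀ hb, hi hb = W.base (m + t)) (h' : b = false → lo = W.base m) :
    W.choosePoint m t b hi lo = W.base _ := by
  cases b
  · exact h' rfl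
  · exact h rfl

theorem Tower.qpow_choosePoint {m t : ℕ} {b : Bool} {hi : b = true → W.space (m + t)}
    {lo : W.space m} (h : ∀ hb, W.qpow m t (hi hb) = lo) :
    W.qpow m (bif b then t else 0) (W.choosePoint m t b hi lo) = lo := by
  cases b
  · rfl
  · exact h rfl

theorem Tower.continuous_choosePoint {Z : Type*} [TopologicalSpace Z] {m t : ℕ} {b : Bool}
    {hi : b = true → Z → W.space (m + t)} {lo : Z → W.space m} (h : ∀ hb, Continuous (hi hb))
    (h' : Continuous lo) :
    Continuous fun z => W.choosePoint m t b (fun hb => hi hb z) (lo z) := by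
  cases b
  · exact h'
  · exact h rfl

theorem Tower.mk_choosePoint {m t : ℕ} {b : Bool} {hi : b = true → W.space (m + t)}
    {lo : W.space m} :
    (⟨_, W.choosePoint m t b hi lo⟩ : W.Point) =
      if hb : b = true then ⟨m + t, hi hb⟩ else ⟨m, lo⟩ := by
  cases b <;> rfl

/-- A point of `W m` and lifts of it to `W (m+t)` if `b` or `b'` is true. -/
def Tower.choosePoint₂ (W : Tower.{u}) (m t : ℕ) : ∀ b b' : Bool,
    (b = true → W.space (m + t)) → (b' = true → W.space (m + t)) → W.space m →
      W.space ((m + bif b then t else 0) + bif b' then t else 0)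
  -- A default value: the two lifts belong to different faces, so this case does not occur.
  | true, true, _, _, _ => W.base _
  | true, false, hi, _, _ => hi rfl
  | false, true, _, hi', _ => hi' rfl
  | false, false, _, _, lo => lo

theorem Tower.qpow_choosePoint₂ {m t : ℕ} {b b' : Bool} {hi : b = true → W.space (m + t)}
    {hi' : b' = true → W.space (m + t)} {lo : W.space m} (hb : b = true → b' = false)
    (h : ∀ hb, W.qpow m t (hi' hb) = lo) :
    W.qpow _ (bif b' then t else 0) (W.choosePoint₂ m t b b' hi hi' lo) =
      W.choosePoint m t b hi lo := by
  cases b <;> cases b'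
  · rfl
  · exact h rfl
  · rfl
  · exact absurd (hb rfl) (by decide)

theorem Tower.mk_choosePoint₂_swap {m t : ℕ} {b b' : Bool} {hi : b = true → W.space (m + t)}
    {hi' : b' = true → W.space (m + t)} {lo : W.space m} (hb : b = true → b' = false) :
    (⟨_, W.choosePoint₂ m t b b' hi hi' lo⟩ : W.Point) =
      ⟨_, W.choosePoint₂ m t b' b hi' hi lo⟩ := by
  cases b <;> cases b'
  · rfl
  · rfl
  · rfl
  · exact absurd (hb rfl) (by decide)

end Tower

theorem isClosed_boundary (n : ℕ) : IsClosed (Cube.boundary (Fin n)) := by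
  have : Cube.boundary (Fin n) = ⋃ i : Fin n, {y : Fin n → I | y i = 0 ∨ y i = 1} := by
    ext y
    simp [Cube.boundary]
  rw [this]
  exact isClosed_iUnion_of_finite fun i =>
    (isClosed_eq (continuous_apply i) continuous_const).union
      (isClosed_eq (continuous_apply i) continuous_const)

/-! ### Products of relative spheres -/

section Face

variable {P : PointedOperad.{u}} {W : Tower.{u}} {s : ℕ} (Φ : TowerAction P W s) {t : ℕ} {k : ℕ+}
  {m : Fin k → ℕ} {M : ℕ} (hM : ∑ i, m i = M) (hm : ∀ i, s ≤ m i) {n : Fin k → ℕ}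

/-- The value of a product of squares at a point of the face of the `i`-th disk. -/
def TowerAction.face (p : P.space k) (α : ∀ i, W.Square t (m i) (n i)) (y : ∀ i, Fin (n i) → I)
    (i : Fin k) (hi : y i ∈ Cube.boundary (Fin (n i))) : W.space (M + t) :=
  Φ.act (raise m t i) (M + t) (sum_raise m t i hM) (le_raise t i hm) p
    (fun l => W.choosePoint (m l) t (decide (l = i))
      (fun hl => (α l).bdry ⟨y l, (of_decide_eq_true hl).symm ▸ hi⟩) ((α l).disk (y l)))

variable {p : P.space k} {α : ∀ i, W.Square t (m i) (n i)} {y : ∀ i, Fin (n i) → I}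
  {i : Fin k} {hi : y i ∈ Cube.boundary (Fin (n i))}

theorem TowerAction.face_of_left (hp : p = P.base k) :
    Φ.face hM hm p α y i hi = W.base (M + t) := by
  subst hp
  exact (Φ.act _ _ _ _).base_left _

theorem TowerAction.face_of_bdry (h : (α i).bdry ⟨y i, hi⟩ = W.base (m i + t)) :
    Φ.face hM hm p α y i hi = W.base (M + t) := by
  refine (Φ.act _ _ _ _).base_right _ _ ⟨i, ?_⟩
  exact Tower.choosePoint_base (fun _ => h) fun hf =>
    absurd rfl (of_decide_eq_false hf)

theorem TowerAction.face_of_zero {l : Fin k} (h : ∃ a, y l a = 0) :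
    Φ.face hM hm p α y i hi = W.base (M + t) := by
  refine (Φ.act _ _ _ _).base_right _ _ ⟨l, ?_⟩
  exact Tower.choosePoint_base (fun _ => (α l).base _ h) fun _ =>
    ((α l).disk_base _ h).trans (W.qpow_base _ _)

theorem TowerAction.qpow_face : W.qpow M t (Φ.face hM hm p α y i hi) =
    Φ.act m M hM hm p (fun l => (α l).disk (y l)) := by
  refine (Φ.act_q m _ M t hM hm _ _ p _).trans ?_
  congr 1
  funext l
  exact Tower.qpow_choosePoint fun hb => (α l).comm _

/-- On the intersection of two faces both the `i`-th and the `i'`-th factor lift to filtration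
raised by `t`. Acting on these lifts and applying `q^t` gives the value on either face, by strict
compatibility with the tower. -/
theorem TowerAction.face_eq_face {i' : Fin k} {hi' : y i' ∈ Cube.boundary (Fin (n i'))} :
    Φ.face hM hm p α y i hi = Φ.face hM hm p α y i' hi' := by
  by_cases hii : i = i'
  · subst hii
    rfl
  have key : ∀ (i i' : Fin k) (hi : y i ∈ Cube.boundary (Fin (n i)))
      (hi' : y i' ∈ Cube.boundary (Fin (n i'))), i ≠ i' → Φ.face hM hm p α y i hi =
        W.qpow (M + t) t (Φ.act (fun l => raise m t i l + bif decide (l = i') then t else 0)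
          (M + t + t) (sum_raise _ t i' (sum_raise m t i hM))
          (le_raise t i' (le_raise t i hm)) p
          (fun l => W.choosePoint₂ (m l) t (decide (l = i)) (decide (l = i'))
            (fun hl => (α l).bdry ⟨y l, (of_decide_eq_true hl).symm ▸ hi⟩)
            (fun hl => (α l).bdry ⟨y l, (of_decide_eq_true hl).symm ▸ hi'⟩)
            ((α l).disk (y l)))) := by
    intro i i' hi hi' hne
    refine Eq.trans ?_ (Φ.act_q (raise m t i) _ (M + t) t (sum_raise m t i hM) (le_raise t i hm) _ _
      p _).symm
    unfold face
    congr 1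
    funext l
    refine (Tower.qpow_choosePoint₂ (b := decide (l = i)) (b' := decide (l = i'))
      (fun h => ?_) fun hb => ?_).symm
    · have h := of_decide_eq_true h
      exact decide_eq_false fun h' => hne (h.symm.trans h')
    · exact (α l).comm _
  rw [key i i' hi hi' hii, key i' i hi' hi (Ne.symm hii)]
  -- The two filtrations are raised by `t` in opposite orders, so they are equal but not
  -- syntactically; hence the comparison in the total space.
  refine congrArg (W.qpow (M + t) t) (Tower.point_inj ?_)
  refine (Φ.mk_act _ _ _ _ _ _).trans (Eq.trans ?_ (Φ.mk_act _ _ _ _ _ _).symm)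
  refine congrArg (Φ.actPoint p) (funext fun l => Tower.mk_choosePoint₂_swap fun h => ?_)
  have h := of_decide_eq_true h
  exact decide_eq_false fun h' => hii (h.symm.trans h')

/-- Updating a family of points with varying filtration replaces the case distinctions of
`choosePoint`; in this form equivariance and associativity apply directly. -/
theorem TowerAction.mk_face : (⟨M + t, Φ.face hM hm p α y i hi⟩ : W.Point) =
    Φ.actPoint p (Function.update (fun l => ⟨m l, (α l).disk (y l)⟩) i
      ⟨m i + t, (α i).bdry ⟨y i, hi⟩⟩) := by
  refine (Φ.mk_act _ _ _ _ _ _).trans (congrArg (Φ.actPoint p) (funext fun l => ?_))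
  refine Tower.mk_choosePoint.trans ?_
  by_cases h : l = i
  · subst h
    rw [Function.update_self, dif_pos (decide_eq_true rfl)]
  · rw [Function.update_of_ne h, dif_neg (by simpa using h)]

theorem TowerAction.face_congr {p' : P.space k} {α' : ∀ i, W.Square t (m i) (n i)}
    {y' : ∀ i, Fin (n i) → I} {hi' : y' i ∈ Cube.boundary (Fin (n i))} (hp : p = p')
    (hd : ∀ l, (α l).disk (y l) = (α' l).disk (y' l))
    (hb : (α i).bdry ⟨y i, hi⟩ = (α' i).bdry ⟨y' i, hi'⟩) :
    Φ.face hM hm p α y i hi = Φ.face hM hm p' α' y' i hi' := by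
  refine Tower.point_inj ?_
  rw [Φ.mk_face, Φ.mk_face, hp, hb]
  simp only [hd]

end Face

/-! ### Existence and homotopy invariance of products of squares -/

section Product

variable {P : PointedOperad.{u}} {W : Tower.{u}} {s : ℕ} (Φ : TowerAction P W s) {t : ℕ} {k : ℕ+}
  {m : Fin k → ℕ} {M : ℕ} (hM : ∑ i, m i = M) (hm : ∀ i, s ≤ m i) {n₀ : ℕ} {n : Fin k → ℕ}
  {N : ℕ} (hN : n₀ + ∑ i, n i = N)

open Classical in
/-- The boundary map of a product of squares. -/
def TowerAction.productBdry (ρ : GenLoop (Fin n₀) (P.space k) (P.base k))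
    (α : ∀ i, W.Square t (m i) (n i)) (x : Fin N → I) : W.space (M + t) :=
  if h : ∃ i, block hN i x ∈ Cube.boundary (Fin (n i)) then
    Φ.face hM hm (ρ (headBlock hN x)) α (fun i => block hN i x) h.choose h.choose_spec
  else W.base (M + t)

section

variable {ρ : GenLoop (Fin n₀) (P.space k) (P.base k)} {α : ∀ i, W.Square t (m i) (n i)}
  {x : Fin N → I}

/-- By `face_eq_face` the choice of a face in the definition has no influence. -/
theorem TowerAction.productBdry_eq_face {i : Fin k}
    (hi : block hN i x ∈ Cube.boundary (Fin (n i))) : Φ.productBdry hM hm hN ρ α x =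
      Φ.face hM hm (ρ (headBlock hN x)) α (fun i => block hN i x) i hi := by
  rw [productBdry, dif_pos ⟨i, hi⟩]
  exact Φ.face_eq_face hM hm

theorem TowerAction.productBdry_of_left (h : ρ (headBlock hN x) = P.base k) :
    Φ.productBdry hM hm hN ρ α x = W.base (M + t) := by
  unfold productBdry
  split_ifs with hx
  · exact Φ.face_of_left hM hm h
  · rfl

theorem TowerAction.productBdry_of_head (h : headBlock hN x ∈ Cube.boundary (Fin n₀)) :
    Φ.productBdry hM hm hN ρ α x = W.base (M + t) :=
  Φ.productBdry_of_left hM hm hN (ρ.2 _ h)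

end

/-- The faces, including that of the head disk, are a finite closed cover on each member of which
the map is either constant or a structure map applied to continuous data. Compactness of `T` and of
the faces lets `SmashMap.continuous_comp` apply; `T` is a point for a single product and `I` for a
homotopy. -/
theorem TowerAction.continuous_productBdry {T : Type} [TopologicalSpace T] [CompactSpace T]
    [T2Space T] {R : T → GenLoop (Fin n₀) (P.space k) (P.base k)}
    {α : T → ∀ i, W.Square t (m i) (n i)}
    (hR : Continuous fun z : T × (Fin n₀ → I) => R z.1 z.2)
    (hα : ∀ i, RelSphere.IsFamily fun τ => α τ i) :
    Continuous fun z : T × Cube.boundary (Fin N) =>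
      Φ.productBdry hM hm hN (R z.1) (α z.1) z.2.1 := by
  have : CompactSpace (Cube.boundary (Fin N)) :=
    isCompact_iff_compactSpace.1 (isClosed_boundary N).isCompact
  have cv : Continuous fun z : T × Cube.boundary (Fin N) => z.2.1 :=
    continuous_subtype_val.comp continuous_snd
  let S : Option (Fin k) → Set (T × Cube.boundary (Fin N)) := fun o => o.elim
    {z | headBlock hN z.2.1 ∈ Cube.boundary (Fin n₀)}
    (fun i => {z | block hN i z.2.1 ∈ Cube.boundary (Fin (n i))})
  have hS : ∀ o, IsClosed (S o) := by
    rintro (_ | i)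
    · exact (isClosed_boundary _).preimage (continuous_headBlock.comp cv)
    · exact (isClosed_boundary _).preimage ((continuous_block i).comp cv)
  refine (locallyFinite_of_finite S).continuous ?_ hS ?_
  · refine Set.eq_univ_of_forall fun z => Set.mem_iUnion.2 ?_
    rcases (mem_boundary_iff_blocks (h := hN)).1 z.2.2 with h | ⟨i, h⟩
    · exact ⟨none, h⟩
    · exact ⟨some i, h⟩
  · rintro (_ | i)
    · exact (continuousOn_const (c := W.base (M + t))).congr fun z hz =>
        Φ.productBdry_of_head hM hm hN hz
    · rw [continuousOn_iff_continuous_domRestrict]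
      have : CompactSpace (S (some i)) := isCompact_iff_compactSpace.1 (hS _).isCompact
      have c₁ : Continuous fun z : S (some i) => z.1.1 := continuous_fst.comp continuous_subtype_val
      have c₂ : Continuous fun z : S (some i) => z.1.2.1 := cv.comp continuous_subtype_val
      refine ((Φ.act (raise m t i) (M + t) (sum_raise m t i hM)
        (le_raise t i hm)).continuous_comp (K := S (some i))
        (φ := fun z => R z.1.1 (headBlock hN z.1.2.1))
        (ψ := fun z l => W.choosePoint (m l) t (decide (l = i))
          (fun hl => (α z.1.1 l).bdry ⟨block hN l z.1.2.1, (of_decide_eq_true hl).symm ▸ z.2⟩)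
          ((α z.1.1 l).disk (block hN l z.1.2.1)))
        (hR.comp (c₁.prodMk (continuous_headBlock.comp c₂)))
        (continuous_pi fun l => ?_)).congr fun z => ?_
      · refine Tower.continuous_choosePoint (b := decide (l = i))
          (hi := fun hl (z : S (some i)) => (α z.1.1 l).bdry
            ⟨block hN l z.1.2.1, (of_decide_eq_true hl).symm ▸ z.2⟩) (fun hl => ?_) ?_
        · exact (hα l).bdry.comp (c₁.prodMk (((continuous_block l).comp c₂).subtype_mk _))
        · exact (hα l).disk.comp (c₁.prodMk ((continuous_block l).comp c₂))
      · exact (Φ.productBdry_eq_face hM hm hN z.2).symm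

/-- The product of a map `(D^n₀, S^(n₀-1)) ⟶ (P(k), *)` and squares. -/
def TowerAction.product (ρ : GenLoop (Fin n₀) (P.space k) (P.base k))
    (α : ∀ i, W.Square t (m i) (n i)) : W.Square t M N where
  disk := ⟨fun x => Φ.act m M hM hm (ρ (headBlock hN x)) (fun i => (α i).disk (block hN i x)),
    (Φ.act m M hM hm).continuous_comp (ρ.1.continuous.comp continuous_headBlock)
      (continuous_pi fun i => (α i).disk.continuous.comp (continuous_block i))⟩
  bdry := ⟨fun x => Φ.productBdry hM hm hN ρ α x.1,
    (Φ.continuous_productBdry hM hm hN (T := Unit) (R := fun _ => ρ) (α := fun _ => α)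
      (ρ.1.continuous.comp continuous_snd) (fun i => RelSphere.isFamily_const (α i))).comp
      (Continuous.prodMk_right ())⟩
  comm x := by
    change W.qpow M t (Φ.productBdry hM hm hN ρ α x.1) = Φ.act m M hM hm _ _
    by_cases h : ∃ i, block hN i x.1 ∈ Cube.boundary (Fin (n i))
    · obtain ⟨i, hi⟩ := h
      rw [Φ.productBdry_eq_face hM hm hN hi, Φ.qpow_face]
    · have hx := ((mem_boundary_iff_blocks (h := hN)).1 x.2).resolve_right h
      rw [Φ.productBdry_of_head hM hm hN hx, W.qpow_base, GenLoop.boundary ρ _ hx,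
        (Φ.act m M hM hm).base_left]
  base x hx := by
    obtain ⟨c, hc⟩ := hx
    obtain ⟨a | ⟨i, a⟩, rfl⟩ := (cubeEquiv n₀ n N hN).surjective c
    · exact Φ.productBdry_of_head hM hm hN ⟨a, Or.inl hc⟩
    · exact (Φ.productBdry_eq_face hM hm hN ⟨a, Or.inl hc⟩).trans
        (Φ.face_of_zero hM hm (l := i) ⟨a, hc⟩)

theorem TowerAction.isProduct_product (ρ : GenLoop (Fin n₀) (P.space k) (P.base k))
    (α : ∀ i, W.Square t (m i) (n i)) :
    Φ.IsProduct m M hM hm hN ρ α (Φ.product hM hm hN ρ α) where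
  disk _ := rfl
  bdry_head _ hx := Φ.productBdry_of_head hM hm hN hx
  bdry_block _ _ hi := Φ.productBdry_eq_face hM hm hN hi

theorem TowerAction.product_homotopic {ρ ρ' : GenLoop (Fin n₀) (P.space k) (P.base k)}
    {α α' : ∀ i, W.Square t (m i) (n i)} (hρ : GenLoop.Homotopic ρ ρ')
    (hα : ∀ i, RelSphere.Homotopic (α i) (α' i)) :
    RelSphere.Homotopic (Φ.product hM hm hN ρ α) (Φ.product hM hm hN ρ' α') := by
  obtain ⟨H⟩ := hρ
  choose K hK hK0 hK1 using hα
  let R : I → GenLoop (Fin n₀) (P.space k) (P.base k) := fun τ =>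
    ⟨⟨fun x => H (τ, x), H.continuous.comp (Continuous.prodMk_right τ)⟩,
      fun x hx => (H.eq_fst τ hx).trans (ρ.2 x hx)⟩
  have F : RelSphere.IsFamily fun τ => Φ.product hM hm hN (R τ) (fun i => K i τ) := by
    constructor
    · exact (Φ.act m M hM hm).continuous_comp
        (H.continuous.comp (continuous_fst.prodMk (continuous_headBlock.comp continuous_snd)))
        (continuous_pi fun i => (hK i).disk.comp
          (continuous_fst.prodMk ((continuous_block i).comp continuous_snd)))
    · exact Φ.continuous_productBdry hM hm hN (R := R) (α := fun τ i => K i τ) H.continuous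
        fun i => ⟨(hK i).disk, (hK i).bdry⟩
  have e0 : R 0 = ρ := GenLoop.ext _ _ fun x => H.apply_zero x
  have e1 : R 1 = ρ' := GenLoop.ext _ _ fun x => H.apply_one x
  have := F.homotopic
  rw [e0, e1, funext hK0, funext hK1] at this
  exact this

theorem TowerAction.product_const_left (α : ∀ i, W.Square t (m i) (n i)) :
    Φ.product hM hm hN GenLoop.const α = RelSphere.const N _ _ :=
  RelSphere.eq_const fun _ => ⟨((Φ.act m M hM hm).base_left _).trans (W.qpow_base M t).symm,
    fun _ => Φ.productBdry_of_left hM hm hN rfl⟩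

theorem TowerAction.product_const_right (ρ : GenLoop (Fin n₀) (P.space k) (P.base k))
    {α : ∀ i, W.Square t (m i) (n i)} (hα : ∃ i, α i = RelSphere.const (n i) _ _) :
    Φ.product hM hm hN ρ α = RelSphere.const N _ _ := by
  obtain ⟨i, hi⟩ := hα
  refine RelSphere.eq_const fun x => ⟨?_, fun hx => ?_⟩
  · refine ((Φ.act m M hM hm).base_right _ _ ⟨i, ?_⟩).trans (W.qpow_base M t).symm
    rw [hi]
    exact W.qpow_base _ _
  · change Φ.productBdry hM hm hN ρ α x = _
    by_cases h : ∃ l, block hN l x ∈ Cube.boundary (Fin (n l))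
    · obtain ⟨l, hl⟩ := h
      rw [Φ.productBdry_eq_face hM hm hN hl]
      refine (Φ.act _ _ _ _).base_right _ _ ⟨i, Tower.choosePoint_base (fun _ => ?_) fun _ => ?_⟩
      · rw [hi]
        rfl
      · rw [hi]
        exact W.qpow_base _ _
    · exact Φ.productBdry_of_head hM hm hN
        (((mem_boundary_iff_blocks (h := hN)).1 hx).resolve_right h)

/-- A product is determined by the values of its factors on the blocks, also on the boundary; if `x`
lies on no face of the squares, both sides are trivial because `ρ` is. Both additivity statements
reduce to this. -/
theorem TowerAction.product_eqAt_precomp {ρ ρ' : GenLoop (Fin n₀) (P.space k) (P.base k)}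
    {α α' : ∀ i, W.Square t (m i) (n i)} {φ : CubeMap N} {x : Fin N → I}
    (hρ : ρ (headBlock hN x) = ρ' (headBlock hN (φ x)))
    (hα : ∀ i, (α i).disk (block hN i x) = (α' i).disk (block hN i (φ x)) ∧
      ∀ hi : block hN i x ∈ Cube.boundary (Fin (n i)),
        ∃ hi' : block hN i (φ x) ∈ Cube.boundary (Fin (n i)),
          (α i).bdry ⟨_, hi⟩ = (α' i).bdry ⟨_, hi'⟩) :
    RelSphere.EqAt (Φ.product hM hm hN ρ α) ((Φ.product hM hm hN ρ' α').precomp φ) x := by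
  constructor
  · change Φ.act m M hM hm _ _ = Φ.act m M hM hm _ _
    rw [hρ]
    congr 1
    exact funext fun i => (hα i).1
  · intro hx
    change Φ.productBdry hM hm hN ρ α x = Φ.productBdry hM hm hN ρ' α' (φ x)
    by_cases h : ∃ l, block hN l x ∈ Cube.boundary (Fin (n l))
    · obtain ⟨i, hi⟩ := h
      obtain ⟨hi', hb⟩ := (hα i).2 hi
      rw [Φ.productBdry_eq_face hM hm hN hi, Φ.productBdry_eq_face hM hm hN hi']
      exact Φ.face_congr hM hm hρ (fun l => (hα l).1) hb
    · have hh := ((mem_boundary_iff_blocks (h := hN)).1 hx).resolve_right h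
      rw [Φ.productBdry_of_head hM hm hN hh,
        Φ.productBdry_of_left hM hm hN (hρ.symm.trans (ρ.2 _ hh))]

end Product

/-! ### Additivity, equivariance and unit for products of squares -/

section Laws

variable {P : PointedOperad.{u}} {W : Tower.{u}} {s : ℕ} (Φ : TowerAction P W s) {t : ℕ} {k : ℕ+}
  {m : Fin k → ℕ} {M : ℕ} (hM : ∑ i, m i = M) (hm : ∀ i, s ≤ m i) {n₀ : ℕ} {n : Fin k → ℕ}
  {N : ℕ} (hN : n₀ + ∑ i, n i = N)

theorem TowerAction.product_baseAt_of_head {ρ : GenLoop (Fin n₀) (P.space k) (P.base k)}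
    {α : ∀ i, W.Square t (m i) (n i)} {x : Fin N → I}
    (hx : headBlock hN x ∈ Cube.boundary (Fin n₀)) :
    RelSphere.BaseAt (Φ.product hM hm hN ρ α) x := by
  refine ⟨?_, fun _ => Φ.productBdry_of_head hM hm hN hx⟩
  change Φ.act m M hM hm _ _ = _
  rw [GenLoop.boundary ρ _ hx, (Φ.act m M hM hm).base_left, W.qpow_base]

/-- A product is trivial on the whole face of the head disk, also at the end `1` of the coordinate
`a`, which is why concatenation along this single coordinate is defined. -/
theorem TowerAction.product_transAt (a : Fin n₀)
    (ρ ρ' : GenLoop (Fin n₀) (P.space k) (P.base k)) (α : ∀ i, W.Square t (m i) (n i)) :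
    Φ.product hM hm hN (GenLoop.transAt a ρ' ρ) α =
      RelSphere.concatAt (cubeEquiv n₀ n N hN (Sum.inl a)) (Φ.product hM hm hN ρ α)
        (Φ.product hM hm hN ρ' α)
        (fun _ hx => Φ.product_baseAt_of_head hM hm hN ⟨a, Or.inr hx⟩) := by
  have hb : ∀ {p q : ℝ} (hq : 0 ≤ q) (hp : q + 1 ≤ p) (x : Fin N → I) (i : Fin k),
      block hN i (RelSphere.coordMap (cubeEquiv n₀ n N hN (Sum.inl a)) p q hq hp x) = block hN i x :=
    fun _ _ x i => block_update_inl x a _ i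
  have hh : ∀ {p q : ℝ} (hq : 0 ≤ q) (hp : q + 1 ≤ p) (x : Fin N → I),
      headBlock hN (RelSphere.coordMap (cubeEquiv n₀ n N hN (Sum.inl a)) p q hq hp x) =
        Function.update (headBlock hN x) a
          (Set.projIcc 0 1 zero_le_one (p * (headBlock hN x a : ℝ) - q)) :=
    fun _ _ x => headBlock_update_inl x a _
  refine RelSphere.ext_eqAt fun x => ?_
  rcases le_or_gt (x (cubeEquiv n₀ n N hN (Sum.inl a)) : ℝ) (1 / 2) with hx | hx
  · refine RelSphere.EqAt.trans ?_ (RelSphere.glue_eqAt_of_le (sub_nonpos.2 hx)).symm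
    refine Φ.product_eqAt_precomp hM hm hN ?_ fun i => ?_
    · rw [hh, sub_zero]
      exact if_pos hx
    · rw [hb]
      exact ⟨rfl, fun hi => ⟨hi, rfl⟩⟩
  · refine RelSphere.EqAt.trans ?_ (RelSphere.glue_eqAt_of_lt (sub_pos.2 hx)).symm
    refine Φ.product_eqAt_precomp hM hm hN ?_ fun i => ?_
    · rw [hh]
      exact if_neg hx.not_ge
    · rw [hb]
      exact ⟨rfl, fun hi => ⟨hi, rfl⟩⟩

theorem block_stretch {i : Fin k} {a b : Fin (n i)} (hab : a ≠ b)
    (hab' : cubeEquiv n₀ n N hN (Sum.inr ⟨i, a⟩) ≠ cubeEquiv n₀ n N hN (Sum.inr ⟨i, b⟩))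
    {p q : ℝ} {hq : 0 ≤ q} {hp : q + 1 ≤ p} (x : Fin N → I) :
    block hN i (stretch hab' p q hq hp x) = stretch hab p q hq hp (block hN i x) := by
  rw [stretch_apply, stretch_apply, setPair, setPair, block_update_inr, block_update_inr]
  rfl

theorem headBlock_stretch {i : Fin k} {a b : Fin (n i)}
    (hab' : cubeEquiv n₀ n N hN (Sum.inr ⟨i, a⟩) ≠ cubeEquiv n₀ n N hN (Sum.inr ⟨i, b⟩))
    {p q : ℝ} {hq : 0 ≤ q} {hp : q + 1 ≤ p} (x : Fin N → I) :
    headBlock hN (stretch hab' p q hq hp x) = headBlock hN x := by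
  rw [stretch_apply, setPair, headBlock_update_inr, headBlock_update_inr]

theorem block_stretch_of_ne {i l : Fin k} (hl : l ≠ i) {a b : Fin (n i)}
    (hab' : cubeEquiv n₀ n N hN (Sum.inr ⟨i, a⟩) ≠ cubeEquiv n₀ n N hN (Sum.inr ⟨i, b⟩))
    {p q : ℝ} {hq : 0 ≤ q} {hp : q + 1 ≤ p} (x : Fin N → I) :
    block hN l (stretch hab' p q hq hp x) = block hN l x := by
  rw [stretch_apply, setPair, block_update_inr_of_ne _ hl, block_update_inr_of_ne _ hl]

theorem TowerAction.product_update_eqAt {i : Fin k} {a b : Fin (n i)} (hab : a ≠ b)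
    (hab' : cubeEquiv n₀ n N hN (Sum.inr ⟨i, a⟩) ≠ cubeEquiv n₀ n N hN (Sum.inr ⟨i, b⟩))
    {p q : ℝ} {hq : 0 ≤ q} {hp : q + 1 ≤ p}
    (ρ : GenLoop (Fin n₀) (P.space k) (P.base k)) (α : ∀ i, W.Square t (m i) (n i))
    {β γ : W.Square t (m i) (n i)} {x : Fin N → I}
    (h : RelSphere.EqAt β (γ.precomp (stretch hab p q hq hp)) (block hN i x)) :
    RelSphere.EqAt (Φ.product hM hm hN ρ (Function.update α i β))
      ((Φ.product hM hm hN ρ (Function.update α i γ)).precomp (stretch hab' p q hq hp)) x := by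
  refine Φ.product_eqAt_precomp hM hm hN (by rw [headBlock_stretch]) fun l => ?_
  by_cases hl : l = i
  · subst hl
    rw [Function.update_self, Function.update_self, block_stretch hN hab hab']
    exact ⟨h.1, fun hi => ⟨(stretch hab p q hq hp).map_bdry _ hi, h.2 hi⟩⟩
  · rw [Function.update_of_ne hl, Function.update_of_ne hl, block_stretch_of_ne hN hl]
    exact ⟨rfl, fun hi => ⟨hi, rfl⟩⟩

/-- Both the cut and the maps `stretch` involve only the coordinates `a` and `b` of the block `i`,
so adding before and after multiplication is literally the same. -/
theorem TowerAction.product_addAt {i : Fin k} {a b : Fin (n i)} (hab : a ≠ b)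
    (hab' : cubeEquiv n₀ n N hN (Sum.inr ⟨i, a⟩) ≠ cubeEquiv n₀ n N hN (Sum.inr ⟨i, b⟩))
    (ρ : GenLoop (Fin n₀) (P.space k) (P.base k)) (α : ∀ i, W.Square t (m i) (n i))
    (β γ : W.Square t (m i) (n i)) :
    Φ.product hM hm hN ρ (Function.update α i (RelSphere.addAt hab β γ)) =
      RelSphere.addAt hab' (Φ.product hM hm hN ρ (Function.update α i β))
        (Φ.product hM hm hN ρ (Function.update α i γ)) := by
  refine RelSphere.ext_eqAt fun x => ?_
  rcases le_total (block hN i x a : ℝ) (block hN i x b) with hx | hx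
  · exact (Φ.product_update_eqAt hM hm hN hab hab' ρ α (RelSphere.addAt_eqAt_lower hab β γ hx)).trans
      (RelSphere.addAt_eqAt_lower hab' _ _ hx).symm
  · exact (Φ.product_update_eqAt hM hm hN hab hab' ρ α (RelSphere.addAt_eqAt_upper hab β γ hx)).trans
      (RelSphere.addAt_eqAt_upper hab' _ _ hx).symm

theorem TowerAction.product_perm (θ : Equiv.Perm (Fin k)) (hM' : ∑ i, m (θ i) = M)
    (hN' : n₀ + ∑ i, n (θ i) = N) (ρ : GenLoop (Fin n₀) (P.space k) (P.base k))
    (α : ∀ i, W.Square t (m i) (n i)) :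
    Φ.product hM hm hN (mapLoop (P.perm k θ) (P.perm_base k θ) ρ) α =
      RelSphere.permute (blockCubePerm θ hN hN')
        (Φ.product hM' (fun i => hm (θ i)) hN' ρ (fun i => α (θ i))) := by
  refine RelSphere.ext_eqAt fun x => ⟨?_, fun hx => ?_⟩
  · change Φ.act m M hM hm (P.perm k θ _) _ = Φ.act _ M hM' _ _ _
    rw [headBlock_comp_blockCubePerm]
    simp only [block_comp_blockCubePerm]
    exact Φ.equivariance _ _ _ _ _ _ _ _ _
  · change Φ.productBdry hM hm hN _ α x = Φ.productBdry hM' _ hN' ρ _ _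
    by_cases h : ∃ i, block hN (θ i) x ∈ Cube.boundary (Fin (n (θ i)))
    · obtain ⟨i, hi⟩ := h
      have hi' : block hN' i (fun c => x (blockCubePerm θ hN hN' c)) ∈
          Cube.boundary (Fin (n (θ i))) := by
        rw [block_comp_blockCubePerm]
        exact hi
      rw [Φ.productBdry_eq_face hM hm hN hi, Φ.productBdry_eq_face hM' _ hN' hi']
      refine Tower.point_inj ?_
      rw [Φ.mk_face, Φ.mk_face, mapLoop_apply, Φ.actPoint_perm]
      · simp only [headBlock_comp_blockCubePerm, block_comp_blockCubePerm]
        refine congrArg (Φ.actPoint _) (funext fun l => ?_)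
        by_cases hl : l = i
        · subst hl
          rw [Function.update_self, Function.update_self]
        · rw [Function.update_of_ne hl, Function.update_of_ne fun h => hl (θ.injective h)]
      · intro l
        by_cases hl : l = θ i
        · subst hl
          rw [Function.update_self]
          exact (hm _).trans (Nat.le_add_right _ _)
        · rw [Function.update_of_ne hl]
          exact hm l
    · have hh := ((mem_boundary_iff_blocks (h := hN)).1 hx).resolve_right fun ⟨l, hl⟩ =>
        h ⟨θ.symm l, by rw [Equiv.apply_symm_apply]; exact hl⟩
      rw [Φ.productBdry_of_head hM hm hN hh, Φ.productBdry_of_head]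
      rw [headBlock_comp_blockCubePerm]
      exact hh

theorem TowerAction.product_one (hΦ : Φ.Unital) {m n : ℕ} (hm : s ≤ m)
    (hM : ∑ _i : Fin (1 : ℕ+), m = m) (hN : 0 + ∑ _i : Fin (1 : ℕ+), n = n)
    {ι : GenLoop (Fin 0) (P.space 1) (P.base 1)} (hι : ∀ x, ι x = P.one)
    (α : W.Square t m n) :
    Φ.product hM (fun _ => hm) hN ι (fun _ => α) = α := by
  have hb : ∀ (x : Fin n → I) (i : Fin (1 : ℕ+)), block hN i x = x := fun x i =>
    block_eq_self (Nat.lt_one_iff.1 i.2) x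
  have hsub : ∀ i j : Fin (1 : ℕ+), i = j := fun i j => Fin.ext
    ((Nat.lt_one_iff.1 i.2).trans (Nat.lt_one_iff.1 j.2).symm)
  refine RelSphere.ext_eqAt fun x => ⟨?_, fun hx => ?_⟩
  · change Φ.act _ _ _ _ _ _ = _
    rw [hι]
    simp only [hb]
    exact hΦ _ _ _ _
  · change Φ.productBdry _ _ hN _ _ x = _
    have hi : block hN ⟨0, Nat.one_pos⟩ x ∈ Cube.boundary (Fin n) := by rwa [hb]
    rw [Φ.productBdry_eq_face _ _ hN hi]
    -- The boundary map takes values in `W (m+t)`, so the unit condition is needed there as well.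
    have h1 : ∑ _i : Fin (1 : ℕ+), (m + t) = m + t := by
      change ∑ _i : Fin 1, (m + t) = m + t
      simp
    refine Tower.point_inj ?_
    refine Eq.trans ?_ (congrArg (Sigma.mk (m + t))
      (hΦ (m + t) (hm.trans (Nat.le_add_right _ _)) h1 (α.bdry ⟨x, hx⟩)))
    rw [Φ.mk_face, Φ.mk_act, hι]
    refine congrArg (Φ.actPoint _) (funext fun l => ?_)
    rw [hsub l ⟨0, Nat.one_pos⟩, Function.update_self]
    simp only [hb]

end Laws

/-! ### Associativity, and passage to homotopy classes -/

section Algebra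

variable {P : PointedOperad.{u}} {W : Tower.{u}} {s : ℕ} (Φ : TowerAction P W s) {t : ℕ}

/-- On disks this is associativity of the action. A boundary point lies on the face of an innermost
square, where associativity is applied with that factor lifted, or on the face of `ρ` or of some `η
i`, where both sides are trivial. -/
theorem TowerAction.product_assoc {k : ℕ+} (j : Fin k → ℕ+) (l : ℕ+)
    (hl : ∑ i, (j i : ℕ) = l) {m : ∀ i, Fin (j i) → ℕ} (hm : ∀ i b, s ≤ m i b)
    {M : Fin k → ℕ} (hM : ∀ i, ∑ b, m i b = M i) (hM' : ∀ i, s ≤ M i)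
    {T : ℕ} (hT : ∑ i, M i = T)
    (hT' : ∑ e : Fin l, m ((lexEquiv (fun i => (j i : ℕ)) l hl).symm e).1
      ((lexEquiv (fun i => (j i : ℕ)) l hl).symm e).2 = T)
    {a₀ : ℕ} {a : Fin k → ℕ} {A : ℕ} (hA : a₀ + ∑ i, a i = A)
    {n : ∀ i, Fin (j i) → ℕ} {N : Fin k → ℕ} (hN : ∀ i, a i + ∑ b, n i b = N i)
    {D : ℕ} (hD : a₀ + ∑ i, N i = D)
    (hD' : A + ∑ e : Fin l, n ((lexEquiv (fun i => (j i : ℕ)) l hl).symm e).1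
      ((lexEquiv (fun i => (j i : ℕ)) l hl).symm e).2 = D)
    (ρ : GenLoop (Fin a₀) (P.space k) (P.base k))
    (η : ∀ i, GenLoop (Fin (a i)) (P.space (j i)) (P.base (j i)))
    (ζ : ∀ i b, W.Square t (m i b) (n i b)) :
    Φ.product hT' (fun _ => hm _ _) hD' (smashLoop (P.comp j l hl) hA ρ η)
        (fun e => ζ ((lexEquiv (fun i => (j i : ℕ)) l hl).symm e).1
          ((lexEquiv (fun i => (j i : ℕ)) l hl).symm e).2) =
      RelSphere.permute (shufflePerm hl hA hN hD hD')
        (Φ.product hT hM' hD ρ (fun i => Φ.product (hM i) (hm i) (hN i) (η i) (ζ i))) := by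
  refine RelSphere.ext_eqAt fun x => ⟨?_, fun hx => ?_⟩
  · change Φ.act _ T hT' _ (P.comp j l hl _ _) _ =
      Φ.act M T hT hM' _ (fun i => Φ.act (m i) (M i) (hM i) (hm i) _ _)
    simp only [headBlock_comp_shufflePerm, headBlock_block_comp_shufflePerm]
    rw [← Φ.assoc j l hl m hm M hM hM' T hT hT']
    simp only [block_block_comp_shufflePerm]
  · set y : Fin D → I := fun c => x (shufflePerm hl hA hN hD hD' c)
    change Φ.productBdry hT' _ hD' _ _ x = Φ.productBdry hT hM' hD ρ _ y
    have h₀ : headBlock hD y = headBlock hA (headBlock hD' x) :=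
      headBlock_comp_shufflePerm hl hA hN hD hD' x
    have h₁ : ∀ i, headBlock (hN i) (block hD i y) = block hA i (headBlock hD' x) :=
      headBlock_block_comp_shufflePerm hl hA hN hD hD' x
    have h₂ : ∀ e : Fin l, block (hN _) ((lexEquiv (fun i => (j i : ℕ)) l hl).symm e).2
        (block hD ((lexEquiv (fun i => (j i : ℕ)) l hl).symm e).1 y) = block hD' e x :=
      block_block_comp_shufflePerm hl hA hN hD hD' x
    by_cases h : ∃ e, block hD' e x ∈ Cube.boundary (Fin _)
    · obtain ⟨e, he⟩ := h
      let L := lexEquiv (fun i => (j i : ℕ)) l hl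
      have hc : block (hN (L.symm e).1) (L.symm e).2 (block hD (L.symm e).1 y) ∈
          Cube.boundary (Fin (n (L.symm e).1 (L.symm e).2)) := (h₂ e).symm ▸ he
      have hi : block hD (L.symm e).1 y ∈ Cube.boundary (Fin (N (L.symm e).1)) :=
        (mem_boundary_iff_blocks (h := hN _)).2 (Or.inr ⟨_, hc⟩)
      -- The points to which the innermost action is applied: disk values, except for the factor
      -- indexed by `e`, which is lifted by its boundary map.
      let w : (Σ i, Fin (j i)) → W.Point := Function.update
        (fun c => ⟨m c.1 c.2, (ζ c.1 c.2).disk (block (hN c.1) c.2 (block hD c.1 y))⟩)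
        (L.symm e) ⟨_, (ζ (L.symm e).1 (L.symm e).2).bdry ⟨_, hc⟩⟩
      have hw₁ : w (L.symm e) = ⟨_, (ζ (L.symm e).1 (L.symm e).2).bdry ⟨_, hc⟩⟩ :=
        Function.update_self _ _ _
      have hw₂ : ∀ c, c ≠ L.symm e → w c =
          ⟨m c.1 c.2, (ζ c.1 c.2).disk (block (hN c.1) c.2 (block hD c.1 y))⟩ := fun c h =>
        Function.update_of_ne h _ _
      have hw : ∀ c, s ≤ (w c).1 := by
        intro c
        by_cases h : c = L.symm e
        · rw [h, hw₁]
          exact (hm _ _).trans (Nat.le_add_right _ _)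
        · rw [hw₂ c h]
          exact hm _ _
      rw [Φ.productBdry_eq_face hT' _ hD' he, Φ.productBdry_eq_face hT hM' hD hi]
      refine Tower.point_inj ?_
      rw [Φ.mk_face, Φ.mk_face, smashLoop_apply, h₀]
      refine Eq.trans (congrArg (Φ.actPoint _) (funext fun e' => ?_))
        ((Φ.actPoint_comp j l hl _ _ w hw).trans (congrArg (Φ.actPoint _) (funext fun i => ?_)))
      · by_cases h : e' = e
        · subst h
          simp only [Function.update_self, ← h₂]
          exact hw₁.symm
        · rw [Function.update_of_ne h]
          simp only [← h₂]
          exact (hw₂ (L.symm e') fun h' => h (L.symm.injective h')).symm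
      · rw [← h₁]
        by_cases h : i = (L.symm e).1
        · subst h
          rw [Function.update_self]
          change _ = (⟨_, Φ.productBdry (hM _) (hm _) (hN _) (η _) (ζ _) _⟩ : W.Point)
          rw [Φ.productBdry_eq_face _ _ _ hc, Φ.mk_face]
          refine congrArg (Φ.actPoint _) (funext fun b => ?_)
          by_cases h : b = (L.symm e).2
          · subst h
            rw [Function.update_self]
            exact hw₁
          · rw [Function.update_of_ne h]
            exact hw₂ ⟨_, b⟩ fun h' =>
              h (eq_of_heq (Sigma.mk.inj (h'.trans (Sigma.eta (L.symm e)).symm)).2)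
        · rw [Function.update_of_ne h]
          refine Eq.trans (congrArg (Φ.actPoint _) (funext fun b => ?_)) (Φ.mk_act _ _ _ _ _ _).symm
          exact hw₂ ⟨i, b⟩ fun h' => h (congrArg Sigma.fst h')
    · have hh := ((mem_boundary_iff_blocks (h := hD')).1 hx).resolve_right h
      rw [Φ.productBdry_of_head hT' _ hD' hh]
      -- The point lies on the face of the composed operation. In the nested product this is either
      -- the face of `ρ`, or the face of the `i`-th inner product, whose boundary map is trivial
      -- there because `η i` is.
      rcases (mem_boundary_iff_blocks (h := hA)).1 hh with hh | ⟨i, hi⟩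
      · exact (Φ.productBdry_of_head hT hM' hD (h₀ ▸ hh)).symm
      · have hi' : headBlock (hN i) (block hD i y) ∈ Cube.boundary (Fin (a i)) := h₁ i ▸ hi
        rw [Φ.productBdry_eq_face hT hM' hD
          ((mem_boundary_iff_blocks (h := hN i)).2 (Or.inl hi')), Φ.face_of_bdry]
        exact Φ.productBdry_of_head (hM i) (hm i) (hN i) hi'

/-- A representative of an element of a relative homotopy group. -/
def Tower.rep {m n : ℕ} (x : (W.relPi t m).carrier n) : W.Square t m n :=
  Quotient.out (s := RelSphere.setoid _ _ _) x

theorem Tower.cls_rep {m n : ℕ} (x : (W.relPi t m).carrier n) : W.cls (Tower.rep x) = x :=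
  Quotient.out_eq (s := RelSphere.setoid _ _ _) x

theorem Tower.cls_eq_iff {m n : ℕ} {α β : W.Square t m n} :
    W.cls α = W.cls β ↔ RelSphere.Homotopic α β :=
  Quotient.eq (r := RelSphere.setoid _ _ _)

theorem Tower.rep_cls {m n : ℕ} (α : W.Square t m n) :
    RelSphere.Homotopic (Tower.rep (W.cls α)) α :=
  Tower.cls_eq_iff.1 (Tower.cls_rep _)

theorem Tower.update_cls {k : ℕ+} {m n : Fin k → ℕ} (α : ∀ i, W.Square t (m i) (n i)) (i : Fin k)
    (β : W.Square t (m i) (n i)) :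
    Function.update (β := fun i => (W.relPi t (m i)).carrier (n i)) (fun i => W.cls (α i)) i
      (W.cls β) = fun c => W.cls (Function.update α i β c) := by
  funext c
  by_cases h : c = i
  · subst h
    exact (Function.update_self _ _ _).trans (congrArg W.cls (by rw [Function.update_self]))
  · exact (Function.update_of_ne h _ _).trans
      (congrArg W.cls (Function.update_of_ne h _ _).symm)

theorem Tower.exists_cls {k : ℕ+} {m n : Fin k → ℕ}
    (y : ∀ i, (W.relPi t (m i)).carrier (n i)) :
    ∃ α : ∀ i, W.Square t (m i) (n i), (fun i => W.cls (α i)) = y :=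
  ⟨fun i => Tower.rep (y i), funext fun i => Tower.cls_rep (y i)⟩

theorem PointedOperad.exists_rep {k : ℕ+} {n : ℕ} (x : (P.pi k).carrier n) : ∃ ρ, P.cls ρ = x :=
  exists_loopCls x

/-- The action on homotopy groups. -/
def TowerAction.piAct {k : ℕ+} {m : Fin k → ℕ} {M : ℕ} (hM : ∑ i, m i = M) (hm : ∀ i, s ≤ m i)
    {n₀ : ℕ} {n : Fin k → ℕ} {N : ℕ} (hN : n₀ + ∑ i, n i = N)
    (x : (P.pi k).carrier n₀) (y : ∀ i, (W.relPi t (m i)).carrier (n i)) :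
    (W.relPi t M).carrier N :=
  W.cls (Φ.product hM hm hN (loopRep x) (fun i => Tower.rep (y i)))

theorem TowerAction.piAct_cls {k : ℕ+} {m : Fin k → ℕ} {M : ℕ} (hM : ∑ i, m i = M)
    (hm : ∀ i, s ≤ m i) {n₀ : ℕ} {n : Fin k → ℕ} {N : ℕ} (hN : n₀ + ∑ i, n i = N)
    (ρ : GenLoop (Fin n₀) (P.space k) (P.base k)) (α : ∀ i, W.Square t (m i) (n i)) :
    Φ.piAct hM hm hN (P.cls ρ) (fun i => W.cls (α i)) = W.cls (Φ.product hM hm hN ρ α) :=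
  Tower.cls_eq_iff.2 (Φ.product_homotopic hM hm hN (loopRep_loopCls ρ) fun i => Tower.rep_cls (α i))

/-- The algebra of relative homotopy groups over the operad of homotopy groups. -/
def TowerAction.piAlgebra (t : ℕ) : GradedAlgebra P.piOperad (W.relPi t) s where
  isGroup m := relHomotopyGroups_isGroup _ _
  act m M hM hm n₀ n hn N hN := Φ.piAct hM hm hN
  zero_act {k} m M hM hm n₀ n hn N hN y := by
    obtain ⟨α, rfl⟩ := Tower.exists_cls y
    refine (Φ.piAct_cls hM hm hN GenLoop.const α).trans ?_
    rw [Φ.product_const_left]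
    rfl
  act_zero {k} m M hM hm n₀ n hn N hN x y := by
    rintro ⟨i, hi⟩
    obtain ⟨ρ, rfl⟩ := P.exists_rep x
    obtain ⟨α, rfl⟩ := Tower.exists_cls y
    have e : (fun c => W.cls (Function.update α i (RelSphere.const (n i) _ _) c)) =
        fun c => W.cls (α c) := by
      rw [← Tower.update_cls]
      exact Function.update_eq_iff.2 ⟨hi.symm, fun _ _ => rfl⟩
    rw [← e, Φ.piAct_cls, Φ.product_const_right hM hm hN _ ⟨i, Function.update_self _ _ _⟩]
    rfl
  add_act {k} m M hM hm n₀ n hn N hN h₀ h x x' y := by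
    obtain ⟨ρ, rfl⟩ := P.exists_rep x
    obtain ⟨ρ', rfl⟩ := P.exists_rep x'
    obtain ⟨α, rfl⟩ := Tower.exists_cls y
    have e : (P.pi k).add h₀ (P.cls ρ) (P.cls ρ') = P.cls (GenLoop.transAt ⟨0, h₀⟩ ρ' ρ) :=
      homotopyGroups_add h₀ ⟨0, h₀⟩ ρ ρ'
    rw [e, Φ.piAct_cls, Φ.piAct_cls, Φ.piAct_cls, Φ.product_transAt]
    -- The first coordinate of the head block is coordinate `0` of the large cube, so it forms an
    -- increasing pair with coordinate `1`. This keeps the order of the summands right when the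
    -- target degree is `2`.
    have h0 : cubeEquiv n₀ n N hN (Sum.inl ⟨0, h₀⟩) < ⟨1, h⟩ :=
      Fin.lt_def.2 (by rw [cubeEquiv_inl_val]; exact Nat.one_pos)
    exact (Tower.cls_eq_iff.2 ((RelSphere.add_homotopic_addAt h h0.ne (fun _ => h0) _ _).trans
      (RelSphere.addAt_homotopic_concatAt h0.ne _ _ _))).symm
  act_add {k} m M hM hm n₀ n hn N hN i hi h x y z z' := by
    obtain ⟨ρ, rfl⟩ := P.exists_rep x
    obtain ⟨α, rfl⟩ := Tower.exists_cls y
    obtain ⟨β, rfl⟩ : ∃ β, W.cls β = z := ⟨_, Tower.cls_rep z⟩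
    obtain ⟨γ, rfl⟩ : ∃ γ, W.cls γ = z' := ⟨_, Tower.cls_rep z'⟩
    have e : (W.relPi t (m i)).add hi (W.cls β) (W.cls γ) = W.cls (RelSphere.add hi β γ) := rfl
    rw [e, Tower.update_cls, Tower.update_cls, Tower.update_cls, Φ.piAct_cls, Φ.piAct_cls,
      Φ.piAct_cls, RelSphere.add_eq_addAt]
    -- The first two coordinates of block `i` keep their order in the large cube, so the sum along
    -- them represents the sum in the target even in degree `2`.
    have h01 : cubeEquiv n₀ n N hN (Sum.inr ⟨i, ⟨0, by omega⟩⟩) <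
        cubeEquiv n₀ n N hN (Sum.inr ⟨i, ⟨1, by omega⟩⟩) := by
      rw [Fin.lt_def, cubeEquiv_inr_val, cubeEquiv_inr_val, finSigmaFinEquiv_apply,
        finSigmaFinEquiv_apply]
      simp
    rw [Φ.product_addAt hM hm hN _ h01.ne]
    exact (Tower.cls_eq_iff.2 (RelSphere.add_homotopic_addAt h h01.ne (fun _ => h01) _ _)).symm
  equivariance {k} m M hM hm n₀ n hn N hN θ hM' hN' x y := by
    obtain ⟨ρ, rfl⟩ := P.exists_rep x
    obtain ⟨α, rfl⟩ := Tower.exists_cls y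
    have e : P.piOperad.perm k θ (P.cls ρ) =
      P.cls (mapLoop (P.perm k θ) (P.perm_base k θ) ρ) := P.piPerm_cls k θ ρ
    rw [e, Φ.piAct_cls, Φ.piAct_cls _ _ hN' ρ (fun i => α (θ i)), Φ.product_perm hM hm hN θ hM' hN',
      ← sign_blockCubePerm (h := hN) (h' := hN')]
    exact relHomotopyGroups_permute _ _
  assoc {k} j l hl m hm M hM hM' T hT hT' a₀ a A hA n hn N hN hN' D hD hD' x y z := by
    obtain ⟨ρ, rfl⟩ := P.exists_rep x
    obtain ⟨η, rfl⟩ := P.exists_cls y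
    obtain ⟨ζ, rfl⟩ : ∃ ζ : ∀ i b, W.Square t (m i b) (n i b),
        (fun i b => W.cls (ζ i b)) = z :=
      ⟨fun i b => Tower.rep (z i b), funext fun i => funext fun b => Tower.cls_rep (z i b)⟩
    have e : P.piOperad.comp j l hl A hA (P.cls ρ) (fun i => loopCls (η i)) =
      P.cls (smashLoop (P.comp j l hl) hA ρ η) := P.piComp_cls j l hl A hA ρ η
    have e' : ∀ i, Φ.piAct (hM i) (hm i) (hN i) (loopCls (η i)) (fun b => W.cls (ζ i b)) =
      W.cls (Φ.product (hM i) (hm i) (hN i) (η i) (ζ i)) := fun i => Φ.piAct_cls _ _ _ _ _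
    simp only [e']
    rw [e, Φ.piAct_cls hT' _ hD' _ (fun e => ζ ((lexEquiv (fun i => (j i : ℕ)) l hl).symm e).1
          ((lexEquiv (fun i => (j i : ℕ)) l hl).symm e).2), Φ.piAct_cls,
      Φ.product_assoc j l hl hm hM hM' hT hT' hA hN hD hD', ← sign_shufflePerm hl hA hN hD hD']
    exact relHomotopyGroups_permute _ _

theorem TowerAction.piAlgebra_unital (hΦ : Φ.Unital) (t : ℕ) : (Φ.piAlgebra t).Unital := by
  intro m hm hM n hn hN y
  obtain ⟨α, rfl⟩ : ∃ α, W.cls α = y := ⟨_, Tower.cls_rep y⟩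
  exact (Φ.piAct_cls hM (fun _ => hm) hN _ (fun _ => α)).trans
    (congrArg W.cls (Φ.product_one hΦ hm hM hN (fun _ => rfl) α))

end Algebra

end OperadTower

end

theorem propositionp (P : OperadTower.PointedOperad.{u}) (W : OperadTower.Tower.{u}) (s : ℕ)
    (Φ : OperadTower.TowerAction P W s) (t : ℕ) (ht : 1 ≤ t) :
    ∃ O : OperadTower.GradedOperad P.pi,
      (∀ (k : ℕ+) (n : ℕ) (θ : Equiv.Perm (Fin k)) (ρ : GenLoop (Fin n) (P.space k) (P.base k)),
        ∃ ρ' : GenLoop (Fin n) (P.space k) (P.base k),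
          (∀ x, ρ' x = P.perm k θ (ρ x)) ∧ O.perm k θ (P.cls ρ) = P.cls ρ') ∧
      (∃ ι : GenLoop (Fin 0) (P.space 1) (P.base 1), (∀ x, ι x = P.one) ∧ O.one = P.cls ι) ∧
      (∀ (k : ℕ+) (j : Fin k → ℕ+) (l : ℕ+) (hl : ∑ i, (j i : ℕ) = l) (a₀ : ℕ) (a : Fin k → ℕ)
        (A : ℕ) (hA : a₀ + ∑ i, a i = A) (ρ : GenLoop (Fin a₀) (P.space k) (P.base k))
        (η : ∀ i, GenLoop (Fin (a i)) (P.space (j i)) (P.base (j i))),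
        ∃ γ : GenLoop (Fin A) (P.space l) (P.base l), P.IsComp j l hl hA ρ η γ ∧
          O.comp j l hl A hA (P.cls ρ) (fun i => P.cls (η i)) = P.cls γ) ∧
      ∃ Γ : OperadTower.GradedAlgebra O (W.relPi t) s,
        (∀ (k : ℕ+) (m : Fin k → ℕ) (M : ℕ) (hM : ∑ i, m i = M) (hm : ∀ i, s ≤ m i) (n₀ : ℕ)
          (n : Fin k → ℕ) (hn : ∀ i, 1 ≤ n i) (N : ℕ) (hN : n₀ + ∑ i, n i = N)
          (ρ : GenLoop (Fin n₀) (P.space k) (P.base k)) (α : ∀ i, W.Square t (m i) (n i)),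
          ∃ β : W.Square t M N, Φ.IsProduct m M hM hm hN ρ α β ∧
            Γ.act m M hM hm hn N hN (P.cls ρ) (fun i => W.cls (α i)) = W.cls β) ∧
        (Φ.Unital → Γ.Unital) := by
  refine ⟨P.piOperad, fun k n θ ρ => ⟨OperadTower.mapLoop (P.perm k θ) (P.perm_base k θ) ρ,
    fun _ => rfl, P.piPerm_cls k θ ρ⟩, ⟨_, fun _ => rfl, rfl⟩,
    fun k j l hl a₀ a A hA ρ η => ⟨OperadTower.smashLoop (P.comp j l hl) hA ρ η, fun _ => rfl,
      P.piComp_cls j l hl A hA ρ η⟩, Φ.piAlgebra t,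
    fun k m M hM hm n₀ n _ N hN ρ α => ⟨Φ.product hM hm hN ρ α, Φ.isProduct_product hM hm hN ρ α,
      Φ.piAct_cls hM hm hN ρ α⟩, fun hΦ => Φ.piAlgebra_unital hΦ t⟩
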